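/- Let $2 \le d \le m$ be integers and let $\mathcal M\subset\mathbb R^m$ be a $d$-dimensional $C^2$ submanifold (without boundary): $\mathcal M$ is nonempty and each of its points lies in $g(U)$ for some chart $(U,g)$, i.e. an open $U\subset\mathbb R^d$ and a $C^2$ injection $g:U\to\mathbb R^m$ with $g(U)\subset \mathcal M$, open as a map into $\mathcal M$, with $g'(u)$ of full rank for all $u\in U$. Let $v$ be the Riemannian volume on $\mathcal M$, ${\rm dist}(x,y)\in[0,\infty]$ the geodetic distance (the infimum of the lengths of $C^1$ paths in $\mathcal M$ from $x$ to $y$), and $B(x,r)=\{y\in\mathcal M:{\rm dist}(x,y)\le r\}$. For $D\subset\mathcal M$ let $D^o$ be its interior relative to $\mathcal M$ and $\partial D=\overline D\setminus D^o$, with closures in $\mathcal M$. Let $A\subset\mathcal M$ be a compact $d$-dimensional $C^2$ submanifold-with-boundary of $\mathcal M$: for each $y\in\partial A$ there is a chart $(U,g)$ of $\mathcal M$ with $0\in U$, $g(0)=y$ and $g(U\cap(\mathbb R^{d-1}\times[0,\infty)))=g(U)\cap A$ (possibly $\partial A=\emptyset$). Let $B\subset A$ be closed. Let $f\ge 0$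 be a probability density on $\mathcal M$ with respect to $v$ which vanishes on $\mathcal M\setminus A$, let $\mu$ be the measure with density $f$, and let $X_1,X_2,\dots$ be independent random points with common distribution $\mu$; set $\mathcal X_n=\{X_1,\dots,X_n\}$. For $r>0$ let $A^{(r)}=\{x\in A: B(x,r)\subset A^o\}$, and for integers $n,k\ge 1$ set $$R_{n,k}=\inf\{r>0:\#(\mathcal X_n\cap B(x,r))\ge k\ \ \forall x\in B\},$$ $$\tilde R_{n,k}=\inf\{r>0:\#(\mathcal X_n\cap B(x,r))\ge k\ \ \forall x\in B\cap A^{(r)}\},$$ with $\inf\emptyset=+\infty$. Let $\theta_d=\pi^{d/2}/\Gamma(1+d/2)$ and $f_0=\inf_{x\in B}f(x)$. Let $H(0)=1$, $H(t)=1-t+t\log t$ for $t>0$, and for $a\in[0,\infty)$ and $x\ge 0$ let $\hat H_a(x)$ be the unique $y\ge a$ with $yH(a/y)=x$ (with $\hat H_0(0)=0$). Suppose that $\mu(B)>0$, that $B=\overline{B^o}$, and that $f|_A$ is continuous on $A$. Let $\beta\in[0,\infty]$ and let $(k(n))_{n\ge1}$ be a sequence of positive integers with $k(n)/\log n\to\beta$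 and $k(n)/n\to0$ as $n\to\infty$. Then, almost surely, with limits in $[0,\infty]$ and the convention $c/0=+\infty$ for $c>0$, $$\lim_{n\to\infty}\frac{n\theta_d\tilde R_{n,k(n)}^d}{k(n)}=\frac1{f_0}\quad\text{if }\beta=\infty,\qquad \lim_{n\to\infty}\frac{n\theta_d\tilde R_{n,k(n)}^d}{\log n}=\frac{\hat H_\beta(1)}{f_0}\quad\text{if }\beta<\infty.$$ In particular, if $f_0>0$ and $k\ge1$ is a constant integer, then almost surely $\lim_{n\to\infty} n\theta_d f_0\tilde R_{n,k}^d/\log n=1$. If moreover $B\subset A^o$, all of these statements also hold with $R_{n,k(n)}$ and $R_{n,k}$ in place of $\tilde R_{n,k(n)}$ and $\tilde R_{n,k}$. -/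

import Mathlib

open MeasureTheory ProbabilityTheory Filter Topology Set
open scoped ENNReal

noncomputable section

namespace Coverage

/-- The Euclidean space `ℝ^m`. -/
abbrev E (m : ℕ) : Type := EuclideanSpace ℝ (Fin m)

/-! ### Submanifolds of Euclidean space -/

/-- A `C²` chart `(U, g)` of dimension `d` of a subset `M` of `ℝ^m`: `g` is a `C²` injection of the
open set `U ⊆ ℝ^d` into `M`, open as a map into `M`, with derivative of full rank. -/
structure Chart {m : ℕ} (d : ℕ) (M : Set (E m)) where
  U : Set (E d)
  g : E d → E m
  isOpen_U : IsOpen U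
  contDiffOn : ContDiffOn ℝ 2 g U
  injOn : Set.InjOn g U
  mapsTo : Set.MapsTo g U M
  openMap : ∀ W ⊆ U, IsOpen W → ∃ O : Set (E m), IsOpen O ∧ g '' W = M ∩ O
  fullRank : ∀ u ∈ U, Function.Injective (fderiv ℝ g u)

/-- The part `g(U)` of the manifold that a chart covers. -/
def Chart.image {m d : ℕ} {M : Set (E m)} (c : Chart d M) : Set (E m) := c.g '' c.U

/-- `M` is a `d`-dimensional `C²` submanifold (without boundary) of `ℝ^m`. -/
def IsC2Submanifold {m : ℕ} (d : ℕ) (M : Set (E m)) : Prop :=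
  M.Nonempty ∧ ∀ y ∈ M, ∃ c : Chart d M, y ∈ c.image

/-- The interior of `D` relative to `M`. -/
def relInterior {m : ℕ} (M D : Set (E m)) : Set (E m) := M \ closure (M \ D)

/-- The boundary of `D` relative to `M`. -/
def relBoundary {m : ℕ} (M D : Set (E m)) : Set (E m) := (closure D ∩ M) \ relInterior M D

/-- The half-space `ℝ^{d-1} × [0,∞)`: the last coordinate is nonnegative. -/
def halfSpace (d : ℕ) : Set (E d) := {u | ∀ i : Fin d, (i : ℕ) + 1 = d → 0 ≤ u i}

/-- `A` is a `d`-dimensional `C²` submanifold-with-boundary of `M`. -/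
def IsSubmanifoldWithBoundary {m : ℕ} (d : ℕ) (M A : Set (E m)) : Prop :=
  A ⊆ M ∧ ∀ y ∈ relBoundary M A, ∃ c : Chart d M,
    (0 : E d) ∈ c.U ∧ c.g 0 = y ∧ c.g '' (c.U ∩ halfSpace d) = c.image ∩ A

/-! ### Riemannian volume -/

/-- The `m × d` Jacobian matrix of `g` at `u`. -/
def jacobian {m d : ℕ} (g : E d → E m) (u : E d) : Matrix (Fin m) (Fin d) ℝ :=
  Matrix.of fun i j => fderiv ℝ g u (EuclideanSpace.single j 1) i

/-- The volume density `D_g = √det(Jᵀ J)`. -/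
def volDensity {m d : ℕ} (g : E d → E m) (u : E d) : ℝ :=
  Real.sqrt ((jacobian g u).transpose * jacobian g u).det

/-- The volume measure that a sequence of charts defines: the sum over `i` of the images under `g_i`
of the measures `ψ_i(g_i(u)) D_{g_i}(u) du` on `U_i`, for the partition of unity `(ψ_i)` formed by
the indicators of the sets `g_i(U_i) \ ⋃_{j<i} g_j(U_j)`. -/
def atlasVolume {m d : ℕ} {M : Set (E m)} (c : ℕ → Chart d M) : Measure (E m) :=
  Measure.sum fun i =>
    ((volume.restrict ((c i).U ∩ (c i).g ⁻¹' disjointed (fun j => (c j).image) i)).withDensity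
      fun u => ENNReal.ofReal (volDensity (c i).g u)).map (c i).g

theorem IsC2Submanifold.exists_atlas {m d : ℕ} {M : Set (E m)} (hM : IsC2Submanifold d M) :
    ∃ c : ℕ → Chart d M, M ⊆ ⋃ i, (c i).image := by
  obtain ⟨⟨y₀, hy₀⟩, h⟩ := hM
  choose c hc using fun y : M => h y y.2
  choose O hO hcO using fun y : M => (c y).openMap (c y).U subset_rfl (c y).isOpen_U
  obtain ⟨T, hT, hTO⟩ := TopologicalSpace.isOpen_iUnion_countable O hO
  have hcov : ∀ y : M, ∃ z ∈ T, (y : E m) ∈ O z := by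
    intro y
    have hy : (y : E m) ∈ ⋃ z, O z := by
      have hy' : (y : E m) ∈ (c y).g '' (c y).U := hc y
      rw [hcO y] at hy'
      exact mem_iUnion.2 ⟨y, hy'.2⟩
    rw [← hTO] at hy
    simpa using hy
  obtain ⟨z₀, hz₀, -⟩ := hcov ⟨y₀, hy₀⟩
  obtain ⟨e, he⟩ := hT.exists_eq_range ⟨z₀, hz₀⟩
  refine ⟨fun i => c (e i), fun y hy => ?_⟩
  obtain ⟨z, hz, hyz⟩ := hcov ⟨y, hy⟩
  rw [he] at hz
  obtain ⟨i, rfl⟩ := hz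
  refine mem_iUnion.2 ⟨i, ?_⟩
  rw [Chart.image, hcO]
  exact ⟨hy, hyz⟩

/-- The Riemannian volume of a submanifold `M` of `ℝ^m`, as a measure on `ℝ^m` (carried by `M`). It
is computed in a countable atlas; the result does not depend on the atlas. -/
def riemVolume {m d : ℕ} {M : Set (E m)} (hM : IsC2Submanifold d M) : Measure (E m) :=
  atlasVolume hM.exists_atlas.choose

/-- `f` is a probability density function on `M` with respect to the Riemannian volume. -/
def IsProbDensity {m d : ℕ} {M : Set (E m)} (hM : IsC2Submanifold d M) (f : E m → ℝ) : Prop :=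
  (∀ x ∈ M, 0 ≤ f x) ∧ ∫⁻ x, ENNReal.ofReal (f x) ∂(riemVolume hM) = 1

/-- The measure with density `f` with respect to the Riemannian volume. -/
def densityMeasure {m d : ℕ} {M : Set (E m)} (hM : IsC2Submanifold d M) (f : E m → ℝ) :
    Measure (E m) :=
  (riemVolume hM).withDensity fun x => ENNReal.ofReal (f x)

/-! ### Geodetic distance -/

/-- `γ` restricted to `[0,1]` is a `C¹` path in `M` from `x` to `y`. -/
def IsC1Path {m : ℕ} (M : Set (E m)) (x y : E m) (γ : ℝ → E m) : Prop :=
  ContDiffOn ℝ 1 γ (Icc 0 1) ∧ MapsTo γ (Icc 0 1) M ∧ γ 0 = x ∧ γ 1 = y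

/-- The length of the path `γ` on `[0,1]`. -/
def pathLength {m : ℕ} (γ : ℝ → E m) : ℝ≥0∞ :=
  ∫⁻ t in Icc (0 : ℝ) 1, ‖derivWithin γ (Icc 0 1) t‖ₑ

/-- The geodetic distance in `M` (equal to `∞` if no path in `M` joins the two points). -/
def geoDist {m : ℕ} (M : Set (E m)) (x y : E m) : ℝ≥0∞ :=
  ⨅ (γ : ℝ → E m) (_ : IsC1Path M x y γ), pathLength γ

/-- The closed geodetic ball `B(x,r)`. -/
def geoBall {m : ℕ} (M : Set (E m)) (x : E m) (r : ℝ) : Set (E m) :=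
  {y ∈ M | geoDist M x y ≤ ENNReal.ofReal r}

/-- The `r`-interior `A^{(r)}` of `A`. -/
def rInterior {m : ℕ} (M A : Set (E m)) (r : ℝ) : Set (E m) :=
  {x ∈ A | geoBall M x r ⊆ relInterior M A}

/-! ### Coverage thresholds -/

/-- The set of the first `n` points of a sequence. -/
def firstPoints {m : ℕ} (x : ℕ → E m) (n : ℕ) : Set (E m) := x '' {i | i < n}

/-- The `k`-coverage threshold `R_{n,k}` of `B` (`∞` if there is no admissible radius). -/
def covThreshold {m : ℕ} (M B : Set (E m)) (x : ℕ → E m) (n k : ℕ) : ℝ≥0∞ :=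
  sInf (ENNReal.ofReal '' {r : ℝ | 0 < r ∧
    ∀ y ∈ B, (k : ℕ∞) ≤ (firstPoints x n ∩ geoBall M y r).encard})

/-- The interior `k`-coverage threshold `R̃_{n,k}`: only `B ∩ A^{(r)}` has to be covered. -/
def intCovThreshold {m : ℕ} (M A B : Set (E m)) (x : ℕ → E m) (n k : ℕ) : ℝ≥0∞ :=
  sInf (ENNReal.ofReal '' {r : ℝ | 0 < r ∧
    ∀ y ∈ B ∩ rInterior M A r, (k : ℕ∞) ≤ (firstPoints x n ∩ geoBall M y r).encard})

/-! ### Constants -/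

/-- The volume `θ_d` of the unit ball of `ℝ^d`. -/
def theta (d : ℕ) : ℝ := Real.pi ^ ((d : ℝ) / 2) / Real.Gamma (1 + (d : ℝ) / 2)

/-- The infimum `f₀` of `f` over `B`, in `[0,∞]`. -/
def infOn {m : ℕ} (B : Set (E m)) (f : E m → ℝ) : ℝ≥0∞ := ⨅ x ∈ B, ENNReal.ofReal (f x)

/-- `H(t) = 1 - t + t log t` for `t > 0`, and `H(0) = 1`. -/
def H (t : ℝ) : ℝ := if 0 < t then 1 - t + t * Real.log t else 1

/-- `Ĥ_a(x)`, for `a, x ≥ 0`: the unique `y ≥ a` with `y H(a/y) = x` (the set below is a singleton;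
for `a = x = 0` the value is `0`). -/
def hatH (a x : ℝ) : ℝ := sInf {y : ℝ | a ≤ y ∧ y * H (a / y) = x}

end Coverage

end

noncomputable section

namespace Coverage

open scoped NNReal

/-! ### The area formula for charts -/

/-! For small `r`, a geodetic ball of radius `r` about an `r`-interior point `x` has volume close to
`θ_d r^d`. It therefore holds a binomial number of sample points with mean close to `n f(x) θ_d
r^d`. The critical balls are those where `f` is near `f₀`, and of order `r⁻ᵈ` balls compete. The
threshold sits where `r⁻ᵈ` times the probability of fewer than `k` points passes from small to
large. Put mean `c log n` and `k ~ b log n` with `c > b`: the probability is `n^(-rate c b + o(1))`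
and `r⁻ᵈ` is `n^(1 + o(1))`, so the critical `c` solves `rate c b = 1`, which is `c = Ĥ_b(1)`. If
`k` dominates `log n`, Chernoff's bound beats every power of `n` as soon as mean and `k` differ by a
constant factor, so the mean must be asymptotic to `k`.

Upper bound: `exists_cover` reduces coverage to `O(r⁻ᵈ)` fixed sets, and a union bound with Chernoff
and Borel–Cantelli finishes (`ae_eventually_covered`). In the logarithmic regime the resulting
probabilities need not be summable in `n`; Borel–Cantelli is then applied along `n = j^κ`, and
monotonicity in `n` and `k` fills the gaps.

Lower bound: `exists_packing` gives at least `c r⁻ᵈ` disjoint balls in a region of low density.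
Counts in disjoint sets are negatively dependent (`measureReal_forall_le_hits_le`), so all these
balls are filled with probability at most a power of one binomial tail. In the logarithmic regime, a
single binomial weight bounds the failure probability of one ball from below
(`eventually_exp_le_one_sub_binTail`).

Geometry enters only through `IsC2Submanifold.exists_nearly_euclidean`. It rests on the
identification of Riemannian volume with Hausdorff measure (`riemVolume_eq`), which makes volumes
comparable under nearly isometric parametrizations. The limit theorems themselves
(`ae_tendsto_ratio_all`) are proved for any process satisfying `FilledAtDensity` and
`UnfilledAtDensity`, and so serve both thresholds. -/

/-- Injectivity of `ψ` is not needed: the inequality forces `φ` to be constant on the fibres of `ψ`,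
so `φ` composed with any section of `ψ` is Lipschitz on `ψ '' W` with image `φ '' W`. -/
theorem euclideanHausdorffMeasure_image_le {α X Y : Type*} [EMetricSpace X] [MeasurableSpace X]
    [BorelSpace X] [EMetricSpace Y] [MeasurableSpace Y] [BorelSpace Y] (d : ℕ) {φ : α → X}
    {ψ : α → Y} {W : Set α} {K : ℝ≥0}
    (h : ∀ w ∈ W, ∀ w' ∈ W, edist (φ w) (φ w') ≤ K * edist (ψ w) (ψ w')) :
    μHE[d] (φ '' W) ≤ (K : ℝ≥0∞) ^ d * μHE[d] (ψ '' W) := by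
  rcases W.eq_empty_or_nonempty with rfl | ⟨w₀, hw₀⟩
  · simp
  have : Nonempty α := ⟨w₀⟩
  have hinv : ∀ w ∈ W, Function.invFunOn ψ W (ψ w) ∈ W ∧
      ψ (Function.invFunOn ψ W (ψ w)) = ψ w := fun w hw =>
    Function.invFunOn_pos ⟨w, hw, rfl⟩
  have hF : LipschitzOnWith K (φ ∘ Function.invFunOn ψ W) (ψ '' W) := by
    rintro _ ⟨w, hw, rfl⟩ _ ⟨w', hw', rfl⟩
    have := h _ (hinv w hw).1 _ (hinv w' hw').1
    rwa [(hinv w hw).2, (hinv w' hw').2] at this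
  have himg : (φ ∘ Function.invFunOn ψ W) '' (ψ '' W) = φ '' W := by
    rw [image_image]
    refine image_congr fun w hw => ?_
    have := h _ (hinv w hw).1 _ hw
    rw [(hinv w hw).2, edist_self, mul_zero] at this
    exact edist_le_zero.1 this
  have := hF.hausdorffMeasure_image_le (d := (d : ℝ)) (by positivity)
  rw [himg, ENNReal.rpow_natCast] at this
  simp only [Measure.euclideanHausdorffMeasure_def, Measure.smul_apply, ENNReal.smul_def,
    smul_eq_mul]
  rw [mul_left_comm]
  gcongr

theorem edist_le_of_norm_sub_le {F G : Type*} [NormedAddCommGroup F] [NormedAddCommGroup G]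
    {x y : F} {z w : G} {K : ℝ≥0} (h : ‖x - y‖ ≤ K * ‖z - w‖) : edist x y ≤ K * edist z w := by
  rw [edist_nndist, edist_nndist, ← ENNReal.coe_mul, ENNReal.coe_le_coe, ← NNReal.coe_le_coe]
  simpa [dist_eq_norm] using h

/-- Near a point of strict differentiability, a map with injective derivative distorts distances in
almost the same way as its derivative. -/
theorem exists_nhds_norm_sub_le_of_hasStrictFDerivAt {V F : Type*} [NormedAddCommGroup V]
    [NormedSpace ℝ V] [FiniteDimensional ℝ V] [NormedAddCommGroup F] [NormedSpace ℝ F]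
    {g : V → F} {L : V →L[ℝ] F} {u : V} (hg : HasStrictFDerivAt g L u)
    (hL : Function.Injective L) {K : ℝ≥0} (hK : 1 < K) :
    ∃ N ∈ 𝓝 u, ∀ w ∈ N, ∀ w' ∈ N, ‖g w - g w'‖ ≤ K * ‖L w - L w'‖ ∧
      ‖L w - L w'‖ ≤ K * ‖g w - g w'‖ := by
  obtain ⟨K₀, hK₀, hanti⟩ := L.toLinearMap.exists_antilipschitzWith
    (LinearMap.ker_eq_bot.2 hL)
  have hK' : (1 : ℝ) < K := by exact_mod_cast hK
  have hK₀' : (0 : ℝ) < K₀ := by exact_mod_cast hK₀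
  have hinv : (K : ℝ)⁻¹ < 1 := inv_lt_one_of_one_lt₀ hK'
  -- Chosen so that `c * K₀ = 1 - K⁻¹`: the linearization error is then at most `(1 - K⁻¹) ‖q‖`.
  set c : ℝ≥0 := ⟨(1 - (K : ℝ)⁻¹) / K₀, by
    apply div_nonneg _ hK₀'.le
    linarith⟩ with hc
  have hc0 : 0 < c := by
    rw [← NNReal.coe_pos, hc]
    exact div_pos (by linarith) hK₀'
  obtain ⟨N, hN, hA⟩ := hg.approximates_deriv_on_nhds (Or.inr hc0)
  refine ⟨N, hN, fun w hw w' hw' => ?_⟩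
  have h1 : ‖g w - g w' - L (w - w')‖ ≤ c * ‖w - w'‖ := hA w hw w' hw'
  have h2 : ‖w - w'‖ ≤ K₀ * ‖L w - L w'‖ := by
    have := hanti.le_mul_dist w w'
    simpa [dist_eq_norm] using this
  rw [map_sub] at h1
  set p := g w - g w'
  set q := L w - L w'
  have h3 : ‖p - q‖ ≤ (1 - (K : ℝ)⁻¹) * ‖q‖ := by
    refine h1.trans ((mul_le_mul_of_nonneg_left h2 c.2).trans (le_of_eq ?_))
    change (1 - (K : ℝ)⁻¹) / K₀ * (K₀ * ‖q‖) = _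
    field_simp
  have hq : 0 ≤ ‖q‖ := norm_nonneg q
  have h4 : ‖p‖ ≤ ‖p - q‖ + ‖q‖ := by simpa using norm_add_le (p - q) q
  have h5 : ‖q‖ ≤ ‖p - q‖ + ‖p‖ := by
    have := norm_add_le (q - p) p
    rw [norm_sub_rev] at this
    simpa using this
  -- The inequality `K + K⁻¹ ≥ 2` lets the same error bound serve in both directions.
  have h6 : 2 - (K : ℝ)⁻¹ ≤ K := by
    have : (K : ℝ) + (K : ℝ)⁻¹ - 2 = ((K : ℝ) - 1) ^ 2 * (K : ℝ)⁻¹ := by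
      field_simp
      ring
    have h7 : 0 ≤ ((K : ℝ) - 1) ^ 2 * (K : ℝ)⁻¹ := by positivity
    linarith
  constructor
  · calc ‖p‖ ≤ (2 - (K : ℝ)⁻¹) * ‖q‖ := by linarith
      _ ≤ K * ‖q‖ := by gcongr
  · have : (K : ℝ)⁻¹ * ‖q‖ ≤ ‖p‖ := by linarith
    rwa [inv_mul_le_iff₀ (by linarith)] at this

/-- Both sides are the square root of the Gram determinant of the images of the standard basis. -/
theorem volDensity_eq_normDet {m d : ℕ} (g : E d → E m) (u : E d) :
    volDensity g u = (fderiv ℝ g u).toLinearMap.normDet := by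
  have h := LinearMap.normDet_sq_eq_det_gram (fderiv ℝ g u).toLinearMap
    (EuclideanSpace.basisFun (Fin d) ℝ)
  have hmat : (jacobian g u).transpose * jacobian g u =
      Matrix.gram ℝ fun x => (fderiv ℝ g u).toLinearMap (EuclideanSpace.basisFun (Fin d) ℝ x) := by
    ext i j
    simp [Matrix.mul_apply, jacobian, Matrix.gram, PiLp.inner_apply, mul_comm]
  rw [volDensity, hmat, ← h]
  simp only [RCLike.ofReal_real_eq_id, id]
  exact Real.sqrt_sq (LinearMap.normDet_nonneg _)

namespace Chart

variable {m d : ℕ} {M : Set (E m)} (c : Chart d M)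

theorem contDiffAt {u : E d} (hu : u ∈ c.U) : ContDiffAt ℝ 2 c.g u :=
  c.contDiffOn.contDiffAt (c.isOpen_U.mem_nhds hu)

theorem hasStrictFDerivAt {u : E d} (hu : u ∈ c.U) :
    HasStrictFDerivAt c.g (fderiv ℝ c.g u) u :=
  (c.contDiffAt hu).hasStrictFDerivAt (by norm_num)

theorem continuousOn_volDensity : ContinuousOn (volDensity c.g) c.U := by
  have h1 : ContinuousOn (fderiv ℝ c.g) c.U :=
    c.contDiffOn.continuousOn_fderiv_of_isOpen c.isOpen_U (by norm_num)
  have h2 : ContinuousOn (jacobian c.g) c.U := by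
    refine continuousOn_pi.2 fun i => continuousOn_pi.2 fun j => ?_
    have : ContinuousOn (fun u => fderiv ℝ c.g u (EuclideanSpace.single j 1)) c.U :=
      h1.clm_apply continuousOn_const
    exact (EuclideanSpace.proj (𝕜 := ℝ) i).continuous.comp_continuousOn this
  unfold volDensity
  refine Real.continuous_sqrt.comp_continuousOn ?_
  exact (Continuous.matrix_det continuous_id).comp_continuousOn
    ((Continuous.matrix_mul (Continuous.matrix_transpose continuous_id)
      continuous_id).comp_continuousOn h2)

theorem volDensity_pos {u : E d} (hu : u ∈ c.U) : 0 < volDensity c.g u := by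
  rw [volDensity_eq_normDet]
  refine lt_of_le_of_ne (LinearMap.normDet_nonneg _) (Ne.symm ?_)
  rw [Ne, LinearMap.normDet_eq_zero_iff_ker_ne_bot, not_not]
  exact LinearMap.ker_eq_bot.2 (c.fullRank u hu)

theorem measurableSet_image {W : Set (E d)} (hW : MeasurableSet W) (hWU : W ⊆ c.U) :
    MeasurableSet (c.g '' W) :=
  hW.image_of_continuousOn_injOn (c.contDiffOn.continuousOn.mono hWU) (c.injOn.mono hWU)

/-- Freeze the derivative at `u`. Replacing `g` by this linear map costs `K ^ d` in Hausdorff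
measure, replacing the density by its value at `u` costs one more `K`, and for a linear map the
formula is exact. -/
theorem exists_nhds_lintegral_volDensity_le {u : E d} (hu : u ∈ c.U) {K : ℝ≥0} (hK : 1 < K) :
    ∃ N ∈ 𝓝 u, ∀ W ⊆ N, MeasurableSet W →
      ∫⁻ w in W, ENNReal.ofReal (volDensity c.g w) ≤ (K : ℝ≥0∞) ^ (d + 1) * μHE[d] (c.g '' W) ∧
      μHE[d] (c.g '' W) ≤ (K : ℝ≥0∞) ^ (d + 1) * ∫⁻ w in W, ENNReal.ofReal (volDensity c.g w) := by
  obtain ⟨N, hN, hNb⟩ := exists_nhds_norm_sub_le_of_hasStrictFDerivAt (c.hasStrictFDerivAt hu)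
    (c.fullRank u hu) hK
  set D := volDensity c.g u with hD
  have hDpos : 0 < D := c.volDensity_pos hu
  have hcont : ContinuousAt (volDensity c.g) u :=
    c.continuousOn_volDensity.continuousAt (c.isOpen_U.mem_nhds hu)
  have hK1 : (1 : ℝ) < K := by exact_mod_cast hK
  have e1 : ∀ᶠ w in 𝓝 u, volDensity c.g w < K * D :=
    hcont.eventually_lt continuousAt_const (by rw [← hD]; nlinarith)
  have e2 : ∀ᶠ w in 𝓝 u, D < K * volDensity c.g w :=
    continuousAt_const.eventually_lt (continuousAt_const.mul hcont) (by rw [← hD]; nlinarith)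
  refine ⟨N ∩ {w | volDensity c.g w < K * D ∧ D < K * volDensity c.g w},
    inter_mem hN (e1.and e2), fun W hW hWm => ?_⟩
  have hlin : μHE[d] ((fderiv ℝ c.g u) '' W) = ENNReal.ofReal D * volume W := by
    have := LinearMap.euclideanHausdorffMeasure_image_eq_normDet_mul_volume
      (fderiv ℝ c.g u).toLinearMap W
    rw [finrank_euclideanSpace_fin, ← volDensity_eq_normDet] at this
    exact this
  have hA : μHE[d] (c.g '' W) ≤ (K : ℝ≥0∞) ^ d * μHE[d] ((fderiv ℝ c.g u) '' W) :=
    euclideanHausdorffMeasure_image_le d fun w hw w' hw' =>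
      edist_le_of_norm_sub_le (hNb w (hW hw).1 w' (hW hw').1).1
  have hB : μHE[d] ((fderiv ℝ c.g u) '' W) ≤ (K : ℝ≥0∞) ^ d * μHE[d] (c.g '' W) :=
    euclideanHausdorffMeasure_image_le d fun w hw w' hw' =>
      edist_le_of_norm_sub_le (hNb w (hW hw).1 w' (hW hw').1).2
  have hC : ∫⁻ w in W, ENNReal.ofReal (volDensity c.g w) ≤
      K * (ENNReal.ofReal D * volume W) := by
    rw [← mul_assoc, ← setLIntegral_const]
    refine setLIntegral_mono measurable_const fun w hw => ?_
    rw [← ENNReal.ofReal_coe_nnreal (p := K), ← ENNReal.ofReal_mul K.coe_nonneg]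
    exact ENNReal.ofReal_le_ofReal (hW hw).2.1.le
  have hE : ENNReal.ofReal D * volume W ≤
      K * ∫⁻ w in W, ENNReal.ofReal (volDensity c.g w) := by
    rw [← setLIntegral_const, ← lintegral_const_mul' _ _ ENNReal.coe_ne_top]
    refine setLIntegral_mono' hWm fun w hw => ?_
    rw [← ENNReal.ofReal_coe_nnreal (p := K), ← ENNReal.ofReal_mul K.coe_nonneg]
    exact ENNReal.ofReal_le_ofReal (hW hw).2.2.le
  constructor
  · calc _ ≤ K * (ENNReal.ofReal D * volume W) := hC
      _ ≤ K * ((K : ℝ≥0∞) ^ d * μHE[d] (c.g '' W)) := by rw [← hlin]; gcongr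
      _ = _ := by rw [pow_succ']; ring
  · calc _ ≤ (K : ℝ≥0∞) ^ d * (ENNReal.ofReal D * volume W) := by rw [← hlin]; exact hA
      _ ≤ (K : ℝ≥0∞) ^ d * (K * ∫⁻ w in W, ENNReal.ofReal (volDensity c.g w)) := by gcongr
      _ = _ := by rw [pow_succ']; ring

/-- By Lindelöf, `W` splits into countably many disjoint pieces on which the local bound holds.
Injectivity keeps the images disjoint, and the factor does not depend on the pieces, so the bounds
add up. -/
theorem lintegral_volDensity_le {W : Set (E d)} (hW : MeasurableSet W) (hWU : W ⊆ c.U) {K : ℝ≥0}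
    (hK : 1 < K) :
    ∫⁻ w in W, ENNReal.ofReal (volDensity c.g w) ≤ (K : ℝ≥0∞) ^ (d + 1) * μHE[d] (c.g '' W) ∧
    μHE[d] (c.g '' W) ≤ (K : ℝ≥0∞) ^ (d + 1) * ∫⁻ w in W, ENNReal.ofReal (volDensity c.g w) := by
  rcases W.eq_empty_or_nonempty with rfl | ⟨w₀, hw₀⟩
  · simp
  choose! N hN hNb using fun u (hu : u ∈ c.U) => c.exists_nhds_lintegral_volDensity_le hu hK
  obtain ⟨T, hTW, hTc, hT⟩ := TopologicalSpace.countable_cover_nhdsWithin (s := W)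
    (f := fun u => interior (N u))
    fun u hu => mem_nhdsWithin_of_mem_nhds (interior_mem_nhds.2 (hN u (hWU hu)))
  have hTne : T.Nonempty := by
    have := hT hw₀
    simp only [mem_iUnion] at this
    obtain ⟨i, hi, -⟩ := this
    exact ⟨i, hi⟩
  obtain ⟨e, rfl⟩ := hTc.exists_eq_range hTne
  rw [biUnion_range] at hT
  set S : ℕ → Set (E d) := fun i => W ∩ disjointed (fun j => interior (N (e j))) i with hS
  have hSW : W = ⋃ i, S i := by
    rw [hS, ← inter_iUnion, iUnion_disjointed, inter_eq_left.2 hT]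
  have hSm : ∀ i, MeasurableSet (S i) := fun i =>
    hW.inter (MeasurableSet.disjointed (fun _ => isOpen_interior.measurableSet) i)
  have hSd : Pairwise (Function.onFun Disjoint S) := fun i j hij =>
    (disjoint_disjointed _ hij).mono inter_subset_right inter_subset_right
  have hSU : ∀ i, S i ⊆ c.U := fun i => inter_subset_left.trans hWU
  have hSN : ∀ i, S i ⊆ N (e i) := fun i =>
    inter_subset_right.trans ((disjointed_subset _ i).trans interior_subset)
  have h1 : ∫⁻ w in W, ENNReal.ofReal (volDensity c.g w) =
      ∑' i, ∫⁻ w in S i, ENNReal.ofReal (volDensity c.g w) := by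
    conv_lhs => rw [hSW]
    exact lintegral_iUnion hSm hSd _
  have h2 : μHE[d] (c.g '' W) = ∑' i, μHE[d] (c.g '' S i) := by
    conv_lhs => rw [hSW]
    rw [image_iUnion]
    refine measure_iUnion (fun i j hij => ?_) fun i => c.measurableSet_image (hSm i) (hSU i)
    refine Set.disjoint_left.2 ?_
    rintro _ ⟨x, hx, rfl⟩ ⟨y, hy, hxy⟩
    rw [c.injOn (hSU j hy) (hSU i hx) hxy] at hy
    exact Set.disjoint_left.1 (hSd hij) hx hy
  rw [h1, h2, ← ENNReal.tsum_mul_left, ← ENNReal.tsum_mul_left]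
  exact ⟨ENNReal.tsum_le_tsum fun i =>
      (hNb _ (hWU (hTW (mem_range_self i))) _ (hSN i) (hSm i)).1,
    ENNReal.tsum_le_tsum fun i => (hNb _ (hWU (hTW (mem_range_self i))) _ (hSN i) (hSm i)).2⟩

/-- The area formula for a chart. -/
theorem lintegral_volDensity {W : Set (E d)} (hW : MeasurableSet W) (hWU : W ⊆ c.U) :
    ∫⁻ w in W, ENNReal.ofReal (volDensity c.g w) = μHE[d] (c.g '' W) := by
  have key : ∀ a b : ℝ≥0∞, (∀ K : ℝ≥0, 1 < K → a ≤ (K : ℝ≥0∞) ^ (d + 1) * b) → a ≤ b := by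
    intro a b h
    have ht : Tendsto (fun K : ℝ≥0 => (K : ℝ≥0∞) ^ (d + 1) * b) (𝓝[>] 1)
        (𝓝 (((1 : ℝ≥0) : ℝ≥0∞) ^ (d + 1) * b)) := by
      refine ENNReal.Tendsto.mul_const ?_ (Or.inl (by simp))
      exact ((ENNReal.continuous_pow (d + 1)).comp
        ENNReal.continuous_coe).continuousAt.tendsto.mono_left nhdsWithin_le_nhds
    simp only [ENNReal.coe_one, one_pow, one_mul] at ht
    exact ge_of_tendsto ht (eventually_mem_nhdsWithin.mono fun K hK => h K hK)
  exact le_antisymm (key _ _ fun K hK => (c.lintegral_volDensity_le hW hWU hK).1)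
    (key _ _ fun K hK => (c.lintegral_volDensity_le hW hWU hK).2)

end Chart

theorem IsC2Submanifold.measurableSet {m d : ℕ} {M : Set (E m)} (hM : IsC2Submanifold d M) :
    MeasurableSet M := by
  obtain ⟨c, hc⟩ := hM.exists_atlas
  have : M = ⋃ i, (c i).image :=
    hc.antisymm (iUnion_subset fun i => image_subset_iff.2 (c i).mapsTo)
  rw [this]
  exact MeasurableSet.iUnion fun i => (c i).measurableSet_image (c i).isOpen_U.measurableSet subset_rfl

/-- The volume measure of an atlas is the Hausdorff measure of the submanifold. -/
theorem atlasVolume_eq {m d : ℕ} {M : Set (E m)} {c : ℕ → Chart d M}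
    (hc : M ⊆ ⋃ i, (c i).image) :
    atlasVolume c = (μHE[d] : Measure (E m)).restrict M := by
  have hMc : M = ⋃ i, (c i).image :=
    hc.antisymm (iUnion_subset fun i => image_subset_iff.2 (c i).mapsTo)
  have hdm : ∀ i, MeasurableSet (disjointed (fun j => (c j).image) i) := fun i =>
    MeasurableSet.disjointed (fun j =>
      (c j).measurableSet_image (c j).isOpen_U.measurableSet subset_rfl) i
  have hpre : ∀ i (S : Set (E m)), MeasurableSet S → MeasurableSet ((c i).U ∩ (c i).g ⁻¹' S) := by
    intro i S hS
    have : Measurable ((c i).U.domRestrict (c i).g) :=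
      (continuousOn_iff_continuous_domRestrict.1 (c i).contDiffOn.continuousOn).measurable
    have h2 := (MeasurableEmbedding.subtype_coe
      (c i).isOpen_U.measurableSet).measurableSet_image.2 (this hS)
    convert h2 using 1
    ext x
    simp [Set.domRestrict, and_comm]
  ext S hS
  rw [atlasVolume, Measure.sum_apply _ hS, Measure.restrict_apply hS]
  have hdisj : S ∩ M = ⋃ i, S ∩ disjointed (fun j => (c j).image) i := by
    rw [← inter_iUnion, iUnion_disjointed, ← hMc]
  rw [hdisj, measure_iUnion (fun i j hij => (disjoint_disjointed _ hij).mono inter_subset_right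
    inter_subset_right) fun i => hS.inter (hdm i)]
  refine tsum_congr fun i => ?_
  have hW := hpre i _ (hdm i)
  have hae : AEMeasurable (c i).g
      ((volume.restrict ((c i).U ∩ (c i).g ⁻¹' disjointed (fun j => (c j).image) i)).withDensity
      fun u => ENNReal.ofReal (volDensity (c i).g u)) :=
    (((c i).contDiffOn.continuousOn.mono inter_subset_left).aemeasurable hW).mono_ac
      (withDensity_absolutelyContinuous _ _)
  rw [Measure.map_apply_of_aemeasurable hae hS, withDensity_apply', Measure.restrict_restrict₀]
  · have : (c i).g ⁻¹' S ∩ ((c i).U ∩ (c i).g ⁻¹' disjointed (fun j => (c j).image) i) =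
        (c i).U ∩ (c i).g ⁻¹' (S ∩ disjointed (fun j => (c j).image) i) := by
      ext x
      simp only [mem_inter_iff, mem_preimage]
      tauto
    rw [this, (c i).lintegral_volDensity (hpre i _ (hS.inter (hdm i))) inter_subset_left]
    congr 1
    rw [image_inter_preimage]
    refine inter_eq_right.2 (inter_subset_right.trans ?_)
    exact disjointed_subset _ i
  · exact ((((c i).contDiffOn.continuousOn.mono inter_subset_left).aemeasurable
      hW).nullMeasurableSet_preimage hS)

theorem riemVolume_eq {m d : ℕ} {M : Set (E m)} (hM : IsC2Submanifold d M) :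
    riemVolume hM = (μHE[d] : Measure (E m)).restrict M :=
  atlasVolume_eq hM.exists_atlas.choose_spec

end Coverage

end

noncomputable section

namespace Coverage

open scoped NNReal
open Metric

/-! ### Local geometry of submanifolds -/

theorem theta_pos (d : ℕ) : 0 < theta d :=
  div_pos (Real.rpow_pos_of_pos Real.pi_pos _) (Real.Gamma_pos_of_pos (by positivity))

theorem volume_closedBall_eq {d : ℕ} (hd : 0 < d) (x : E d) {r : ℝ} (hr : 0 ≤ r) :
    volume (closedBall x r) = ENNReal.ofReal (theta d * r ^ d) := by
  have : Nonempty (Fin d) := ⟨⟨0, hd⟩⟩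
  have hθ : √Real.pi ^ d / Real.Gamma (d / 2 + 1) = theta d := by
    rw [theta, Real.sqrt_eq_rpow, ← Real.rpow_natCast, ← Real.rpow_mul Real.pi_pos.le, add_comm]
    congr 2
    ring
  rw [EuclideanSpace.volume_closedBall, Fintype.card_fin, hθ, ← ENNReal.ofReal_pow hr,
    ← ENNReal.ofReal_mul (by positivity), mul_comm]

/-- Every point of a submanifold has a parametrized neighbourhood that is nearly isometric to a
Euclidean ball. -/
theorem IsC2Submanifold.exists_nearly_isometric_param {m d : ℕ} {M : Set (E m)}
    (hM : IsC2Submanifold d M) {y : E m} (hy : y ∈ M) {K : ℝ≥0} (hK : 1 < K) :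
    ∃ (h : E d → E m) (ρ : ℝ), 0 < ρ ∧ h 0 = y ∧ ContDiffOn ℝ 1 h (ball 0 ρ) ∧
      (∀ w ∈ ball (0 : E d) ρ, ∀ w' ∈ ball (0 : E d) ρ,
        ‖h w - h w'‖ ≤ K * ‖w - w'‖ ∧ ‖w - w'‖ ≤ K * ‖h w - h w'‖) ∧
      ∃ O, IsOpen O ∧ h '' ball 0 ρ = M ∩ O := by
  obtain ⟨c, u, hu, rfl⟩ := hM.2 y hy
  set L := fderiv ℝ c.g u with hL
  have hLinj : Function.Injective L.toLinearMap := c.fullRank u hu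
  obtain ⟨N, hN, hNb⟩ := exists_nhds_norm_sub_le_of_hasStrictFDerivAt (c.hasStrictFDerivAt hu)
    (c.fullRank u hu) hK
  set p := LinearMap.range L.toLinearMap
  have hp : Module.finrank ℝ p = d := by
    rw [LinearMap.finrank_range_of_inj hLinj, finrank_euclideanSpace_fin]
  set b := (stdOrthonormalBasis ℝ p).reindex (finCongr hp)
  -- `T` undoes `L` along an orthonormal basis of its range, so `L ∘ T` is an isometry and the
  -- reparametrized chart inherits the distortion bound `K` relative to the Euclidean norm.
  set T : E d ≃L[ℝ] E d := (b.repr.symm.toLinearEquiv.trans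
    (LinearEquiv.ofInjective L.toLinearMap hLinj).symm).toContinuousLinearEquiv with hT
  have hLT : ∀ z, L (T z) = (b.repr.symm z : E m) := by
    intro z
    have h1 : LinearEquiv.ofInjective L.toLinearMap hLinj (T z) = b.repr.symm z := by
      simp [hT]
    rw [← h1]
    rfl
  set e : E d ≃ₜ E d := T.toHomeomorph.trans (Homeomorph.addLeft u) with he
  have hez : ∀ z, e z = u + T z := fun z => rfl
  have he0 : e 0 = u := by simp [hez]
  have hnh : N ∩ c.U ∈ 𝓝 (e 0) := by
    rw [he0]
    exact inter_mem hN (c.isOpen_U.mem_nhds hu)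
  obtain ⟨ρ, hρ, hball⟩ := Metric.mem_nhds_iff.1 (e.continuous.continuousAt.preimage_mem_nhds hnh)
  refine ⟨c.g ∘ e, ρ, hρ, by simp [he0], ?_, ?_, ?_⟩
  · refine (c.contDiffOn.of_le (by norm_num)).comp ?_ fun z hz => (hball hz).2
    exact (contDiff_const.add T.contDiff).contDiffOn
  · intro w hw w' hw'
    have hn : ‖L (e w) - L (e w')‖ = ‖w - w'‖ := by
      rw [hez, hez, map_add, map_add, add_sub_add_left_eq_sub, hLT, hLT, ← Submodule.coe_sub,
        ← map_sub]
      exact b.repr.symm.norm_map (w - w')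
    have := hNb _ (hball hw).1 _ (hball hw').1
    rwa [hn] at this
  · rw [image_comp]
    refine c.openMap _ ?_ (e.isOpenMap _ isOpen_ball)
    rintro _ ⟨z, hz, rfl⟩
    exact (hball hz).2

theorem edist_le_geoDist {m : ℕ} (M : Set (E m)) (x y : E m) : edist x y ≤ geoDist M x y := by
  refine le_iInf₂ fun γ hγ => ?_
  have := enorm_sub_le_lintegral_derivWithin_Icc_of_contDiffOn_Icc hγ.1 zero_le_one
  rw [hγ.2.2.1, hγ.2.2.2] at this
  rwa [edist_comm, edist_eq_enorm_sub]

theorem geoBall_subset_closedBall {m : ℕ} (M : Set (E m)) (x : E m) {r : ℝ} (hr : 0 ≤ r) :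
    geoBall M x r ⊆ M ∩ closedBall x r := by
  rintro y ⟨hy, hxy⟩
  refine ⟨hy, ?_⟩
  have h := (edist_le_geoDist M x y).trans hxy
  rw [edist_dist, ENNReal.ofReal_le_ofReal_iff hr] at h
  rwa [mem_closedBall, dist_comm]

theorem geoBall_mono {m : ℕ} (M : Set (E m)) (x : E m) {r s : ℝ} (hrs : r ≤ s) :
    geoBall M x r ⊆ geoBall M x s :=
  fun _ hy => ⟨hy.1, hy.2.trans (ENNReal.ofReal_le_ofReal hrs)⟩

theorem rInterior_anti {m : ℕ} (M A : Set (E m)) {r s : ℝ} (hrs : r ≤ s) :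
    rInterior M A s ⊆ rInterior M A r :=
  fun _ hx => ⟨hx.1, (geoBall_mono M _ hrs).trans hx.2⟩

/-- The image of a segment under a Lipschitz parametrization bounds the geodetic distance. -/
theorem geoDist_le_of_param {m d : ℕ} {M : Set (E m)} {h : E d → E m} {S : Set (E d)}
    (hS : Convex ℝ S) (hh : ContDiffOn ℝ 1 h S) (hmaps : MapsTo h S M) {K : ℝ≥0}
    (hK : ∀ w ∈ S, ∀ w' ∈ S, ‖h w - h w'‖ ≤ K * ‖w - w'‖) {w w' : E d} (hw : w ∈ S) (hw' : w' ∈ S) :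
    geoDist M (h w) (h w') ≤ ENNReal.ofReal (K * ‖w - w'‖) := by
  set l : ℝ → E d := fun t => w + t • (w' - w) with hl
  have hlS : MapsTo l (Icc 0 1) S := fun t ht => by
    have := hS.add_smul_sub_mem hw hw' ht
    exact this
  have hlC : ContDiff ℝ 1 l := contDiff_const.add (contDiff_id.smul contDiff_const)
  have hpath : IsC1Path M (h w) (h w') (h ∘ l) :=
    ⟨hh.comp hlC.contDiffOn hlS, hmaps.comp hlS, by simp [hl], by simp [hl]⟩
  refine (iInf₂_le _ hpath).trans ?_
  -- On the open interval `derivWithin` is the ordinary derivative, which the Lipschitz constant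
  -- bounds; the endpoints are null.
  have hb : ∀ t ∈ Ioo (0 : ℝ) 1, ‖derivWithin (h ∘ l) (Icc 0 1) t‖ₑ ≤
      ENNReal.ofReal (K * ‖w - w'‖) := by
    intro t ht
    rw [derivWithin_of_mem_nhds (Icc_mem_nhds ht.1 ht.2), ← ofReal_norm]
    refine ENNReal.ofReal_le_ofReal (norm_deriv_le_of_lip' (by positivity) ?_)
    filter_upwards [Ioo_mem_nhds ht.1 ht.2] with s hs
    refine (hK _ (hlS (Ioo_subset_Icc_self hs)) _ (hlS (Ioo_subset_Icc_self ht))).trans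
      (le_of_eq ?_)
    have : l s - l t = (s - t) • (w' - w) := by
      simp only [hl, sub_smul]
      abel
    rw [this, norm_smul, norm_sub_rev w' w]
    ring
  rw [pathLength, ← restrict_Ioo_eq_restrict_Icc]
  refine (setLIntegral_mono' measurableSet_Ioo hb).trans ?_
  simp

/-- The property "uniform for small radii on `S`" passes to subsets and to unions of two sets (take
the smaller radius), so compactness upgrades it from local to global. -/
theorem IsCompact.exists_uniform_radius {m : ℕ} {A : Set (E m)} (hA : IsCompact A)
    {Q : E m → ℝ → Prop}
    (h : ∀ y ∈ A, ∃ δ > 0, ∀ x ∈ A, dist x y < δ → ∀ r, 0 < r → r < δ → Q x r) :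
    ∃ r₀ > 0, ∀ x ∈ A, ∀ r, 0 < r → r < r₀ → Q x r := by
  refine hA.induction_on (p := fun S => ∃ r₀ > 0, ∀ x ∈ S, ∀ r, 0 < r → r < r₀ → Q x r)
    ⟨1, one_pos, by simp⟩ ?_ ?_ ?_
  · rintro S T hST ⟨r₀, h0, hT⟩
    exact ⟨r₀, h0, fun x hx => hT x (hST hx)⟩
  · rintro S T ⟨r₁, h1, hS⟩ ⟨r₂, h2, hT⟩
    refine ⟨min r₁ r₂, lt_min h1 h2, fun x hx r hr hrr => ?_⟩
    rcases hx with hx | hx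
    · exact hS x hx r hr (hrr.trans_le (min_le_left _ _))
    · exact hT x hx r hr (hrr.trans_le (min_le_right _ _))
  · intro y hy
    obtain ⟨δ, hδ, hQ⟩ := h y hy
    exact ⟨A ∩ ball y δ, inter_mem_nhdsWithin _ (ball_mem_nhds y hδ), δ, hδ,
      fun x hx => hQ x hx.1 hx.2⟩

/-- Small balls of a submanifold have nearly Euclidean volume, and geodetic and Euclidean distances
nearly agree at small scales. -/
theorem IsC2Submanifold.exists_nearly_euclidean_nhds {m d : ℕ} (hd : 0 < d) {M : Set (E m)}
    (hM : IsC2Submanifold d M) {y : E m} (hy : y ∈ M) {K : ℝ≥0} (hK : 1 < K) :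
    ∃ δ > 0, ∀ x ∈ M, dist x y < δ → ∀ r, 0 < r → r < δ →
      μHE[d] (M ∩ closedBall x r) ≤ (K : ℝ≥0∞) ^ (2 * d) * ENNReal.ofReal (theta d * r ^ d) ∧
      ENNReal.ofReal (theta d * r ^ d) ≤ (K : ℝ≥0∞) ^ (2 * d) * μHE[d] (M ∩ closedBall x r) ∧
      ∀ x' ∈ M, dist x x' ≤ r → geoDist M x x' ≤ ENNReal.ofReal (K ^ 2 * dist x x') := by
  obtain ⟨h, ρ, hρ, h0, hC, hb, O, hO, hMO⟩ := hM.exists_nearly_isometric_param hy hK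
  have hK1 : (1 : ℝ) < K := by exact_mod_cast hK
  have hK0 : (0 : ℝ) < K := by linarith
  have hmaps : MapsTo h (ball 0 ρ) M := fun w hw => by
    have : h w ∈ M ∩ O := hMO ▸ mem_image_of_mem h hw
    exact this.1
  have hyO : y ∈ O := by
    have : y ∈ M ∩ O := hMO ▸ ⟨0, mem_ball_self hρ, h0⟩
    exact this.2
  obtain ⟨δ₁, hδ₁, hball⟩ := Metric.isOpen_iff.1 hO y hyO
  -- The bound `δ₁ / 2` keeps balls about `x` inside `O`. The bound `ρ / (K + 1)` keeps the
  -- parameter ball about `w` inside `ball 0 ρ`, since `K * (ρ / (K + 1)) + ρ / (K + 1) = ρ`.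
  have hδpos : 0 < min (δ₁ / 2) (ρ / (K + 1)) := lt_min (by positivity) (by positivity)
  refine ⟨min (δ₁ / 2) (ρ / (K + 1)), hδpos, fun x hx hxy r hr hrδ => ?_⟩
  have hxy1 : dist x y < δ₁ / 2 := hxy.trans_le (min_le_left _ _)
  have hr1 : r < δ₁ / 2 := hrδ.trans_le (min_le_left _ _)
  have hxy2 : dist x y < ρ / (K + 1) := hxy.trans_le (min_le_right _ _)
  have hr2 : r < ρ / (K + 1) := hrδ.trans_le (min_le_right _ _)
  have hsub : M ∩ closedBall x r ⊆ h '' ball 0 ρ := by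
    rw [hMO]
    refine fun z hz => ⟨hz.1, hball ?_⟩
    have h1 : dist z x ≤ r := hz.2
    have := dist_triangle z x y
    rw [mem_ball]
    linarith
  obtain ⟨w, hw, rfl⟩ := hsub ⟨hx, mem_closedBall_self hr.le⟩
  have hwn : ‖w‖ ≤ K * dist (h w) y := by
    have := (hb w hw 0 (mem_ball_self hρ)).2
    rwa [sub_zero, h0, ← dist_eq_norm] at this
  have hvol : ∀ s, 0 ≤ s → (μHE[d] : Measure (E d)) (closedBall w s) =
      ENNReal.ofReal (theta d * s ^ d) := fun s hs => by
    rw [EuclideanSpace.euclideanHausdorffMeasure_eq_volume, volume_closedBall_eq hd w hs]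
  refine ⟨?_, ?_, ?_⟩
  · have hsub2 : M ∩ closedBall (h w) r ⊆ h '' (closedBall w (K * r) ∩ ball 0 ρ) := by
      intro z hz
      obtain ⟨w', hw', rfl⟩ := hsub hz
      refine ⟨w', ⟨?_, hw'⟩, rfl⟩
      rw [mem_closedBall, dist_eq_norm]
      refine (hb w' hw' w hw).2.trans ?_
      rw [← dist_eq_norm]
      exact mul_le_mul_of_nonneg_left hz.2 hK0.le
    have h1 := euclideanHausdorffMeasure_image_le d (φ := h) (ψ := (id : E d → E d))
      (W := closedBall w (K * r) ∩ ball 0 ρ) (K := K)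
      fun z hz z' hz' => edist_le_of_norm_sub_le (hb z hz.2 z' hz'.2).1
    rw [image_id] at h1
    calc μHE[d] (M ∩ closedBall (h w) r) ≤ (K : ℝ≥0∞) ^ d * μHE[d] (closedBall w (K * r)) :=
          (measure_mono hsub2).trans (h1.trans (by gcongr; exact inter_subset_left))
      _ = (K : ℝ≥0∞) ^ (2 * d) * ENNReal.ofReal (theta d * r ^ d) := by
          rw [hvol _ (by positivity), mul_pow, mul_left_comm, ENNReal.ofReal_mul (by positivity),
            ENNReal.ofReal_pow hK0.le, ENNReal.ofReal_coe_nnreal, ← mul_assoc, ← pow_add, two_mul]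
  · have hcb : closedBall w (r / K) ⊆ ball 0 ρ := by
      intro z hz
      rw [mem_ball_zero_iff]
      have h1 : ‖z‖ ≤ ‖z - w‖ + ‖w‖ := by simpa using norm_add_le (z - w) w
      have h2 : ‖z - w‖ ≤ r / K := by simpa [dist_eq_norm] using hz
      have h3 : r / K ≤ r := div_le_self hr.le hK1.le
      have h4 : K * dist (h w) y < K * (ρ / (K + 1)) := by gcongr
      have h5 : K * (ρ / (K + 1)) + ρ / (K + 1) = ρ := by field_simp
      linarith
    have h1 := euclideanHausdorffMeasure_image_le d (φ := (id : E d → E d)) (ψ := h)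
      (W := closedBall w (r / K)) (K := K)
      fun z hz z' hz' => edist_le_of_norm_sub_le (hb z (hcb hz) z' (hcb hz')).2
    rw [image_id, hvol _ (by positivity)] at h1
    have hsub2 : h '' closedBall w (r / K) ⊆ M ∩ closedBall (h w) r := by
      rintro _ ⟨z, hz, rfl⟩
      refine ⟨hmaps (hcb hz), ?_⟩
      rw [mem_closedBall, dist_eq_norm]
      refine (hb z (hcb hz) w hw).1.trans ?_
      rw [← dist_eq_norm]
      calc K * dist z w ≤ K * (r / K) := by gcongr; exact hz
        _ = r := by field_simp
    have h2 : ENNReal.ofReal (theta d * r ^ d) =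
        (K : ℝ≥0∞) ^ d * ENNReal.ofReal (theta d * (r / K) ^ d) := by
      rw [← ENNReal.ofReal_coe_nnreal (p := K), ← ENNReal.ofReal_pow hK0.le,
        ← ENNReal.ofReal_mul (by positivity)]
      congr 1
      rw [div_pow]
      field_simp
    rw [h2, two_mul, pow_add, mul_assoc]
    gcongr
    exact h1.trans (by gcongr)
  · intro x' hx' hxx'
    obtain ⟨w', hw', rfl⟩ := hsub ⟨hx', by rwa [mem_closedBall, dist_comm]⟩
    refine (geoDist_le_of_param (convex_ball 0 ρ) hC hmaps (fun z hz z' hz' => (hb z hz z' hz').1)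
      hw hw').trans (ENNReal.ofReal_le_ofReal ?_)
    have hdist := (hb w hw w' hw').2
    rw [sq, mul_assoc, dist_eq_norm]
    gcongr

/-- Uniform version over a compact set, for an arbitrary factor `1 + ε`. -/
theorem IsC2Submanifold.exists_nearly_euclidean {m d : ℕ} (hd : 0 < d) {M : Set (E m)}
    (hM : IsC2Submanifold d M) {A : Set (E m)} (hA : IsCompact A) (hAM : A ⊆ M) {ε : ℝ}
    (hε : 0 < ε) :
    ∃ r₀ > 0, ∀ x ∈ A, ∀ r, 0 < r → r < r₀ →
      μHE[d] (M ∩ closedBall x r) ≤ ENNReal.ofReal ((1 + ε) * (theta d * r ^ d)) ∧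
      ENNReal.ofReal (theta d * r ^ d / (1 + ε)) ≤ μHE[d] (M ∩ closedBall x r) ∧
      ∀ x' ∈ M, dist x x' ≤ r → geoDist M x x' ≤ ENNReal.ofReal ((1 + ε) * dist x x') := by
  -- One `K` serves volumes, distorted by `K ^ (2 * d)`, and distances, distorted by `K ^ 2 ≤ K ^ (2
  -- * d)`.
  obtain ⟨K, hK, hKd⟩ : ∃ K : ℝ≥0, 1 < K ∧ (K : ℝ) ^ (2 * d) < 1 + ε := by
    have ht : Tendsto (fun K : ℝ≥0 => (K : ℝ) ^ (2 * d)) (𝓝[>] 1) (𝓝 (((1 : ℝ≥0) : ℝ) ^ (2 * d))) :=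
      (NNReal.continuous_coe.pow _).continuousAt.tendsto.mono_left nhdsWithin_le_nhds
    have h1 : ∀ᶠ K : ℝ≥0 in 𝓝[>] 1, (K : ℝ) ^ (2 * d) < 1 + ε :=
      ht.eventually_lt_const (by simpa using hε)
    obtain ⟨K, h2, h3⟩ := (h1.and eventually_mem_nhdsWithin).exists
    exact ⟨K, h3, h2⟩
  have hK1 : (1 : ℝ) < K := by exact_mod_cast hK
  have hKe : (K : ℝ≥0∞) ^ (2 * d) ≤ ENNReal.ofReal (1 + ε) := by
    rw [← ENNReal.ofReal_coe_nnreal (p := K), ← ENNReal.ofReal_pow K.coe_nonneg]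
    exact ENNReal.ofReal_le_ofReal hKd.le
  have hK2 : (K : ℝ) ^ 2 ≤ 1 + ε :=
    (pow_le_pow_right₀ hK1.le (by omega)).trans hKd.le
  obtain ⟨r₀, hr₀, h⟩ := IsCompact.exists_uniform_radius hA fun y hy => by
    obtain ⟨δ, hδ, hh⟩ := hM.exists_nearly_euclidean_nhds hd (hAM hy) hK
    exact ⟨δ, hδ, fun x hx => hh x (hAM hx)⟩
  refine ⟨r₀, hr₀, fun x hx r hr hrr => ?_⟩
  obtain ⟨h1, h2, h3⟩ := h x hx r hr hrr
  refine ⟨?_, ?_, fun x' hx' hxx' => (h3 x' hx' hxx').trans (ENNReal.ofReal_le_ofReal ?_)⟩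
  · rw [ENNReal.ofReal_mul (by positivity)]
    exact h1.trans (by gcongr)
  · rw [ENNReal.ofReal_div_of_pos (by positivity)]
    refine ENNReal.div_le_of_le_mul' (h2.trans (by gcongr))
  · gcongr

end Coverage

end

noncomputable section

namespace Coverage

open scoped NNReal
open Metric

/-! ### Coverings and packings by small balls -/

section Density

variable {m d : ℕ} {M : Set (E m)} (hM : IsC2Submanifold d M) {f : E m → ℝ}

theorem densityMeasure_apply {S : Set (E m)} (hS : MeasurableSet S) (hSM : S ⊆ M) :
    densityMeasure hM f S = ∫⁻ x in S, ENNReal.ofReal (f x) ∂μHE[d] := by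
  rw [densityMeasure, withDensity_apply _ hS, riemVolume_eq, Measure.restrict_restrict hS,
    inter_eq_left.2 hSM]

/-- Absence of atoms makes the sample points distinct, so that counting points and counting indices
agree. -/
theorem densityMeasure_singleton (hd : 0 < d) (x : E m) : densityMeasure hM f {x} = 0 := by
  have := Measure.nullSingletonClass_hausdorff (E m) (d := (d : ℝ)) (by exact_mod_cast hd)
  have h1 : (μHE[d] : Measure (E m)) {x} = 0 := by
    rw [Measure.euclideanHausdorffMeasure_def, Measure.smul_apply, measure_singleton, smul_zero]
  refine withDensity_absolutelyContinuous _ _ ?_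
  rw [riemVolume_eq]
  exact Measure.restrict_le_self.absolutelyContinuous h1

theorem mul_le_densityMeasure {S : Set (E m)} (hS : MeasurableSet S) (hSM : S ⊆ M) {a : ℝ}
    (ha : ∀ x ∈ S, a ≤ f x) : ENNReal.ofReal a * μHE[d] S ≤ densityMeasure hM f S := by
  rw [densityMeasure_apply hM hS hSM, ← setLIntegral_const]
  exact setLIntegral_mono' hS fun x hx => ENNReal.ofReal_le_ofReal (ha x hx)

theorem densityMeasure_le_mul {S : Set (E m)} (hS : MeasurableSet S) (hSM : S ⊆ M) {a : ℝ}
    (ha : ∀ x ∈ S, f x ≤ a) : densityMeasure hM f S ≤ ENNReal.ofReal a * μHE[d] S := by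
  rw [densityMeasure_apply hM hS hSM, ← setLIntegral_const]
  exact setLIntegral_mono' hS fun x hx => ENNReal.ofReal_le_ofReal (ha x hx)

end Density

theorem relInterior_subset {m : ℕ} {M D : Set (E m)} : relInterior M D ⊆ D := by
  intro x hx
  by_contra h
  exact hx.2 (subset_closure ⟨hx.1, h⟩)

theorem relInterior_mono {m : ℕ} {M D D' : Set (E m)} (h : D ⊆ D') :
    relInterior M D ⊆ relInterior M D' :=
  fun _ hx => ⟨hx.1, fun hx' => hx.2 (closure_mono (sdiff_subset_sdiff_right h) hx')⟩

theorem exists_ball_subset_relInterior {m : ℕ} {M D : Set (E m)} {x : E m}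
    (hx : x ∈ relInterior M D) : ∃ ρ > 0, M ∩ ball x ρ ⊆ relInterior M D := by
  obtain ⟨ρ, hρ, h⟩ := Metric.isOpen_iff.1 (isClosed_closure (s := M \ D)).isOpen_compl x hx.2
  exact ⟨ρ, hρ, fun y hy => ⟨hy.1, h hy.2⟩⟩

/-- A set whose separated finite subsets have bounded cardinality has a finite separated net. -/
theorem exists_separated_net {X : Type*} [PseudoMetricSpace X] {Y : Set X} {s : ℝ} {N : ℕ}
    (hs : 0 ≤ s) (hN : ∀ T : Finset X, ↑T ⊆ Y → (T : Set X).Pairwise (fun x y => s < dist x y) →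
      T.card ≤ N) :
    ∃ T : Finset X, ↑T ⊆ Y ∧ (T : Set X).Pairwise (fun x y => s < dist x y) ∧
      ∀ y ∈ Y, ∃ x ∈ T, dist y x ≤ s := by
  classical
  set C : Set ℕ := {n | ∃ T : Finset X, ↑T ⊆ Y ∧
    (T : Set X).Pairwise (fun x y => s < dist x y) ∧ T.card = n}
  have hne : C.Nonempty := ⟨0, ∅, by simp, by simp, rfl⟩
  have hbdd : BddAbove C := ⟨N, by
    rintro _ ⟨T, h1, h2, rfl⟩
    exact hN T h1 h2⟩
  -- A separated set of maximal cardinality is a net, since any point far from it could be added.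
  obtain ⟨T, hT1, hT2, hT3⟩ := Nat.sSup_mem hne hbdd
  refine ⟨T, hT1, hT2, fun y hy => ?_⟩
  by_contra! hcon
  have hyT : y ∉ T := fun h => by
    have := hcon y h
    rw [dist_self] at this
    exact absurd this (not_lt.2 hs)
  have hmem : (insert y T).card ∈ C := by
    refine ⟨insert y T, ?_, ?_, rfl⟩
    · rw [Finset.coe_insert]
      exact insert_subset hy hT1
    · rw [Finset.coe_insert]
      refine hT2.insert fun x hx _ => ⟨hcon x hx, ?_⟩
      rw [dist_comm]
      exact hcon x hx
  have := le_csSup hbdd hmem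
  rw [Finset.card_insert_of_notMem hyT, hT3] at this
  omega

/-- The balls of radius `s / 2` about separated points are disjoint, each has volume at least a
constant times `s ^ d`, and all lie in a neighbourhood of `A` of finite volume. -/
theorem IsC2Submanifold.exists_card_separated_le {m d : ℕ} (hd : 0 < d) {M : Set (E m)}
    (hM : IsC2Submanifold d M) {A : Set (E m)} (hA : IsCompact A) (hAM : A ⊆ M) :
    ∃ C > 0, ∃ r₀ > 0, ∀ s, 0 < s → s < r₀ → ∀ T : Finset (E m), ↑T ⊆ A →
      (T : Set (E m)).Pairwise (fun x y => s < dist x y) → (T.card : ℝ) ≤ C / s ^ d := by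
  obtain ⟨r₀, hr₀, h⟩ := hM.exists_nearly_euclidean hd hA hAM one_pos
  obtain ⟨t, htA, htf, ht⟩ := hA.finite_cover_balls (e := r₀ / 4) (by positivity)
  set V : Set (E m) := ⋃ x ∈ t, M ∩ closedBall x (r₀ / 2) with hV
  have hVfin : μHE[d] V < ∞ := measure_biUnion_lt_top htf fun x hx =>
    (h x (htA hx) (r₀ / 2) (by positivity) (by linarith)).1.trans_lt ENNReal.ofReal_lt_top
  have hθ := theta_pos d
  refine ⟨((μHE[d] V).toReal + 1) * 2 ^ (d + 1) / theta d, by positivity, r₀ / 2, by positivity,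
    fun s hs hsr T hTA hsep => ?_⟩
  have hdisj : (T : Set (E m)).PairwiseDisjoint fun x => M ∩ closedBall x (s / 2) := by
    intro x hx y hy hxy
    refine (closedBall_disjoint_closedBall ?_).mono inter_subset_right inter_subset_right
    have := hsep hx hy hxy
    linarith
  have hsub : (⋃ x ∈ T, M ∩ closedBall x (s / 2)) ⊆ V := by
    refine iUnion₂_subset fun x hx z hz => ?_
    have := ht (hTA hx)
    simp only [mem_iUnion] at this
    obtain ⟨y, hy, hxy⟩ := this
    refine mem_iUnion₂.2 ⟨y, hy, hz.1, ?_⟩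
    have h1 : dist z x ≤ s / 2 := hz.2
    have h2 : dist x y < r₀ / 4 := hxy
    have := dist_triangle z x y
    rw [mem_closedBall]
    linarith
  have hsum : (T.card : ℝ≥0∞) * ENNReal.ofReal (theta d * (s / 2) ^ d / (1 + 1)) ≤ μHE[d] V := by
    refine le_trans ?_ (measure_mono hsub)
    rw [measure_biUnion_finset hdisj fun x _ => hM.measurableSet.inter measurableSet_closedBall,
      ← nsmul_eq_mul]
    exact Finset.card_nsmul_le_sum _ _ _ fun x hx =>
      (h x (hTA hx) (s / 2) (by positivity) (by linarith)).2.1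
  have hreal : (T.card : ℝ) * (theta d * (s / 2) ^ d / (1 + 1)) ≤ (μHE[d] V).toReal := by
    have := ENNReal.toReal_mono hVfin.ne hsum
    rwa [ENNReal.toReal_mul, ENNReal.toReal_natCast, ENNReal.toReal_ofReal (by positivity)] at this
  rw [div_div, le_div_iff₀ (by positivity)]
  rw [div_pow] at hreal
  have h3 : (T.card : ℝ) * (theta d * s ^ d) =
      (T.card : ℝ) * (theta d * (s ^ d / 2 ^ d) / (1 + 1)) * 2 ^ (d + 1) := by
    rw [pow_succ]
    field_simp
    norm_num
  rw [h3]
  gcongr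
  linarith

section CoverPack

variable {m d : ℕ} {M A B : Set (E m)} {f : E m → ℝ}

/-- The small balls around the `r`-interior points of `B` all contain members of a family of
`O(r⁻ᵈ)` sets of large measure. -/
theorem exists_cover (hd : 0 < d) (hM : IsC2Submanifold d M) (hAM : A ⊆ M) (hA : IsCompact A)
    (hBA : B ⊆ A) (hfc : ContinuousOn f A) {a : ℝ} (ha : 0 < a)
    (haf : ENNReal.ofReal a < infOn B f) :
    ∃ C > 0, ∃ r₀ > 0, ∀ r, 0 < r → r < r₀ → ∃ (T : Finset (E m)) (S : E m → Set (E m)),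
      (T.card : ℝ) ≤ C / r ^ d ∧ (∀ x, MeasurableSet (S x)) ∧
      (∀ x ∈ T, ENNReal.ofReal (a * (theta d * r ^ d)) ≤ densityMeasure hM f (S x)) ∧
      ∀ y ∈ B ∩ rInterior M A r, ∃ x ∈ T, S x ⊆ geoBall M y r := by
  obtain ⟨a₁, ha₁, haa₁, ha₁f⟩ := ENNReal.lt_iff_exists_real_btwn.1 haf
  have haa₁' : a < a₁ := (ENNReal.ofReal_lt_ofReal_iff_of_nonneg ha.le).1 haa₁
  have hfB : ∀ x ∈ B, a₁ ≤ f x := by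
    intro x hx
    have h1 : infOn B f ≤ ENNReal.ofReal (f x) := iInf₂_le x hx
    have h2 := ha₁f.trans_le h1
    exact ((ENNReal.ofReal_lt_ofReal_iff_of_nonneg ha₁).1 h2).le
  -- `a₁` bounds `f` from below on `B`, `a₂` bounds it on small balls by uniform continuity, and the
  -- gap between `a` and `a₂` pays for the loss of volume.
  set a₂ := (a + a₁) / 2 with ha₂
  have ha₂a : a < a₂ := by rw [ha₂]; linarith
  have ha₂a₁ : a₂ < a₁ := by rw [ha₂]; linarith
  obtain ⟨δ, hδ, hunif⟩ := Metric.uniformContinuousOn_iff.1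
    (hA.uniformContinuousOn_of_continuous hfc) (a₁ - a₂) (by linarith)
  obtain ⟨ε, hε, hε4, hεa⟩ : ∃ ε : ℝ, 0 < ε ∧ ε < 1 / 4 ∧ a < a₂ * ((1 - 2 * ε) ^ d / (1 + ε)) := by
    have hc : ContinuousAt (fun ε : ℝ => a₂ * ((1 - 2 * ε) ^ d / (1 + ε))) 0 := by
      refine continuousAt_const.mul (ContinuousAt.div (by fun_prop) (by fun_prop) (by norm_num))
    have h1 : ∀ᶠ ε in 𝓝[>] (0 : ℝ), a < a₂ * ((1 - 2 * ε) ^ d / (1 + ε)) :=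
      (hc.tendsto.mono_left nhdsWithin_le_nhds).eventually_const_lt (by simpa using ha₂a)
    have h2 : ∀ᶠ ε in 𝓝[>] (0 : ℝ), ε < 1 / 4 :=
      (tendsto_id.mono_left nhdsWithin_le_nhds).eventually_lt_const (by norm_num)
    obtain ⟨ε, ⟨h3, h4⟩, h5⟩ := ((h1.and h2).and eventually_mem_nhdsWithin).exists
    exact ⟨ε, h5, h4, h3⟩
  obtain ⟨r₁, hr₁, hgeo⟩ := hM.exists_nearly_euclidean hd hA hAM hε
  obtain ⟨C, hC, r₂, hr₂, hcard⟩ := hM.exists_card_separated_le hd hA hAM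
  refine ⟨C / ε ^ d, by positivity, min r₁ (min r₂ δ), by positivity, fun r hr hrr => ?_⟩
  have hrr₁ : r < r₁ := hrr.trans_le (min_le_left _ _)
  have hrr₂ : r < r₂ := hrr.trans_le ((min_le_right _ _).trans (min_le_left _ _))
  have hrδ : r < δ := hrr.trans_le ((min_le_right _ _).trans (min_le_right _ _))
  have hYA : B ∩ rInterior M A r ⊆ A := inter_subset_left.trans hBA
  have hεr : ε * r < r₂ := by nlinarith
  -- The net is taken inside the `r`-interior part of `B`, so that the centres are `r`-interior
  -- points themselves.
  obtain ⟨T, hTY, hTsep, hTnet⟩ := exists_separated_net (Y := B ∩ rInterior M A r) (s := ε * r)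
    (N := ⌊C / (ε * r) ^ d⌋₊) (by positivity) fun T hT hsep =>
      Nat.le_floor (hcard (ε * r) (by positivity) hεr T (hT.trans hYA) hsep)
  have hsr : 0 < (1 - 2 * ε) * r := mul_pos (by linarith) hr
  have hsr₁ : (1 - 2 * ε) * r < r₁ := by nlinarith
  refine ⟨T, fun x => M ∩ closedBall x ((1 - 2 * ε) * r), ?_,
    fun x => hM.measurableSet.inter measurableSet_closedBall, fun x hx => ?_, fun y hy => ?_⟩
  · have := hcard (ε * r) (by positivity) hεr T (hTY.trans hYA) hTsep
    rwa [mul_pow, ← div_div] at this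
  · have hxY := hTY hx
    obtain ⟨-, hvol, -⟩ := hgeo x (hYA hxY) _ hsr hsr₁
    have hfS : ∀ z ∈ M ∩ closedBall x ((1 - 2 * ε) * r), a₂ ≤ f z := by
      rintro z ⟨hzM, hz⟩
      have hxz : dist x z ≤ (1 - 2 * ε) * r := by rwa [dist_comm]
      have hzA : z ∈ A := by
        -- Continuity of `f` is available only on `A`. Since `(1 + ε) * (1 - 2 * ε) ≤ 1`, the point
        -- `z` lies in the geodetic ball of radius `r` about the `r`-interior point `x`, hence in
        -- `A`.
        refine relInterior_subset (hxY.2.2 ⟨hzM, ?_⟩)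
        refine ((hgeo x (hYA hxY) _ hsr hsr₁).2.2 z hzM hxz).trans (ENNReal.ofReal_le_ofReal ?_)
        have : (1 + ε) * dist x z ≤ (1 + ε) * ((1 - 2 * ε) * r) := by gcongr
        nlinarith [mul_pos hε hr, mul_pos (mul_pos hε hε) hr]
      have h1 := hunif x (hYA hxY) z hzA (by nlinarith)
      rw [Real.dist_eq] at h1
      have h2 := hfB x hxY.1
      have h3 := (abs_lt.1 h1).2
      linarith
    refine le_trans ?_ (mul_le_densityMeasure hM (hM.measurableSet.inter measurableSet_closedBall)
      inter_subset_left hfS)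
    refine le_trans ?_ (mul_le_mul_right hvol _)
    rw [← ENNReal.ofReal_mul (by linarith)]
    refine ENNReal.ofReal_le_ofReal ?_
    have hpos : 0 < theta d * r ^ d := mul_pos (theta_pos d) (by positivity)
    have heq : a₂ * (theta d * ((1 - 2 * ε) * r) ^ d / (1 + ε)) =
        a₂ * ((1 - 2 * ε) ^ d / (1 + ε)) * (theta d * r ^ d) := by
      rw [mul_pow]
      ring
    rw [heq]
    exact mul_le_mul_of_nonneg_right hεa.le hpos.le
  · obtain ⟨x, hx, hyx⟩ := hTnet y hy
    refine ⟨x, hx, fun z hz => ⟨hz.1, ?_⟩⟩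
    have h1 : dist z x ≤ (1 - 2 * ε) * r := hz.2
    -- Shrinking by `2 * ε`, with `ε` spent on the distance to the net, leaves Euclidean radius `(1
    -- - ε) * r`; then `(1 + ε) * (1 - ε) ≤ 1` turns this into geodetic radius `r`.
    have h2 : dist y z ≤ (1 - ε) * r := by
      have := dist_triangle y x z
      rw [dist_comm z x] at h1
      linarith
    refine ((hgeo y (hYA hy) r hr hrr₁).2.2 z hz.1 (by nlinarith)).trans
      (ENNReal.ofReal_le_ofReal ?_)
    have : (1 + ε) * dist y z ≤ (1 + ε) * ((1 - ε) * r) := by gcongr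
    nlinarith [mul_pos (mul_pos hε hε) hr]

/-- If the density is less than `a` somewhere on `B`, then there are at least `c r⁻ᵈ` disjoint
balls of radius `r` around `r`-interior points of `B` with small measure. -/
theorem exists_packing (hd : 0 < d) (hM : IsC2Submanifold d M) (hAM : A ⊆ M) (hA : IsCompact A)
    (hBA : B ⊆ A) (hfc : ContinuousOn f A)
    (hB : B = closure (relInterior M B)) {a : ℝ} (ha : 0 < a)
    (haf : infOn B f < ENNReal.ofReal a) :
    ∃ c > 0, ∃ r₀ > 0, ∀ r, 0 < r → r < r₀ → ∃ T : Finset (E m),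
      c / r ^ d ≤ (T.card : ℝ) ∧ ↑T ⊆ B ∩ rInterior M A r ∧
      (T : Set (E m)).PairwiseDisjoint (fun x => M ∩ closedBall x r) ∧
      ∀ x ∈ T, densityMeasure hM f (M ∩ closedBall x r) ≤
        ENNReal.ofReal (a * (theta d * r ^ d)) := by
  obtain ⟨x₀, hx₀, hfx₀⟩ : ∃ x ∈ B, f x < a := by
    simp only [infOn, iInf_lt_iff] at haf
    obtain ⟨x, hx, hlt⟩ := haf
    exact ⟨x, hx, (ENNReal.ofReal_lt_ofReal_iff ha).1 hlt⟩
  have hnear : ∀ x ∈ A, ∀ b, f x < b → ∃ ρ > 0, ∀ z ∈ A, dist z x < ρ → f z < b := by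
    intro x hx b hb
    have h1 : ∀ᶠ z in 𝓝[A] x, f z < b := (hfc x hx).eventually_lt_const hb
    obtain ⟨ρ, hρ, h2⟩ := Metric.mem_nhdsWithin_iff.1 h1
    exact ⟨ρ, hρ, fun z hz hzx => h2 ⟨hzx, hz⟩⟩
  -- As `B` is the closure of its interior, the point of low density can be moved into the interior.
  obtain ⟨x₁, hx₁, hfx₁⟩ : ∃ x ∈ relInterior M B, f x < a := by
    obtain ⟨ρ, hρ, h1⟩ := hnear x₀ (hBA hx₀) a hfx₀
    rw [hB] at hx₀
    obtain ⟨x, hx, hxx⟩ := Metric.mem_closure_iff.1 hx₀ ρ hρ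
    exact ⟨x, hx, h1 x (hBA (relInterior_subset hx)) (by rwa [dist_comm])⟩
  obtain ⟨a₁, ha₁, ha₁a, hfa₁⟩ : ∃ a₁, 0 < a₁ ∧ a₁ < a ∧ f x₁ < a₁ := by
    obtain ⟨b, hb1, hb2⟩ := exists_between (max_lt hfx₁ ha)
    exact ⟨b, (le_max_right _ _).trans_lt hb1, hb2, (le_max_left _ _).trans_lt hb1⟩
  have hx₁A : x₁ ∈ A := hBA (relInterior_subset hx₁)
  obtain ⟨ρ₁, hρ₁, hρ₁f⟩ := hnear x₁ hx₁A a₁ hfa₁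
  obtain ⟨ρ₂, hρ₂, hρ₂B⟩ := exists_ball_subset_relInterior hx₁
  -- With this `ε` the volume factor `1 + ε` is exactly `a / a₁`, which turns the density bound `a₁`
  -- into `a`.
  have hε : 0 < a / a₁ - 1 := by
    rw [sub_pos, one_lt_div ha₁]
    exact ha₁a
  obtain ⟨r₁, hr₁, hgeo⟩ := hM.exists_nearly_euclidean hd hA hAM hε
  obtain ⟨C, hC, r₂, hr₂, hcard⟩ := hM.exists_card_separated_le hd hA hAM
  set ρ := min (min ρ₁ ρ₂) r₁ / 3 with hρdef
  have hρ : 0 < ρ := by positivity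
  have hρρ₁ : 3 * ρ ≤ ρ₁ := by
    rw [hρdef, mul_div_cancel₀ _ (by norm_num)]
    exact (min_le_left _ _).trans (min_le_left _ _)
  have hρρ₂ : 3 * ρ ≤ ρ₂ := by
    rw [hρdef, mul_div_cancel₀ _ (by norm_num)]
    exact (min_le_left _ _).trans (min_le_right _ _)
  have hρr₁ : 3 * ρ ≤ r₁ := by
    rw [hρdef, mul_div_cancel₀ _ (by norm_num)]
    exact min_le_right _ _
  have hint : ∀ z ∈ M, dist z x₁ < 3 * ρ → z ∈ relInterior M B := fun z hz hzx =>
    hρ₂B ⟨hz, hzx.trans_le hρρ₂⟩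
  set V := M ∩ closedBall x₁ ρ with hV
  obtain ⟨-, hVlow, -⟩ := hgeo x₁ hx₁A ρ hρ (by linarith)
  have hθ := theta_pos d
  have h1ε : 1 + (a / a₁ - 1) = a / a₁ := by ring
  rw [h1ε] at hVlow
  have hVB : V ⊆ relInterior M B := fun z hz =>
    hint z hz.1 (lt_of_le_of_lt hz.2 (by linarith))
  have hVA : V ⊆ A := hVB.trans (relInterior_subset.trans hBA)
  refine ⟨ρ ^ d / (a / a₁) / (a / a₁ * 2 ^ d), by positivity, min (r₂ / 2) (ρ / 2), by positivity,
    fun r hr hrr => ?_⟩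
  have hrr₂ : r < r₂ / 2 := hrr.trans_le (min_le_left _ _)
  have hrρ : r < ρ / 2 := hrr.trans_le (min_le_right _ _)
  -- Separation by `2 * r` makes the `r`-balls disjoint, while the `2 * r`-balls cover `V`;
  -- comparing volumes bounds the number of centres from below.
  obtain ⟨T, hTV, hTsep, hTnet⟩ := exists_separated_net (Y := V) (s := 2 * r)
    (N := ⌊C / (2 * r) ^ d⌋₊) (by positivity) fun T hT hsep =>
      Nat.le_floor (hcard (2 * r) (by positivity) (by linarith) T (hT.trans hVA) hsep)
  have hballs : ∀ x ∈ T, M ∩ closedBall x r ⊆ relInterior M B := by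
    rintro x hx z ⟨hzM, hz⟩
    have h1 : dist z x ≤ r := hz
    have h2 : dist x x₁ ≤ ρ := (hTV hx).2
    have := dist_triangle z x x₁
    exact hint z hzM (by linarith)
  refine ⟨T, ?_, fun x hx => ⟨relInterior_subset (hVB (hTV hx)), hVA (hTV hx), ?_⟩, ?_, ?_⟩
  · have hsub : V ⊆ ⋃ x ∈ T, M ∩ closedBall x (2 * r) := fun z hz => by
      obtain ⟨x, hx, hzx⟩ := hTnet z hz
      exact mem_iUnion₂.2 ⟨x, hx, hz.1, hzx⟩
    have hsum : μHE[d] V ≤ T.card * ENNReal.ofReal (a / a₁ * (theta d * (2 * r) ^ d)) := by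
      refine (measure_mono hsub).trans ((measure_biUnion_finset_le _ _).trans ?_)
      rw [← nsmul_eq_mul]
      refine Finset.sum_le_card_nsmul _ _ _ fun x hx => ?_
      have := (hgeo x (hVA (hTV hx)) (2 * r) (by positivity) (by linarith)).1
      rwa [h1ε] at this
    have h2 := hVlow.trans hsum
    rw [← ENNReal.ofReal_natCast, ← ENNReal.ofReal_mul (Nat.cast_nonneg _),
      ENNReal.ofReal_le_ofReal_iff (mul_nonneg (Nat.cast_nonneg _) (by positivity))] at h2
    rw [div_div, div_le_iff₀ (by positivity)]
    have h3 : theta d * (ρ ^ d / (a / a₁)) ≤ theta d * (T.card * (a / a₁ * 2 ^ d * r ^ d)) := by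
      calc theta d * (ρ ^ d / (a / a₁)) = theta d * ρ ^ d / (a / a₁) := by ring
        _ ≤ _ := h2
        _ = _ := by rw [mul_pow]; ring
    exact le_of_mul_le_mul_left h3 hθ
  · exact (geoBall_subset_closedBall M x hr.le).trans
      ((hballs x hx).trans (relInterior_mono hBA))
  · intro x hx y hy hxy
    refine (closedBall_disjoint_closedBall ?_).mono inter_subset_right inter_subset_right
    have := hTsep hx hy hxy
    linarith
  · intro x hx
    have hfS : ∀ z ∈ M ∩ closedBall x r, f z ≤ a₁ := by
      rintro z ⟨hzM, hz⟩
      have h1 : dist z x ≤ r := hz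
      have h2 : dist x x₁ ≤ ρ := (hTV hx).2
      have := dist_triangle z x x₁
      exact (hρ₁f z (hBA (relInterior_subset (hballs x hx ⟨hzM, hz⟩))) (by linarith)).le
    refine (densityMeasure_le_mul hM (hM.measurableSet.inter measurableSet_closedBall)
      inter_subset_left hfS).trans ?_
    refine (mul_le_mul_right (hgeo x (hVA (hTV hx)) r hr (by linarith)).1 _).trans (le_of_eq ?_)
    rw [h1ε, ← ENNReal.ofReal_mul ha₁.le]
    congr 1
    field_simp

/-- A compact subset of the interior of `A` lies in the `r`-interior for small `r`. -/
theorem exists_subset_rInterior (hBA : B ⊆ A) (hB : IsCompact B) (hBi : B ⊆ relInterior M A) :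
    ∃ r₀ > 0, ∀ r, 0 < r → r < r₀ → B ⊆ rInterior M A r := by
  obtain ⟨r₀, hr₀, h⟩ := IsCompact.exists_uniform_radius hB
    (Q := fun x r => x ∈ rInterior M A r) fun y hy => by
      obtain ⟨ρ, hρ, hsub⟩ := exists_ball_subset_relInterior (hBi hy)
      refine ⟨ρ / 2, by positivity, fun x hx hxy r hr hrρ => ⟨hBA hx, ?_⟩⟩
      refine (geoBall_subset_closedBall M x hr.le).trans fun z hz => hsub ⟨hz.1, ?_⟩
      have h1 : dist z x ≤ r := hz.2
      have := dist_triangle z x y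
      rw [mem_ball]
      linarith
  exact ⟨r₀, hr₀, fun r hr hrr x hx => h x hx r hr hrr⟩

end CoverPack

end Coverage

end

noncomputable section

namespace Coverage

/-! ### Binomial tails -/

/-- The probability that a binomial variable with parameters `n` and `p` is at least `k`. -/
def binTail (p : ℝ) : ℕ → ℕ → ℝ
  | _, 0 => 1
  | 0, _ + 1 => 0
  | n + 1, k + 1 => (1 - p) * binTail p n (k + 1) + p * binTail p n k

theorem binTail_zero_right (p : ℝ) (n : ℕ) : binTail p n 0 = 1 := by
  cases n <;> rw [binTail]

theorem binTail_zero_succ (p : ℝ) (k : ℕ) : binTail p 0 (k + 1) = 0 := by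
  rw [binTail]

theorem binTail_succ (p : ℝ) (n k : ℕ) :
    binTail p (n + 1) k = (1 - p) * binTail p n k + p * binTail p n (k - 1) := by
  cases k with
  | zero => simp [binTail_zero_right]
  | succ k => rw [binTail, Nat.add_sub_cancel]

theorem binTail_mem_Icc {p : ℝ} (hp : p ∈ Icc (0 : ℝ) 1) (n k : ℕ) :
    binTail p n k ∈ Icc (0 : ℝ) 1 := by
  induction n generalizing k with
  | zero =>
    cases k with
    | zero => simp [binTail_zero_right]
    | succ k => simp [binTail_zero_succ]
  | succ n ih =>
    rw [binTail_succ]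
    have := convex_Icc (0 : ℝ) 1 (ih k) (ih (k - 1)) (sub_nonneg.2 hp.2) hp.1 (by ring)
    simpa using this

theorem binTail_le_pred {p : ℝ} (hp : p ∈ Icc (0 : ℝ) 1) (n k : ℕ) :
    binTail p n k ≤ binTail p n (k - 1) := by
  induction n generalizing k with
  | zero =>
    cases k with
    | zero => rfl
    | succ k =>
      rw [binTail_zero_succ]
      exact (binTail_mem_Icc hp _ _).1
  | succ n ih =>
    rw [binTail_succ, binTail_succ]
    have h1 := sub_nonneg.2 hp.2
    have h0 := hp.1
    gcongr
    · exact ih k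
    · exact ih (k - 1)

theorem binTail_mono {p q : ℝ} (hp : 0 ≤ p) (hpq : p ≤ q) (hq : q ≤ 1) (n k : ℕ) :
    binTail p n k ≤ binTail q n k := by
  have hp' : p ∈ Icc (0 : ℝ) 1 := ⟨hp, hpq.trans hq⟩
  have hq' : q ∈ Icc (0 : ℝ) 1 := ⟨hp.trans hpq, hq⟩
  induction n generalizing k with
  | zero =>
    cases k with
    | zero => simp [binTail_zero_right]
    | succ k => simp [binTail_zero_succ]
  | succ n ih =>
    rw [binTail_succ, binTail_succ]
    have h1 := mul_le_mul_of_nonneg_left (ih k) (sub_nonneg.2 hp'.2)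
    have h2 := mul_le_mul_of_nonneg_left (ih (k - 1)) hp
    have h3 := mul_nonneg (sub_nonneg.2 hpq) (sub_nonneg.2 (binTail_le_pred hq' n k))
    linarith

/-- This is Markov's inequality for `z` raised to a binomial variable, whose mean is `(1 - p + p *
z) ^ n`. Here it comes directly from the recursion for `binTail`. -/
theorem pow_mul_binTail_le {p z : ℝ} (hp : p ∈ Icc (0 : ℝ) 1) (hz : 1 ≤ z) (n k : ℕ) :
    z ^ k * binTail p n k ≤ (1 - p + p * z) ^ n := by
  have h1 := sub_nonneg.2 hp.2
  have h0 := hp.1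
  have hb : 1 ≤ 1 - p + p * z := by nlinarith
  induction n generalizing k with
  | zero =>
    cases k with
    | zero => simp [binTail_zero_right]
    | succ k => simp [binTail_zero_succ]
  | succ n ih =>
    cases k with
    | zero =>
      rw [binTail_zero_right, pow_zero, one_mul]
      exact one_le_pow₀ hb
    | succ k =>
      rw [binTail_succ, Nat.add_sub_cancel]
      calc z ^ (k + 1) * ((1 - p) * binTail p n (k + 1) + p * binTail p n k)
          = (1 - p) * (z ^ (k + 1) * binTail p n (k + 1)) + p * z * (z ^ k * binTail p n k) := by
            ring
        _ ≤ (1 - p) * (1 - p + p * z) ^ n + p * z * (1 - p + p * z) ^ n := by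
            gcongr
            · exact ih (k + 1)
            · exact ih k
        _ = _ := by ring

theorem pow_mul_one_sub_binTail_le {p z : ℝ} (hp : p ∈ Icc (0 : ℝ) 1) (hz0 : 0 ≤ z) (hz : z ≤ 1)
    (n k : ℕ) : z ^ k * (1 - binTail p n k) ≤ (1 - p + p * z) ^ n := by
  have h1 := sub_nonneg.2 hp.2
  have h0 := hp.1
  have hb : 0 ≤ 1 - p + p * z := by positivity
  induction n generalizing k with
  | zero =>
    cases k with
    | zero => simp [binTail_zero_right]
    | succ k =>
      rw [binTail_zero_succ, sub_zero, mul_one, pow_zero]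
      exact pow_le_one₀ hz0 hz
  | succ n ih =>
    cases k with
    | zero =>
      rw [binTail_zero_right, sub_self, mul_zero]
      positivity
    | succ k =>
      rw [binTail_succ, Nat.add_sub_cancel]
      calc z ^ (k + 1) * (1 - ((1 - p) * binTail p n (k + 1) + p * binTail p n k))
          = (1 - p) * (z ^ (k + 1) * (1 - binTail p n (k + 1)))
            + p * z * (z ^ k * (1 - binTail p n k)) := by
            ring
        _ ≤ (1 - p) * (1 - p + p * z) ^ n + p * z * (1 - p + p * z) ^ n := by
            gcongr
            · exact ih (k + 1)
            · exact ih k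
        _ = _ := by ring

theorem one_add_mul_pow_le_exp {p z : ℝ} (hb : 0 ≤ 1 - p + p * z) (n : ℕ) :
    (1 - p + p * z) ^ n ≤ Real.exp (n * p * (z - 1)) := by
  have h : 1 - p + p * z ≤ Real.exp (p * (z - 1)) := by
    have := Real.add_one_le_exp (p * (z - 1))
    linarith
  calc (1 - p + p * z) ^ n ≤ Real.exp (p * (z - 1)) ^ n := pow_le_pow_left₀ hb h n
    _ = _ := by rw [← Real.exp_nat_mul]; congr 1; ring

/-- The Chernoff exponent, in terms of the ratio `x` of the mean to `k`. -/
theorem exp_eq_of_ratio {x : ℝ} (hx : 0 < x) (k : ℕ) :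
    Real.exp (-(k * (x - 1 - Real.log x))) = Real.exp (k * x * (x⁻¹ - 1)) / x⁻¹ ^ k := by
  rw [eq_div_iff (by positivity), ← Real.exp_log (show (0 : ℝ) < x⁻¹ ^ k by positivity),
    ← Real.exp_add, Real.log_pow, Real.log_inv]
  congr 1
  field_simp
  ring

/-- Chernoff's bound for the upper tail. -/
theorem binTail_le_exp {p x : ℝ} (hp : p ∈ Icc (0 : ℝ) 1) (hx : 0 < x) (hx1 : x ≤ 1) {n k : ℕ}
    (hnp : n * p = k * x) :
    binTail p n k ≤ Real.exp (-(k * (x - 1 - Real.log x))) := by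
  -- `z = x⁻¹ = k / (n p)` minimizes `z⁻ᵏ exp(n p (z - 1))`.
  have hz : 1 ≤ x⁻¹ := (one_le_inv₀ hx).2 hx1
  have h1 := pow_mul_binTail_le hp hz n k
  have h2 := one_add_mul_pow_le_exp (p := p) (z := x⁻¹) (by
    have := mul_nonneg hp.1 (inv_pos.2 hx).le
    linarith [hp.2]) n
  rw [exp_eq_of_ratio hx, ← hnp, le_div_iff₀ (by positivity), mul_comm]
  exact h1.trans h2

/-- Chernoff's bound for the lower tail. -/
theorem one_sub_binTail_le_exp {p x : ℝ} (hp : p ∈ Icc (0 : ℝ) 1) (hx1 : 1 ≤ x) {n k : ℕ}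
    (hnp : n * p = k * x) :
    1 - binTail p n k ≤ Real.exp (-(k * (x - 1 - Real.log x))) := by
  have hx : 0 < x := by linarith
  have hz : x⁻¹ ≤ 1 := inv_le_one_of_one_le₀ hx1
  have h1 := pow_mul_one_sub_binTail_le hp (inv_pos.2 hx).le hz n k
  have h2 := one_add_mul_pow_le_exp (p := p) (z := x⁻¹) (by
    have := mul_nonneg hp.1 (inv_pos.2 hx).le
    linarith [hp.2]) n
  rw [exp_eq_of_ratio hx, ← hnp, le_div_iff₀ (by positivity), mul_comm]
  exact h1.trans h2

/-- The left side is the probability of exactly `j` successes; the weight at `j = k - 1` alone will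
give the lower tail to leading exponential order. -/
theorem choose_mul_le_one_sub_binTail {p : ℝ} (hp : p ∈ Icc (0 : ℝ) 1) {n k j : ℕ} (hj : j < k) :
    n.choose j * p ^ j * (1 - p) ^ (n - j) ≤ 1 - binTail p n k := by
  have h1 := sub_nonneg.2 hp.2
  have h0 := hp.1
  induction n generalizing k j with
  | zero =>
    obtain ⟨k, rfl⟩ := Nat.exists_eq_add_of_lt hj
    rw [binTail_zero_succ]
    cases j <;> simp
  | succ n ih =>
    obtain ⟨k, rfl⟩ : ∃ k', k = k' + 1 := ⟨k - 1, by omega⟩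
    have heq : 1 - binTail p (n + 1) (k + 1) =
        (1 - p) * (1 - binTail p n (k + 1)) + p * (1 - binTail p n k) := by
      rw [binTail_succ, Nat.add_sub_cancel]
      ring
    rw [heq]
    cases j with
    | zero =>
      have h2 := ih (k := k + 1) (j := 0) (by omega)
      have h3 : 0 ≤ p * (1 - binTail p n k) :=
        mul_nonneg h0 (sub_nonneg.2 (binTail_mem_Icc hp n k).2)
      have h4 := mul_le_mul_of_nonneg_left h2 h1
      simp only [Nat.choose_zero_right, Nat.cast_one, pow_zero, one_mul, mul_one, tsub_zero] at h4 ⊢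
      rw [pow_succ']
      linarith
    | succ j =>
      have h2 := mul_le_mul_of_nonneg_left (ih (k := k + 1) (j := j + 1) (by omega)) h1
      have h3 := mul_le_mul_of_nonneg_left (ih (k := k) (j := j) (by omega)) h0
      refine le_trans (le_of_eq ?_) (add_le_add h2 h3)
      rw [Nat.choose_succ_succ, Nat.add_sub_add_right]
      push_cast
      -- When `n ≤ j` the subtraction `n - (j + 1)` is truncated, but its term carries the factor
      -- `n.choose (j + 1) = 0`.
      rcases Nat.lt_or_ge j n with hjn | hjn
      · have : n - j = (n - (j + 1)) + 1 := by omega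
        rw [this]
        ring
      · rw [Nat.choose_eq_zero_of_lt (show n < j + 1 by omega)]
        push_cast
        ring

end Coverage

end

noncomputable section

namespace Coverage

/-! ### Numbers of points in disjoint sets -/

/-- The number of indices `i < n` with `x i ∈ S`. -/
def hits {α : Type*} (x : ℕ → α) (S : Set α) (n : ℕ) : ℕ :=
  ∑ i ∈ Finset.range n, S.indicator (fun _ => 1) (x i)

theorem natCast_hits_eq_encard {α : Type*} (x : ℕ → α) (S : Set α) (n : ℕ) :
    (hits x S n : ℕ∞) = {i | i < n ∧ x i ∈ S}.encard := by
  classical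
  have h : {i | i < n ∧ x i ∈ S} = ((Finset.range n).filter fun i => x i ∈ S : Finset ℕ) := by
    ext i
    simp
  rw [h, Set.encard_coe_eq_coe_finsetCard, Finset.card_filter, hits]
  simp only [Set.indicator_apply]

theorem firstPoints_inter {m : ℕ} (x : ℕ → E m) (S : Set (E m)) (n : ℕ) :
    firstPoints x n ∩ S = x '' {i | i < n ∧ x i ∈ S} := by
  ext y
  constructor
  · rintro ⟨⟨i, hi, rfl⟩, hS⟩
    exact ⟨i, ⟨hi, hS⟩, rfl⟩
  · rintro ⟨i, ⟨hi, hS⟩, rfl⟩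
    exact ⟨⟨i, hi, rfl⟩, hS⟩

/-- Coincident sample points count once in the set but repeatedly in `hits`, so equality needs
distinct points while this bound does not. -/
theorem encard_firstPoints_inter_le {m : ℕ} (x : ℕ → E m) (S : Set (E m)) (n : ℕ) :
    (firstPoints x n ∩ S).encard ≤ hits x S n := by
  rw [firstPoints_inter, natCast_hits_eq_encard]
  exact Set.encard_image_le _ _

theorem encard_firstPoints_inter {m : ℕ} {x : ℕ → E m} (hx : Function.Injective x) (S : Set (E m))
    (n : ℕ) : (firstPoints x n ∩ S).encard = hits x S n := by
  rw [firstPoints_inter, natCast_hits_eq_encard, hx.encard_image]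

theorem hits_succ {α : Type*} (x : ℕ → α) (S : Set α) (n : ℕ) :
    hits x S (n + 1) = hits x S n + S.indicator (fun _ => 1) (x n) :=
  Finset.sum_range_succ _ _

theorem hits_zero {α : Type*} (x : ℕ → α) (S : Set α) : hits x S 0 = 0 := rfl

/-- Expanding the product, the terms of order zero and one in `e` are kept and the remaining
nonnegative ones dropped. -/
theorem prod_add_sum_mul_le_prod_add {ι : Type*} [DecidableEq ι] (T : Finset ι) {a e : ι → ℝ}
    (ha : ∀ i ∈ T, 0 ≤ a i) (he : ∀ i ∈ T, 0 ≤ e i) :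
    ∏ i ∈ T, a i + ∑ c ∈ T, e c * ∏ i ∈ T.erase c, a i ≤ ∏ i ∈ T, (a i + e i) := by
  induction T using Finset.induction_on with
  | empty => simp
  | insert j T hj ih =>
    have ih' := ih (fun i hi => ha i (Finset.mem_insert_of_mem hi))
      (fun i hi => he i (Finset.mem_insert_of_mem hi))
    have haj := ha j (Finset.mem_insert_self _ _)
    have hej := he j (Finset.mem_insert_self _ _)
    have h1 : ∑ c ∈ T, e c * ∏ i ∈ (insert j T).erase c, a i =
        a j * ∑ c ∈ T, e c * ∏ i ∈ T.erase c, a i := by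
      rw [Finset.mul_sum]
      refine Finset.sum_congr rfl fun c hc => ?_
      have hcj : j ≠ c := fun h => hj (h ▸ hc)
      rw [Finset.erase_insert_of_ne hcj,
        Finset.prod_insert fun h => hj (Finset.mem_of_mem_erase h)]
      ring
    rw [Finset.prod_insert hj, Finset.sum_insert hj, Finset.prod_insert hj,
      Finset.erase_insert hj, h1]
    have h2 : 0 ≤ e j * ∑ c ∈ T, e c * ∏ i ∈ T.erase c, a i :=
      mul_nonneg hej (Finset.sum_nonneg fun c hc => mul_nonneg
        (he c (Finset.mem_insert_of_mem hc)) (Finset.prod_nonneg fun i hi =>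
          ha i (Finset.mem_insert_of_mem (Finset.mem_of_mem_erase hi))))
    have h3 := mul_le_mul_of_nonneg_left ih' (add_nonneg haj hej)
    linarith

section Independent

variable {Ω 𝓧 : Type*} [MeasurableSpace Ω] [MeasurableSpace 𝓧] {P : Measure Ω}
  {μ : Measure 𝓧} {X : ℕ → Ω → 𝓧}

theorem measurable_hits (hXm : ∀ i, Measurable (X i)) {S : Set 𝓧} (hS : MeasurableSet S) (n : ℕ) :
    Measurable fun ω => hits (fun i => X i ω) S n :=
  Finset.measurable_fun_sum _ fun i _ => (measurable_const.indicator hS).comp (hXm i)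

theorem indepFun_hits (hXm : ∀ i, Measurable (X i)) (hXind : iIndepFun X P) {ι : Type*}
    {S : ι → Set 𝓧} (hS : ∀ i, MeasurableSet (S i)) (n : ℕ) :
    IndepFun (fun ω i => hits (fun i => X i ω) (S i) n) (X n) P := by
  have h := hXind.indepFun_finset (Finset.range n) {n} (by simp) hXm
  have hφ : Measurable fun (y : Finset.range n → 𝓧) (i : ι) =>
      ∑ j, (S i).indicator (fun _ => 1) (y j) :=
    measurable_pi_iff.2 fun i => Finset.measurable_fun_sum _ fun j _ =>
      (measurable_const.indicator (hS i)).comp (measurable_pi_apply j)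
  have hψ : Measurable fun y : ({n} : Finset ℕ) → 𝓧 => y ⟨n, by simp⟩ := measurable_pi_apply _
  have h2 := h.comp hφ hψ
  refine IndepFun.congr h2 (Eventually.of_forall fun ω => ?_) (Eventually.of_forall fun ω => rfl)
  ext i
  simp only [hits, Function.comp]
  exact (Finset.sum_coe_sort (Finset.range n)
    fun j => (S i).indicator (fun _ => (1 : ℕ)) (X j ω))

theorem measureReal_hits_inter (hXm : ∀ i, Measurable (X i)) (hXind : iIndepFun X P)
    (hXlaw : ∀ i, P.map (X i) = μ) {ι : Type*}
    {S : ι → Set 𝓧} (hS : ∀ i, MeasurableSet (S i)) (n : ℕ) (T : Finset ι) (k : ι → ℕ)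
    {C : Set 𝓧} (hC : MeasurableSet C) :
    P.real ({ω | ∀ i ∈ T, k i ≤ hits (fun i => X i ω) (S i) n} ∩ X n ⁻¹' C) =
      P.real {ω | ∀ i ∈ T, k i ≤ hits (fun i => X i ω) (S i) n} * μ.real C := by
  have hD : MeasurableSet {N : ι → ℕ | ∀ i ∈ T, k i ≤ N i} := by
    have : {N : ι → ℕ | ∀ i ∈ T, k i ≤ N i} = ⋂ i ∈ T, (fun N : ι → ℕ => N i) ⁻¹' Ici (k i) := by
      ext N
      simp
    rw [this]
    exact Finset.measurableSet_biInter _ fun i _ => measurable_pi_apply i measurableSet_Ici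
  have h := (indepFun_hits hXm hXind hS n).measure_inter_preimage_eq_mul _ _ hD hC
  have hlaw : P (X n ⁻¹' C) = μ C := by rw [← hXlaw n, Measure.map_apply (hXm n) hC]
  rw [hlaw] at h
  have h' := congrArg ENNReal.toReal h
  rw [ENNReal.toReal_mul] at h'
  exact h'

variable [IsProbabilityMeasure P]

/-- The numbers of points in disjoint sets are negatively dependent. -/
theorem measureReal_forall_le_hits_le (hXm : ∀ i, Measurable (X i)) (hXind : iIndepFun X P)
    (hXlaw : ∀ i, P.map (X i) = μ) {ι : Type*} {S : ι → Set 𝓧} (hS : ∀ i, MeasurableSet (S i))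
    (T : Finset ι) (hdisj : (T : Set ι).PairwiseDisjoint S) (n : ℕ) (k : ι → ℕ) :
    P.real {ω | ∀ i ∈ T, k i ≤ hits (fun i => X i ω) (S i) n} ≤
      ∏ i ∈ T, binTail (μ.real (S i)) n (k i) := by
  classical
  have hμ : IsProbabilityMeasure μ := by
    rw [← hXlaw 0]
    exact Measure.isProbabilityMeasure_map (hXm 0).aemeasurable
  have hp : ∀ i, μ.real (S i) ∈ Icc (0 : ℝ) 1 := fun i => ⟨measureReal_nonneg, measureReal_le_one⟩
  induction n generalizing k with
  | zero =>
    by_cases h : ∀ i ∈ T, k i = 0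
    · rw [Finset.prod_congr rfl fun i hi => by rw [h i hi, binTail_zero_right]]
      simp
    · push Not at h
      obtain ⟨i, hi, hki⟩ := h
      have : {ω | ∀ i ∈ T, k i ≤ hits (fun i => X i ω) (S i) 0} = ∅ := by
        refine eq_empty_of_forall_notMem fun ω hω => hki ?_
        simpa [hits_zero] using hω i hi
      rw [this, measureReal_empty]
      exact Finset.prod_nonneg fun i _ => (binTail_mem_Icc (hp i) _ _).1
  | succ n ih =>
    set F : (ι → ℕ) → Set Ω := fun k => {ω | ∀ i ∈ T, k i ≤ hits (fun i => X i ω) (S i) n} with hF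
    set U : Set 𝓧 := ⋃ i ∈ T, S i with hU
    have hUm : MeasurableSet U := Finset.measurableSet_biUnion _ fun i _ => hS i
    -- Condition on the last point: it misses every set, or it falls into exactly one `S c` and
    -- lowers that requirement by one.
    have hsub : {ω | ∀ i ∈ T, k i ≤ hits (fun i => X i ω) (S i) (n + 1)} ⊆
        (F k ∩ X n ⁻¹' Uᶜ) ∪
          ⋃ c ∈ T, F (fun i => if i = c then k i - 1 else k i) ∩ X n ⁻¹' S c := by
      intro ω hω
      by_cases hc : X n ω ∈ U
      · right
        simp only [hU, mem_iUnion] at hc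
        obtain ⟨c, hcT, hc⟩ := hc
        refine mem_iUnion₂.2 ⟨c, hcT, fun i hi => ?_, hc⟩
        have h1 := hω i hi
        rw [hits_succ] at h1
        change (if i = c then k i - 1 else k i) ≤ _
        split_ifs with hic
        · have h2 : (S i).indicator (fun _ => (1 : ℕ)) (X n ω) ≤ 1 := by
            rw [indicator_apply]
            split_ifs <;> omega
          omega
        · have h2 : X n ω ∉ S i := fun h3 =>
            Set.disjoint_left.1 (hdisj hi hcT hic) h3 hc
          rw [indicator_of_notMem h2] at h1
          exact h1
      · left
        refine ⟨fun i hi => ?_, hc⟩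
        have h1 := hω i hi
        have h2 : X n ω ∉ S i := fun h3 => hc (mem_iUnion₂.2 ⟨i, hi, h3⟩)
        rw [hits_succ, indicator_of_notMem h2] at h1
        exact h1
    set a : ι → ℝ := fun i => binTail (μ.real (S i)) n (k i)
    set b : ι → ℝ := fun i => binTail (μ.real (S i)) n (k i - 1)
    set p : ι → ℝ := fun i => μ.real (S i)
    have hpU : μ.real U = ∑ i ∈ T, p i :=
      measureReal_biUnion_finset hdisj fun i _ => hS i
    have hPF : P.real (F k) ≤ ∏ i ∈ T, a i := ih k
    have hPc : ∀ c ∈ T, P.real (F fun i => if i = c then k i - 1 else k i) ≤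
        b c * ∏ i ∈ T.erase c, a i := by
      intro c hc
      refine (ih _).trans (le_of_eq ?_)
      rw [← Finset.mul_prod_erase T _ hc]
      congr 1
      · simp [b]
      · refine Finset.prod_congr rfl fun i hi => ?_
        rw [if_neg (Finset.ne_of_mem_erase hi)]
    calc P.real {ω | ∀ i ∈ T, k i ≤ hits (fun i => X i ω) (S i) (n + 1)}
        ≤ P.real (F k ∩ X n ⁻¹' Uᶜ) +
          ∑ c ∈ T, P.real (F (fun i => if i = c then k i - 1 else k i) ∩ X n ⁻¹' S c) :=
          (measureReal_mono hsub).trans ((measureReal_union_le _ _).trans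
            (add_le_add le_rfl (measureReal_biUnion_finset_le _ _)))
      _ = P.real (F k) * (1 - ∑ i ∈ T, p i) +
          ∑ c ∈ T, P.real (F (fun i => if i = c then k i - 1 else k i)) * p c := by
          rw [measureReal_hits_inter hXm hXind hXlaw hS n T k hUm.compl,
            probReal_compl_eq_one_sub hUm, hpU]
          congr 1
          exact Finset.sum_congr rfl fun c _ =>
            measureReal_hits_inter hXm hXind hXlaw hS n T _ (hS c)
      _ ≤ (∏ i ∈ T, a i) * (1 - ∑ i ∈ T, p i) +
          ∑ c ∈ T, (b c * ∏ i ∈ T.erase c, a i) * p c := by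
          gcongr with c hc
          · rw [← hpU]
            linarith [measureReal_le_one (μ := μ) (s := U)]
          · exact hPc c hc
      _ = ∏ i ∈ T, a i + ∑ c ∈ T, p c * (b c - a c) * ∏ i ∈ T.erase c, a i := by
          rw [mul_sub, mul_one, Finset.mul_sum, sub_add_eq_add_sub, add_sub_assoc,
            ← Finset.sum_sub_distrib]
          congr 1
          refine Finset.sum_congr rfl fun c hc => ?_
          rw [← Finset.mul_prod_erase T a hc]
          ring
      -- One point enters at most one of the disjoint sets, so the recursion yields only first-order
      -- terms; independent counts would yield the full product.
      _ ≤ ∏ i ∈ T, (a i + p i * (b i - a i)) :=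
          prod_add_sum_mul_le_prod_add T (fun i _ => (binTail_mem_Icc (hp i) _ _).1) fun i _ =>
            mul_nonneg (hp i).1 (sub_nonneg.2 (binTail_le_pred (hp i) _ _))
      _ = _ := by
          refine Finset.prod_congr rfl fun i _ => ?_
          rw [binTail_succ]
          ring

theorem binTail_le_measureReal (hXm : ∀ i, Measurable (X i)) (hXind : iIndepFun X P)
    (hXlaw : ∀ i, P.map (X i) = μ) {S : Set 𝓧} (hS : MeasurableSet S) (n k : ℕ) :
    binTail (μ.real S) n k ≤ P.real {ω | k ≤ hits (fun i => X i ω) S n} := by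
  have hμ : IsProbabilityMeasure μ := by
    rw [← hXlaw 0]
    exact Measure.isProbabilityMeasure_map (hXm 0).aemeasurable
  induction n generalizing k with
  | zero =>
    cases k with
    | zero => simp [binTail_zero_right]
    | succ k => simp [binTail_zero_succ]
  | succ n ih =>
    have hF : ∀ (k : ℕ) {C : Set 𝓧}, MeasurableSet C →
        P.real ({ω | k ≤ hits (fun i => X i ω) S n} ∩ X n ⁻¹' C) =
          P.real {ω | k ≤ hits (fun i => X i ω) S n} * μ.real C := fun k C hC => by
      simpa using measureReal_hits_inter hXm hXind hXlaw (ι := Unit) (S := fun _ => S)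
        (fun _ => hS) n {()} (fun _ => k) hC
    have hsub : ({ω | k ≤ hits (fun i => X i ω) S n} ∩ X n ⁻¹' Sᶜ) ∪
        ({ω | k - 1 ≤ hits (fun i => X i ω) S n} ∩ X n ⁻¹' S) ⊆
        {ω | k ≤ hits (fun i => X i ω) S (n + 1)} := by
      rintro ω (⟨h1, h2⟩ | ⟨h1, h2⟩)
      · rw [mem_ofPred_eq, hits_succ]
        exact le_add_right h1
      · rw [mem_ofPred_eq, hits_succ, indicator_of_mem (mem_preimage.1 h2)]
        rw [mem_ofPred_eq] at h1
        omega
    refine le_trans ?_ (measureReal_mono hsub)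
    rw [measureReal_union, hF k hS.compl, hF (k - 1) hS, probReal_compl_eq_one_sub hS, binTail_succ,
      mul_comm (1 - μ.real S), mul_comm (μ.real S)]
    · gcongr
      · linarith [measureReal_le_one (μ := μ) (s := S)]
      · exact ih k
      · exact ih (k - 1)
    · exact (disjoint_compl_left.preimage _).mono inter_subset_right inter_subset_right
    · exact (measurableSet_le measurable_const (measurable_hits hXm hS n)).inter (hXm n hS)

theorem measureReal_hits_lt_le (hXm : ∀ i, Measurable (X i)) (hXind : iIndepFun X P)
    (hXlaw : ∀ i, P.map (X i) = μ) {S : Set 𝓧} (hS : MeasurableSet S) {p : ℝ} (hp : 0 ≤ p)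
    (hpS : p ≤ μ.real S) (n k : ℕ) :
    P.real {ω | hits (fun i => X i ω) S n < k} ≤ 1 - binTail p n k := by
  have hμ : IsProbabilityMeasure μ := by
    rw [← hXlaw 0]
    exact Measure.isProbabilityMeasure_map (hXm 0).aemeasurable
  have h1 := binTail_le_measureReal hXm hXind hXlaw hS n k
  have h2 := binTail_mono hp hpS measureReal_le_one n k
  have h3 : {ω | hits (fun i => X i ω) S n < k} = {ω | k ≤ hits (fun i => X i ω) S n}ᶜ := by
    ext ω
    simp
  rw [h3, probReal_compl_eq_one_sub
    (measurableSet_le measurable_const (measurable_hits hXm hS n))]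
  linarith

/-- Independent points with a common distribution without atoms are almost surely distinct. -/
theorem ae_injective [MeasurableSingletonClass 𝓧] [MeasurableEq 𝓧] (hXm : ∀ i, Measurable (X i))
    (hXind : iIndepFun X P) (hXlaw : ∀ i, P.map (X i) = μ) (hμ0 : ∀ x, μ {x} = 0) :
    ∀ᵐ ω ∂P, Function.Injective fun i => X i ω := by
  have hμ : IsProbabilityMeasure μ := by
    rw [← hXlaw 0]
    exact Measure.isProbabilityMeasure_map (hXm 0).aemeasurable
  have h : ∀ i j, i ≠ j → ∀ᵐ ω ∂P, X i ω ≠ X j ω := by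
    intro i j hij
    have hprod := (indepFun_iff_map_prod_eq_prod_map_map (hXm i).aemeasurable
      (hXm j).aemeasurable).1 (hXind.indepFun hij)
    rw [hXlaw, hXlaw] at hprod
    have hdiag : (μ.prod μ) (diagonal 𝓧) = 0 := by
      rw [Measure.prod_apply measurableSet_diagonal]
      have hsec : ∀ x : 𝓧, Prod.mk x ⁻¹' diagonal 𝓧 = {x} := fun x => by
        ext y
        simp [eq_comm]
      simp only [hsec, hμ0, lintegral_zero]
    rw [← hprod, Measure.map_apply ((hXm i).prodMk (hXm j)) measurableSet_diagonal] at hdiag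
    exact measure_eq_zero_iff_ae_notMem.1 hdiag
  have h' : ∀ᵐ ω ∂P, ∀ i j, i ≠ j → X i ω ≠ X j ω := by
    refine ae_all_iff.2 fun i => ae_all_iff.2 fun j => ?_
    by_cases hij : i = j
    · exact Eventually.of_forall fun ω h => absurd hij h
    · exact (h i j hij).mono fun ω hω _ => hω
  filter_upwards [h'] with ω hω i j hij
  by_contra hne
  exact hω i j hne hij

end Independent

end Coverage

end

noncomputable section

namespace Coverage

open Metric

/-! ### Borel–Cantelli arguments for coverage -/

/-- The sets `s j` need not be measurable, which matters because coverage events quantify over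
uncountably many centres. -/
theorem ae_eventually_notMem_of_le {Ω : Type*} [MeasurableSpace Ω] {P : Measure Ω}
    {s : ℕ → Set Ω} {b : ℕ → ℝ} (hb : Summable b)
    (h : ∀ᶠ j in atTop, P (s j) ≤ ENNReal.ofReal (b j)) :
    ∀ᵐ ω ∂P, ∀ᶠ j in atTop, ω ∉ s j := by
  obtain ⟨J, hJ⟩ := eventually_atTop.1 h
  have hsum : ∑' j, P (s (j + J)) ≠ ∞ :=
    ne_top_of_le_ne_top ((summable_nat_add_iff J).2 hb).tsum_ofReal_ne_top
      (ENNReal.tsum_le_tsum fun j => hJ (j + J) (by omega))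
  filter_upwards [ae_eventually_notMem hsum] with ω hω
  obtain ⟨N, hN⟩ := eventually_atTop.1 hω
  refine eventually_atTop.2 ⟨N + J, fun j hj => ?_⟩
  have := hN (j - J) (by omega)
  rwa [Nat.sub_add_cancel (by omega)] at this

theorem hits_mono {α : Type*} (x : ℕ → α) {S S' : Set α} (hS : S ⊆ S') {n n' : ℕ} (hn : n ≤ n') :
    hits x S n ≤ hits x S' n' :=
  (Finset.sum_le_sum fun i _ => indicator_le_indicator_of_subset (f := fun _ => (1 : ℕ)) hS
    (fun _ => Nat.zero_le _) (x i)).trans (Finset.sum_le_sum_of_subset (Finset.range_mono hn))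

section

variable {m d : ℕ} {M A B : Set (E m)} {f : E m → ℝ} {Ω : Type*} [MeasurableSpace Ω]
  {P : Measure Ω} [IsProbabilityMeasure P] {X : ℕ → Ω → E m}

/-- A union bound over the sets of `exists_cover`; their number is the source of the division by `r
j ^ d`. Sample size, multiplicity and radius are separate sequences so that subsequences of sample
sizes can be used. -/
theorem ae_eventually_covered (hd : 0 < d) (hM : IsC2Submanifold d M) (hAM : A ⊆ M)
    (hA : IsCompact A) (hBA : B ⊆ A) (hfc : ContinuousOn f A)
    (hXm : ∀ i, Measurable (X i)) (hXind : iIndepFun X P)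
    (hXlaw : ∀ i, P.map (X i) = densityMeasure hM f)
    {a : ℝ} (ha : 0 < a) (haf : ENNReal.ofReal a < infOn B f)
    {N K : ℕ → ℕ} {r b : ℕ → ℝ} (hr : ∀ᶠ j in atTop, 0 < r j) (hr0 : Tendsto r atTop (𝓝 0))
    (hb : Summable b)
    (hbound : ∀ᶠ j in atTop,
      (1 - binTail (a * (theta d * r j ^ d)) (N j) (K j)) / r j ^ d ≤ b j) :
    ∀ᵐ ω ∂P, ∀ᶠ j in atTop, ∀ y ∈ B ∩ rInterior M A (r j),
      K j ≤ hits (fun i => X i ω) (geoBall M y (r j)) (N j) := by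
  have hμ : IsProbabilityMeasure (densityMeasure hM f) := by
    rw [← hXlaw 0]
    exact Measure.isProbabilityMeasure_map (hXm 0).aemeasurable
  have hp0 : Tendsto (fun j => a * (theta d * r j ^ d)) atTop (𝓝 0) := by
    have := ((hr0.pow d).const_mul (theta d)).const_mul a
    simpa [hd.ne'] using this
  obtain ⟨C, hC, r₀, hr₀, hcov⟩ := exists_cover hd hM hAM hA hBA hfc ha haf
  have key := ae_eventually_notMem_of_le (P := P) (s := fun j => {ω | ¬∀ y ∈ B ∩ rInterior M A (r j),
    K j ≤ hits (fun i => X i ω) (geoBall M y (r j)) (N j)}) (hb.mul_left C) (by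
      filter_upwards [hr, hr0.eventually_lt_const hr₀, hp0.eventually_le_const one_pos, hbound]
        with j hj hj₀ hp1 hbj
      obtain ⟨T, S, hT, hSm, hSμ, hS⟩ := hcov (r j) hj hj₀
      have hsub : {ω | ¬∀ y ∈ B ∩ rInterior M A (r j),
          K j ≤ hits (fun i => X i ω) (geoBall M y (r j)) (N j)} ⊆
          ⋃ x ∈ T, {ω | hits (fun i => X i ω) (S x) (N j) < K j} := by
        intro ω hω
        rw [mem_ofPred_eq] at hω
        push Not at hω
        obtain ⟨y, hy, hlt⟩ := hω
        obtain ⟨x, hx, hxy⟩ := hS y hy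
        exact mem_iUnion₂.2 ⟨x, hx, (hits_mono _ hxy le_rfl).trans_lt hlt⟩
      have hp : 0 ≤ a * (theta d * r j ^ d) :=
        mul_nonneg ha.le (mul_nonneg (theta_pos d).le (pow_nonneg hj.le d))
      have hreal : P.real {ω | ¬∀ y ∈ B ∩ rInterior M A (r j),
          K j ≤ hits (fun i => X i ω) (geoBall M y (r j)) (N j)} ≤ C * b j := by
        refine (measureReal_mono hsub (measure_ne_top P _)).trans ((measureReal_biUnion_finset_le _ _).trans ?_)
        have h1 : ∀ x ∈ T, P.real {ω | hits (fun i => X i ω) (S x) (N j) < K j} ≤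
            1 - binTail (a * (theta d * r j ^ d)) (N j) (K j) := fun x hx =>
          measureReal_hits_lt_le hXm hXind hXlaw (hSm x) hp
            ((ENNReal.ofReal_le_iff_le_toReal (measure_ne_top _ _)).1 (hSμ x hx)) _ _
        refine (Finset.sum_le_card_nsmul _ _ _ h1).trans ?_
        rw [nsmul_eq_mul]
        have h2 : 0 ≤ 1 - binTail (a * (theta d * r j ^ d)) (N j) (K j) :=
          sub_nonneg.2 (binTail_mem_Icc ⟨hp, hp1⟩ _ _).2
        calc _ ≤ C / r j ^ d * (1 - binTail (a * (theta d * r j ^ d)) (N j) (K j)) := by gcongr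
          _ = C * ((1 - binTail (a * (theta d * r j ^ d)) (N j) (K j)) / r j ^ d) := by ring
          _ ≤ C * b j := by gcongr
      rw [← ofReal_measureReal]
      exact ENNReal.ofReal_le_ofReal hreal)
  filter_upwards [key] with ω hω
  filter_upwards [hω] with j hj
  exact not_not.1 hj

/-- With `G` the tail for one ball, all balls of the packing are filled with probability at most `G
^ T.card`. This is at most `G`, enough when `k` dominates `log n`, and at most `exp(-T.card * (1 -
G))`, needed when `k` is of order at most `log n`. The constant depends on `a` but not on the
sequences. -/
theorem ae_eventually_uncovered (hd : 0 < d) (hM : IsC2Submanifold d M) (hAM : A ⊆ M)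
    (hA : IsCompact A) (hBA : B ⊆ A) (hfc : ContinuousOn f A) (hB : B = closure (relInterior M B))
    (hXm : ∀ i, Measurable (X i)) (hXind : iIndepFun X P)
    (hXlaw : ∀ i, P.map (X i) = densityMeasure hM f)
    {a : ℝ} (ha : 0 < a) (haf : infOn B f < ENNReal.ofReal a) :
    ∃ c > 0, ∀ {k : ℕ → ℕ} {r b : ℕ → ℝ}, (∀ᶠ n in atTop, 0 < r n) → Tendsto r atTop (𝓝 0) →
      Summable b →
      (∀ᶠ n in atTop, min (binTail (a * (theta d * r n ^ d)) n (k n))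
        (Real.exp (-(c / r n ^ d * (1 - binTail (a * (theta d * r n ^ d)) n (k n))))) ≤ b n) →
      ∀ᵐ ω ∂P, ∀ᶠ n in atTop, ∃ y ∈ B ∩ rInterior M A (r n),
        hits (fun i => X i ω) (geoBall M y (r n)) n < k n := by
  have hμ : IsProbabilityMeasure (densityMeasure hM f) := by
    rw [← hXlaw 0]
    exact Measure.isProbabilityMeasure_map (hXm 0).aemeasurable
  obtain ⟨c, hc, r₀, hr₀, hpack⟩ := exists_packing hd hM hAM hA hBA hfc hB ha haf
  refine ⟨c, hc, fun {k r b} hr hr0 hb hbound => ?_⟩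
  have hp0 : Tendsto (fun n => a * (theta d * r n ^ d)) atTop (𝓝 0) := by
    have := ((hr0.pow d).const_mul (theta d)).const_mul a
    simpa [hd.ne'] using this
  have key := ae_eventually_notMem_of_le (P := P) (s := fun n => {ω | ∀ y ∈ B ∩ rInterior M A (r n),
    k n ≤ hits (fun i => X i ω) (geoBall M y (r n)) n}) hb (by
      filter_upwards [hr, hr0.eventually_lt_const hr₀, hp0.eventually_le_const one_pos, hbound]
        with n hn hn₀ hp1 hbn
      obtain ⟨T, hTc, hTB, hTd, hTμ⟩ := hpack (r n) hn hn₀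
      have hp : 0 ≤ a * (theta d * r n ^ d) :=
        mul_nonneg ha.le (mul_nonneg (theta_pos d).le (pow_nonneg hn.le d))
      set G := binTail (a * (theta d * r n ^ d)) n (k n) with hG
      obtain ⟨hG0, hG1⟩ := binTail_mem_Icc ⟨hp, hp1⟩ n (k n)
      rw [← hG] at hG0 hG1
      have hsub : {ω | ∀ y ∈ B ∩ rInterior M A (r n),
          k n ≤ hits (fun i => X i ω) (geoBall M y (r n)) n} ⊆
          {ω | ∀ x ∈ T, k n ≤ hits (fun i => X i ω) (M ∩ closedBall x (r n)) n} :=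
        fun ω hω x hx => (hω x (hTB hx)).trans
          (hits_mono _ (geoBall_subset_closedBall M x hn.le) le_rfl)
      have h1 : P.real {ω | ∀ y ∈ B ∩ rInterior M A (r n),
          k n ≤ hits (fun i => X i ω) (geoBall M y (r n)) n} ≤ G ^ T.card := by
        refine (measureReal_mono hsub (measure_ne_top P _)).trans ((measureReal_forall_le_hits_le hXm hXind hXlaw
          (S := fun x => M ∩ closedBall x (r n))
          (fun x => hM.measurableSet.inter measurableSet_closedBall) T hTd n fun _ => k n).trans ?_)
        rw [← Finset.prod_const]
        refine Finset.prod_le_prod (fun x _ =>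
          (binTail_mem_Icc ⟨measureReal_nonneg, measureReal_le_one⟩ _ _).1) fun x hx => ?_
        exact binTail_mono measureReal_nonneg
          (ENNReal.toReal_le_of_le_ofReal hp (hTμ x hx)) hp1 _ _
      have hcard : T.card ≠ 0 := by
        intro h0
        rw [h0, Nat.cast_zero] at hTc
        exact absurd hTc (not_le.2 (by positivity))
      have h2 : G ^ T.card ≤ G := pow_le_of_le_one hG0 hG1 hcard
      have h3 : G ^ T.card ≤ Real.exp (-(c / r n ^ d * (1 - G))) := by
        have h4 : G ≤ Real.exp (-(1 - G)) := by
          have := Real.add_one_le_exp (-(1 - G))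
          linarith
        calc G ^ T.card ≤ Real.exp (-(1 - G)) ^ T.card := pow_le_pow_left₀ hG0 h4 _
          _ = Real.exp (-(T.card * (1 - G))) := by rw [← Real.exp_nat_mul]; congr 1; ring
          _ ≤ _ := by
            refine Real.exp_le_exp.2 (neg_le_neg (mul_le_mul_of_nonneg_right hTc ?_))
            linarith
      rw [← ofReal_measureReal]
      exact ENNReal.ofReal_le_ofReal (h1.trans ((le_min h2 h3).trans hbn)))
  filter_upwards [key] with ω hω
  filter_upwards [hω] with n hn
  push Not at hn
  exact hn

end

end Coverage

end

noncomputable section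

namespace Coverage

/-! ### The rate function -/

/-- The rate function `y H(b / y)`, in a form that is jointly continuous for `y > 0`. -/
def rate (y b : ℝ) : ℝ := y - b + b * Real.log b - b * Real.log y

theorem mul_H_div {y b : ℝ} (hy : 0 < y) (hb : 0 ≤ b) : y * H (b / y) = rate y b := by
  -- At `b = 0` the two forms agree because `H 0 = 1` and the terms with factor `b` vanish.
  rcases hb.eq_or_lt with rfl | hb
  · simp [H, rate]
  · rw [H, if_pos (div_pos hb hy), Real.log_div hb.ne' hy.ne', rate]
    field_simp
    ring

/-- The derivative in `y` is `1 - b / y`, which is nonnegative for `y ≥ b`; strictness comes from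
`log t < t - 1` for `t ≠ 1`. -/
theorem rate_strictMono {b y z : ℝ} (hby : b ≤ y) (hy : 0 < y) (hyz : y < z) :
    rate y b < rate z b := by
  have hlog : Real.log z - Real.log y < (z - y) / y := by
    rw [← Real.log_div (by linarith) hy.ne']
    have := Real.log_lt_sub_one_of_pos (div_pos (hy.trans hyz) hy) (by
      rw [Ne, div_eq_one_iff_eq hy.ne']
      exact hyz.ne')
    refine this.trans_eq ?_
    field_simp
  have hlog0 : 0 < Real.log z - Real.log y := sub_pos.2 (Real.log_lt_log hy hyz)
  rw [lt_div_iff₀ hy] at hlog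
  have : b * (Real.log z - Real.log y) ≤ y * (Real.log z - Real.log y) := by gcongr
  unfold rate
  nlinarith

theorem exists_rate_eq_one {b : ℝ} (hb : 0 ≤ b) : ∃ y, b < y ∧ rate y b = 1 := by
  rcases hb.eq_or_lt with rfl | hb
  · exact ⟨1, one_pos, by simp [rate]⟩
  have hcont : ContinuousOn (fun y => rate y b) (Icc b (2 * b + 2)) := by
    unfold rate
    have : ContinuousOn Real.log (Icc b (2 * b + 2)) :=
      Real.continuousOn_log.mono fun y hy => (hb.trans_le hy.1).ne'
    fun_prop
  have h0 : rate b b = 0 := by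
    unfold rate
    ring
  -- From `log t ≤ log 2 + t / 2 - 1 ≤ t / 2` at `t = (2 * b + 2) / b`, the value is at least `(b +
  -- 2) - (b + 1)`.
  have h1 : 1 ≤ rate (2 * b + 2) b := by
    have hlog : Real.log (2 * b + 2) - Real.log b ≤ (2 * b + 2) / b / 2 := by
      rw [← Real.log_div (by positivity) hb.ne']
      have h2 := Real.log_le_sub_one_of_pos (show 0 < (2 * b + 2) / b / 2 by positivity)
      rw [Real.log_div (by positivity) (by norm_num)] at h2
      have h3 : Real.log 2 ≤ 1 := by
        have := Real.log_le_sub_one_of_pos (show (0 : ℝ) < 2 by norm_num)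
        linarith
      linarith
    have h2 := mul_le_mul_of_nonneg_left hlog hb.le
    have h3 : b * ((2 * b + 2) / b / 2) = b + 1 := by
      field_simp
    unfold rate
    nlinarith
  obtain ⟨y, hy, hy1⟩ := intermediate_value_Icc (by linarith) hcont
    (show (1 : ℝ) ∈ Icc (rate b b) (rate (2 * b + 2) b) from ⟨by rw [h0]; exact zero_le_one, h1⟩)
  refine ⟨y, lt_of_le_of_ne hy.1 fun h => ?_, hy1⟩
  simp only at hy1
  rw [← h, h0] at hy1
  norm_num at hy1

/-- The strict inequality leaves room for levels between `b` and `hatH b 1`, where `rate` is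
increasing and below `1`. -/
theorem hatH_spec {b : ℝ} (hb : 0 ≤ b) : b < hatH b 1 ∧ rate (hatH b 1) b = 1 := by
  obtain ⟨y, hby, hy⟩ := exists_rate_eq_one hb
  have hset : {y : ℝ | b ≤ y ∧ y * H (b / y) = 1} = {y} := by
    ext z
    constructor
    · rintro ⟨hz, hz1⟩
      have hz0 : 0 < z := by
        refine lt_of_le_of_ne (hb.trans hz) fun h => ?_
        rw [← h, zero_mul] at hz1
        norm_num at hz1
      rw [mul_H_div hz0 hb] at hz1
      rcases lt_trichotomy z y with h | h | h
      · have := rate_strictMono hz hz0 h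
        linarith
      · exact h
      · have := rate_strictMono hby.le (hb.trans_lt hby) h
        linarith
    · rintro rfl
      exact ⟨hby.le, by rw [mul_H_div (hb.trans_lt hby) hb, hy]⟩
  rw [hatH, hset, csInf_singleton]
  exact ⟨hby, hy⟩

theorem hatH_zero_one : hatH 0 1 = 1 := by
  have := (hatH_spec le_rfl).2
  simpa [rate] using this

theorem continuous_rate_right (y : ℝ) : Continuous fun b => rate y b := by
  unfold rate
  exact ((continuous_const.sub continuous_id).add Real.continuous_mul_log).sub
    (continuous_id.mul continuous_const)

theorem sub_one_sub_log_pos {x : ℝ} (hx : 0 < x) (hx1 : x ≠ 1) : 0 < x - 1 - Real.log x := by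
  have := Real.log_lt_sub_one_of_pos hx hx1
  linarith

/-! ### Asymptotics of binomial tails -/

theorem tendsto_log_natCast : Tendsto (fun n : ℕ => Real.log n) atTop atTop :=
  Real.tendsto_log_atTop.comp tendsto_natCast_atTop_atTop

theorem tendsto_log_div_natCast : Tendsto (fun n : ℕ => Real.log n / n) atTop (𝓝 0) :=
  (Real.isLittleO_log_id_atTop.tendsto_div_nhds_zero).comp tendsto_natCast_atTop_atTop

/-- Stirling's bound up to a factor of order `j`, which is negligible at exponential scale. The
inductive step is `(j + 1) log(1 + 1/j) ≥ 1`. -/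
theorem log_factorial_le (j : ℕ) :
    Real.log (Nat.factorial j) ≤ (j + 1) * Real.log j - j + 1 := by
  induction j with
  | zero => simp
  | succ j ih =>
    rcases Nat.eq_zero_or_pos j with rfl | hj
    · simp
    have hj' : (0 : ℝ) < j := by exact_mod_cast hj
    rw [Nat.factorial_succ, Nat.cast_mul,
      Real.log_mul (by positivity) (by positivity)]
    push_cast
    have h1 : 1 ≤ (j + 1) * (Real.log (j + 1) - Real.log j) := by
      rw [← Real.log_div (by positivity) hj'.ne']
      have := Real.one_sub_inv_le_log_of_pos (show (0 : ℝ) < (j + 1) / j by positivity)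
      have h2 : 1 - ((j + 1 : ℝ) / j)⁻¹ = 1 / (j + 1) := by
        field_simp
        ring
      rw [h2, div_le_iff₀ (by positivity)] at this
      linarith
    linarith

/-- A lower bound for the binomial weights that is sharp to the leading exponential order. -/
theorem exp_le_choose_mul {n j : ℕ} {ℓ c : ℝ} (hℓ : 0 < ℓ) (hc : 0 < c) (hjn : j < n)
    (hp : c * ℓ / n < 1) :
    Real.exp (ℓ * (-rate c (j / ℓ) + c - Real.log j / ℓ - 1 / ℓ
        - j / ℓ * ((j / n) / (1 - j / n)) - c / (1 - c * ℓ / n))) ≤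
      n.choose j * (c * ℓ / n) ^ j * (1 - c * ℓ / n) ^ (n - j) := by
  have hn : (0 : ℝ) < n := by exact_mod_cast (Nat.zero_le j).trans_lt hjn
  have hjn' : (j : ℝ) < n := by exact_mod_cast hjn
  set p := c * ℓ / n with hpdef
  have hp0 : 0 < p := by positivity
  have hnp : n * p = c * ℓ := by rw [hpdef]; field_simp
  have hq1 : (j : ℝ) / n < 1 := (div_lt_one hn).2 hjn'
  have h1p : 0 < 1 - p := by linarith
  have h1q : 0 < 1 - (j : ℝ) / n := by linarith
  have hfac : (0 : ℝ) < Nat.factorial j := by positivity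
  have hch : ((n : ℝ) - j) ^ j / Nat.factorial j ≤ n.choose j := by
    refine le_trans (div_le_div_of_nonneg_right ?_ hfac.le) (Nat.pow_le_choose j n)
    refine pow_le_pow_left₀ (by linarith) ?_ j
    rw [Nat.cast_sub (by omega)]
    push_cast
    linarith
  -- The exponent `n - j` is raised to `n`, which only shrinks the power and decouples the factor
  -- from `j`.
  have hmain : ((n : ℝ) - j) ^ j / Nat.factorial j * p ^ j * (1 - p) ^ n ≤
      n.choose j * p ^ j * (1 - p) ^ (n - j) := by
    have := pow_le_pow_of_le_one h1p.le (by linarith) (Nat.sub_le n j)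
    gcongr
  refine le_trans ?_ hmain
  have hpos : 0 < ((n : ℝ) - j) ^ j / Nat.factorial j * p ^ j * (1 - p) ^ n := by
    have : 0 < (n : ℝ) - j := by linarith
    positivity
  rw [← Real.le_log_iff_exp_le hpos]
  have hnj : (n : ℝ) - j = n * (1 - j / n) := by field_simp
  have hlogeq : Real.log (((n : ℝ) - j) ^ j / Nat.factorial j * p ^ j * (1 - p) ^ n) =
      j * Real.log c + j * Real.log ℓ + j * Real.log (1 - j / n) - Real.log (Nat.factorial j)
        + n * Real.log (1 - p) := by
    have h3 : 0 < (n : ℝ) - j := by linarith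
    rw [Real.log_mul (by positivity) (by positivity), Real.log_mul (by positivity) (by positivity),
      Real.log_div (by positivity) (by positivity), Real.log_pow, Real.log_pow, Real.log_pow, hnj,
      Real.log_mul hn.ne' h1q.ne', hpdef, Real.log_div (by positivity) hn.ne',
      Real.log_mul hc.ne' hℓ.ne']
    ring
  rw [hlogeq]
  have e1 := log_factorial_le j
  have hid : ∀ x : ℝ, x < 1 → -(x / (1 - x)) = 1 - (1 - x)⁻¹ := fun x hx => by
    have : 1 - x ≠ 0 := by linarith
    field_simp
    ring
  have e2 : -((j / n : ℝ) / (1 - j / n)) ≤ Real.log (1 - j / n) := by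
    rw [hid _ hq1]
    exact Real.one_sub_inv_le_log_of_pos h1q
  have e3 : -(p / (1 - p)) ≤ Real.log (1 - p) := by
    rw [hid _ hp]
    exact Real.one_sub_inv_le_log_of_pos h1p
  have e2' := mul_le_mul_of_nonneg_left e2 (Nat.cast_nonneg (α := ℝ) j)
  have e3' := mul_le_mul_of_nonneg_left e3 hn.le
  have e4 : n * -(p / (1 - p)) = -(c * ℓ / (1 - p)) := by
    rw [← hnp]
    ring
  rw [e4] at e3'
  have e5 : (j : ℝ) * Real.log (j / ℓ) = j * Real.log j - j * Real.log ℓ := by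
    rcases Nat.eq_zero_or_pos j with rfl | hj
    · simp
    · have : (0 : ℝ) < j := by exact_mod_cast hj
      rw [Real.log_div this.ne' hℓ.ne']
      ring
  have e6 : ℓ * (-rate c (j / ℓ) + c - Real.log j / ℓ - 1 / ℓ
        - j / ℓ * ((j / n) / (1 - j / n)) - c / (1 - p)) =
      j - j * Real.log (j / ℓ) + j * Real.log c - Real.log j - 1
        - j * ((j / n) / (1 - j / n)) - c * ℓ / (1 - p) := by
    have h3 : ℓ * rate c (j / ℓ) = ℓ * c - j + j * Real.log (j / ℓ) - j * Real.log c := by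
      unfold rate
      field_simp
    have h4 : ℓ * (Real.log j / ℓ) = Real.log j := by field_simp
    have h5 : ℓ * (1 / ℓ) = 1 := by field_simp
    have h6 : ℓ * (j / ℓ * ((j / n : ℝ) / (1 - j / n))) = j * ((j / n) / (1 - j / n)) := by
      rw [← mul_assoc]
      congr 1
      field_simp
    have h7 : ℓ * (c / (1 - p)) = c * ℓ / (1 - p) := by ring
    rw [mul_sub, mul_sub, mul_sub, mul_sub, mul_add, mul_neg, h3, h4, h5, h6, h7]
    ring
  rw [e6, e5]
  linarith

/-- Take the single weight at `j = k n - 1`. Since `k n = O(log n)`, all corrections in the exponent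
of `exp_le_choose_mul` vanish after division by `log n`, which leaves `-rate c b`. -/
theorem eventually_exp_le_one_sub_binTail {k : ℕ → ℕ} (hk : ∀ n, 1 ≤ n → 1 ≤ k n) {b c ζ : ℝ}
    (hkb : Tendsto (fun n : ℕ => (k n : ℝ) / Real.log n) atTop (𝓝 b)) (hc : 0 < c)
    (hζ : rate c b < ζ) :
    ∀ᶠ n : ℕ in atTop,
      Real.exp (-(ζ * Real.log n)) ≤ 1 - binTail (c * Real.log n / n) n (k n) := by
  have hlog := tendsto_log_natCast
  have hinv : Tendsto (fun n : ℕ => 1 / Real.log n) atTop (𝓝 0) :=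
    hlog.inv_tendsto_atTop.congr fun n => (one_div _).symm
  have hkn : Tendsto (fun n : ℕ => (k n : ℝ) / n) atTop (𝓝 0) := by
    have h1 := hkb.mul tendsto_log_div_natCast
    rw [mul_zero] at h1
    refine h1.congr' ?_
    filter_upwards [hlog.eventually_gt_atTop 0] with n hn
    field_simp
  have hu : Tendsto (fun n : ℕ => ((k n - 1 : ℕ) : ℝ) / Real.log n) atTop (𝓝 b) := by
    have h1 := hkb.sub hinv
    rw [sub_zero] at h1
    refine h1.congr' ?_
    filter_upwards [eventually_ge_atTop 1] with n hn
    rw [Nat.cast_sub (hk n hn), Nat.cast_one]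
    ring
  have hq : Tendsto (fun n : ℕ => ((k n - 1 : ℕ) : ℝ) / n) atTop (𝓝 0) := by
    refine squeeze_zero (fun n => by positivity) (fun n => ?_) hkn
    gcongr
    omega
  have hp : Tendsto (fun n : ℕ => c * Real.log n / n) atTop (𝓝 0) := by
    have := tendsto_log_div_natCast.const_mul c
    rw [mul_zero] at this
    exact this.congr fun n => by ring
  -- Uses `log j ≤ 2 √j` and `j = O(log n)`.
  have hlj : Tendsto (fun n : ℕ => Real.log ((k n - 1 : ℕ) : ℝ) / Real.log n) atTop (𝓝 0) := by
    have hs : Tendsto (fun n : ℕ => 2 * Real.sqrt (((k n - 1 : ℕ) : ℝ) / Real.log n *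
        (1 / Real.log n))) atTop (𝓝 0) := by
      have := ((hu.mul hinv).sqrt).const_mul 2
      simpa using this
    refine squeeze_zero' ?_ ?_ hs
    · filter_upwards [hlog.eventually_gt_atTop 0] with n hn
      exact div_nonneg (Real.log_natCast_nonneg _) hn.le
    · filter_upwards [hlog.eventually_gt_atTop 0] with n hn
      set j : ℝ := ((k n - 1 : ℕ) : ℝ)
      have hj : 0 ≤ j := Nat.cast_nonneg _
      have h1 : j / Real.log n * (1 / Real.log n) = j / Real.log n ^ 2 := by
        field_simp
      rw [h1, Real.sqrt_div hj, Real.sqrt_sq hn.le, ← mul_div_assoc]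
      gcongr
      rcases hj.eq_or_lt with h0 | h0
      · rw [← h0]
        simp
      · have := Real.log_le_sub_one_of_pos (Real.sqrt_pos.2 h0)
        rw [Real.log_sqrt hj] at this
        linarith
  have hlim : Tendsto (fun n : ℕ => -rate c (((k n - 1 : ℕ) : ℝ) / Real.log n) + c
      - Real.log ((k n - 1 : ℕ) : ℝ) / Real.log n - 1 / Real.log n
      - ((k n - 1 : ℕ) : ℝ) / Real.log n *
        ((((k n - 1 : ℕ) : ℝ) / n) / (1 - ((k n - 1 : ℕ) : ℝ) / n))
      - c / (1 - c * Real.log n / n)) atTop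
      (𝓝 (-rate c b + c - 0 - 0 - b * (0 / (1 - 0)) - c / (1 - 0))) := by
    refine ((((((((continuous_rate_right c).tendsto b).comp hu).neg.add_const c).sub hlj).sub
      hinv).sub (hu.mul (hq.div (hq.const_sub 1) (by norm_num)))).sub
      ((tendsto_const_nhds (x := c)).div (hp.const_sub 1) (by norm_num)))
  have hlim' : -rate c b + c - 0 - 0 - b * (0 / (1 - 0)) - c / (1 - 0) = -rate c b := by
    norm_num
  rw [hlim'] at hlim
  filter_upwards [hlim.eventually_const_lt (neg_lt_neg hζ), hlog.eventually_gt_atTop 0,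
    hp.eventually_lt_const one_pos, hq.eventually_lt_const one_pos, eventually_ge_atTop 1]
    with n hn hℓ hp1 hq1 hn1
  have hn0 : (0 : ℝ) < n := by exact_mod_cast hn1
  have hjn : k n - 1 < n := by
    rw [div_lt_one hn0] at hq1
    exact_mod_cast hq1
  refine le_trans ?_ ((exp_le_choose_mul hℓ hc hjn hp1).trans
    (choose_mul_le_one_sub_binTail ⟨by positivity, hp1.le⟩ (by have := hk n hn1; omega)))
  refine Real.exp_le_exp.2 ?_
  nlinarith

end Coverage

end

noncomputable section

namespace Coverage

/-! ### Strong laws for abstract thresholds -/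

/-- The radius `r` with `n θ_d r^d = t L`. -/
def radius (d : ℕ) (t L : ℝ) (n : ℕ) : ℝ := (t * L / n / theta d) ^ ((d : ℝ)⁻¹)

theorem theta_mul_radius_pow {d : ℕ} (hd : 0 < d) {t L : ℝ} (ht : 0 ≤ t) (hL : 0 ≤ L) (n : ℕ) :
    theta d * radius d t L n ^ d = t * L / n := by
  have hθ := theta_pos d
  rw [radius, Real.rpow_inv_natCast_pow (by positivity) hd.ne', mul_div_cancel₀ _ hθ.ne']

theorem radius_pos {d : ℕ} {t L : ℝ} (ht : 0 < t) (hL : 0 < L) {n : ℕ} (hn : 0 < n) :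
    0 < radius d t L n := by
  have hθ := theta_pos d
  have : (0 : ℝ) < n := by exact_mod_cast hn
  exact Real.rpow_pos_of_pos (by positivity) _

theorem tendsto_radius {d : ℕ} (hd : 0 < d) (t : ℝ) {L : ℕ → ℝ} {N : ℕ → ℕ}
    (h : Tendsto (fun j => L j / N j) atTop (𝓝 0)) :
    Tendsto (fun j => radius d t (L j) (N j)) atTop (𝓝 0) := by
  have h1 : Tendsto (fun j => t * L j / N j / theta d) atTop (𝓝 0) := by
    have := (h.const_mul t).div_const (theta d)
    rw [mul_zero, zero_div] at this
    exact this.congr fun j => by ring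
  have h2 := h1.rpow_const (p := (d : ℝ)⁻¹) (Or.inr (by positivity))
  rwa [Real.zero_rpow (by positivity)] at h2

theorem div_radius_pow {d : ℕ} (hd : 0 < d) {t L : ℝ} (ht : 0 < t) (hL : 0 < L) {n : ℕ}
    (hn : 0 < n) (u : ℝ) : u / radius d t L n ^ d = u * (theta d / t * n / L) := by
  have hr := pow_pos (radius_pos (d := d) ht hL hn) d
  have hn' : (0 : ℝ) < n := by exact_mod_cast hn
  have h := theta_mul_radius_pow hd ht.le hL.le n
  have h2 : theta d / t * n / L = theta d / (t * L / n) := by field_simp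
  rw [h2, ← h, div_eq_mul_inv]
  have hθ := (theta_pos d).ne'
  congr 1
  field_simp

/-- The normalized threshold `n θ_d R^d / L`. -/
def ratio (d n : ℕ) (R : ℝ≥0∞) (L : ℝ) : ℝ≥0∞ :=
  (n : ℝ≥0∞) * ENNReal.ofReal (theta d) * R ^ d / ENNReal.ofReal L

theorem ratio_ofReal {d n : ℕ} {r L : ℝ} (hr : 0 ≤ r) (hL : 0 < L) :
    ratio d n (ENNReal.ofReal r) L = ENNReal.ofReal (n * theta d * r ^ d / L) := by
  have hθ := theta_pos d
  rw [ratio, ENNReal.ofReal_div_of_pos hL, ENNReal.ofReal_mul (by positivity),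
    ENNReal.ofReal_mul (by positivity), ENNReal.ofReal_natCast, ENNReal.ofReal_pow hr]

theorem ratio_mono {d n : ℕ} {R R' : ℝ≥0∞} (L : ℝ) (h : R ≤ R') :
    ratio d n R L ≤ ratio d n R' L := by
  unfold ratio
  gcongr

theorem ratio_radius {d n : ℕ} (hd : 0 < d) {t L : ℝ} (ht : 0 < t) (hL : 0 < L) (hn : 0 < n) :
    ratio d n (ENNReal.ofReal (radius d t L n)) L = ENNReal.ofReal t := by
  have hn' : (0 : ℝ) < n := by exact_mod_cast hn
  rw [ratio_ofReal (radius_pos ht hL hn).le hL, mul_assoc, theta_mul_radius_pow hd ht.le hL.le]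
  congr 1
  field_simp

theorem summable_exp_neg_two_mul_log : Summable fun n : ℕ => Real.exp (-(2 * Real.log n)) := by
  refine ((Real.summable_nat_rpow (p := -2)).2 (by norm_num)).congr_atTop ?_
  filter_upwards [eventually_ge_atTop 1] with n hn
  have hn' : (0 : ℝ) < n := by exact_mod_cast hn
  rw [Real.rpow_def_of_pos hn']
  congr 1
  ring

section Abstract

variable {Ω : Type*} [MeasurableSpace Ω] {P : Measure Ω} {R : Ω → ℕ → ℕ → ℝ≥0∞} {d : ℕ}

/-- Balls of radius `r` are filled as if the density were at least `a`. -/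
def FilledAtDensity (P : Measure Ω) (R : Ω → ℕ → ℕ → ℝ≥0∞) (d : ℕ) (a : ℝ) : Prop :=
  ∀ (N K : ℕ → ℕ) (r b : ℕ → ℝ), (∀ᶠ j in atTop, 0 < r j) → Tendsto r atTop (𝓝 0) → Summable b →
    (∀ᶠ j in atTop, (1 - binTail (a * (theta d * r j ^ d)) (N j) (K j)) / r j ^ d ≤ b j) →
    ∀ᵐ ω ∂P, ∀ᶠ j in atTop, ∀ n k, N j ≤ n → k ≤ K j → R ω n k ≤ ENNReal.ofReal (r j)

/-- Some balls of radius `r` are filled as if the density were at most `a`. -/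
def UnfilledAtDensity (P : Measure Ω) (R : Ω → ℕ → ℕ → ℝ≥0∞) (d : ℕ) (a : ℝ) : Prop :=
  ∃ c > 0, ∀ (k : ℕ → ℕ) (r b : ℕ → ℝ), (∀ᶠ n in atTop, 0 < r n) → Tendsto r atTop (𝓝 0) →
    Summable b →
    (∀ᶠ n in atTop, min (binTail (a * (theta d * r n ^ d)) n (k n))
      (Real.exp (-(c / r n ^ d * (1 - binTail (a * (theta d * r n ^ d)) n (k n))))) ≤ b n) →
    ∀ᵐ ω ∂P, ∀ᶠ n in atTop, ENNReal.ofReal (r n) ≤ R ω n (k n)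

/-- At mean `c * k n` with `c > 1`, Chernoff's exponent is a positive multiple of `k n` and so beats
any multiple of `log n`; no subsequence is needed. -/
theorem ae_eventually_ratio_le_of_dominates_log (hd : 0 < d) {a c : ℝ} (ha : 0 < a) (hc : 1 < c)
    (hU : FilledAtDensity P R d a) {k : ℕ → ℕ} (hk : ∀ n, 1 ≤ n → 1 ≤ k n)
    (hkl : ∀ C : ℝ, ∀ᶠ n : ℕ in atTop, C * Real.log n ≤ k n)
    (hkn : Tendsto (fun n : ℕ => (k n : ℝ) / n) atTop (𝓝 0)) :
    ∀ᵐ ω ∂P, ∀ᶠ n : ℕ in atTop, ratio d n (R ω n (k n)) (k n) ≤ ENNReal.ofReal (c / a) := by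
  have hc0 : 0 < c := by linarith
  have ht : 0 < c / a := div_pos hc0 ha
  have hθ := theta_pos d
  set η := c - 1 - Real.log c with hη
  have hη0 : 0 < η := sub_one_sub_log_pos hc0 hc.ne'
  have hkpos : ∀ᶠ n : ℕ in atTop, 0 < n ∧ (0 : ℝ) < k n := by
    filter_upwards [eventually_ge_atTop 1] with n hn
    exact ⟨hn, by exact_mod_cast hk n hn⟩
  have hckn : Tendsto (fun n : ℕ => c * k n / n) atTop (𝓝 0) := by
    have := hkn.const_mul c
    rw [mul_zero] at this
    exact this.congr fun n => by ring
  have h := hU id k (fun n => radius d (c / a) (k n) n)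
    (fun n => theta d / (c / a) * Real.exp (-(2 * Real.log n)))
    (hkpos.mono fun n hn => radius_pos ht hn.2 hn.1) (tendsto_radius hd _ hkn)
    (summable_exp_neg_two_mul_log.mul_left _) (by
      -- Of the three powers of `n` gained, one pays for the `O(n)` balls and two give summability.
      filter_upwards [hkpos, hkl (3 / η), hckn.eventually_le_const one_pos] with n hn hkl hp1
      have hn' : (0 : ℝ) < n := by exact_mod_cast hn.1
      have hp : a * (theta d * radius d (c / a) (k n) n ^ d) = c * k n / n := by
        rw [theta_mul_radius_pow hd ht.le hn.2.le]
        field_simp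
      have hp0 : 0 ≤ c * k n / n := by positivity
      have hb := one_sub_binTail_le_exp (p := c * k n / n) ⟨hp0, hp1⟩ hc.le (n := n) (k := k n)
        (by field_simp)
      rw [hp, div_radius_pow hd ht hn.2 hn.1, id]
      have h3 : 3 * Real.log n ≤ k n * η := by
        rw [div_mul_eq_mul_div, div_le_iff₀ hη0] at hkl
        exact hkl
      have h1k : (1 : ℝ) ≤ k n := by exact_mod_cast hk n hn.1
      calc (1 - binTail (c * k n / n) n (k n)) * (theta d / (c / a) * n / k n)
          ≤ Real.exp (-(k n * η)) * (theta d / (c / a) * n) := by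
            gcongr
            exact div_le_self (by positivity) h1k
        _ ≤ Real.exp (-(3 * Real.log n)) * (theta d / (c / a) * n) := by gcongr
        _ = theta d / (c / a) * (Real.exp (Real.log n) * Real.exp (-(3 * Real.log n))) := by
            rw [Real.exp_log hn']
            ring
        _ = _ := by
            rw [← Real.exp_add]
            congr 2
            ring)
  filter_upwards [h] with ω hω
  filter_upwards [hω, hkpos] with n hn hpos
  exact (ratio_mono _ (hn n (k n) le_rfl le_rfl)).trans (ratio_radius hd ht hpos.2 hpos.1).le

/-- Below the mean `k n` even one given ball is filled with probability at most `n⁻²`, so the first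
entry of the minimum suffices. -/
theorem ae_eventually_le_ratio_of_dominates_log (hd : 0 < d) {a c : ℝ} (ha : 0 < a) (hc0 : 0 < c)
    (hc : c < 1) (hL : UnfilledAtDensity P R d a) {k : ℕ → ℕ} (hk : ∀ n, 1 ≤ n → 1 ≤ k n)
    (hkl : ∀ C : ℝ, ∀ᶠ n : ℕ in atTop, C * Real.log n ≤ k n)
    (hkn : Tendsto (fun n : ℕ => (k n : ℝ) / n) atTop (𝓝 0)) :
    ∀ᵐ ω ∂P, ∀ᶠ n : ℕ in atTop, ENNReal.ofReal (c / a) ≤ ratio d n (R ω n (k n)) (k n) := by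
  have ht : 0 < c / a := div_pos hc0 ha
  set η := c - 1 - Real.log c with hη
  have hη0 : 0 < η := sub_one_sub_log_pos hc0 hc.ne
  have hkpos : ∀ᶠ n : ℕ in atTop, 0 < n ∧ (0 : ℝ) < k n := by
    filter_upwards [eventually_ge_atTop 1] with n hn
    exact ⟨hn, by exact_mod_cast hk n hn⟩
  have hckn : Tendsto (fun n : ℕ => c * k n / n) atTop (𝓝 0) := by
    have := hkn.const_mul c
    rw [mul_zero] at this
    exact this.congr fun n => by ring
  obtain ⟨c₁, -, hL⟩ := hL
  have h := hL k (fun n => radius d (c / a) (k n) n) (fun n => Real.exp (-(2 * Real.log n)))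
    (hkpos.mono fun n hn => radius_pos ht hn.2 hn.1) (tendsto_radius hd _ hkn)
    summable_exp_neg_two_mul_log (by
      filter_upwards [hkpos, hkl (2 / η), hckn.eventually_le_const one_pos] with n hn hkl hp1
      have hn' : (0 : ℝ) < n := by exact_mod_cast hn.1
      have hp : a * (theta d * radius d (c / a) (k n) n ^ d) = c * k n / n := by
        rw [theta_mul_radius_pow hd ht.le hn.2.le]
        field_simp
      have hp0 : 0 ≤ c * k n / n := by positivity
      have hb := binTail_le_exp (p := c * k n / n) ⟨hp0, hp1⟩ hc0 hc.le (n := n) (k := k n)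
        (by field_simp)
      rw [hp]
      refine (min_le_left _ _).trans (hb.trans (Real.exp_le_exp.2 (neg_le_neg ?_)))
      rw [div_mul_eq_mul_div, div_le_iff₀ hη0] at hkl
      exact hkl)
  filter_upwards [h] with ω hω
  filter_upwards [hω, hkpos] with n hn hpos
  exact (ratio_radius hd ht hpos.2 hpos.1).ge.trans (ratio_mono _ hn)

/-- About `n / log n` disjoint balls each fail with probability at least `n^(-ζ)`, `ζ < 1`; the
expected number of failures far exceeds `2 log n`. -/
theorem ae_eventually_le_ratio_of_tendsto (hd : 0 < d) {a b c : ℝ} (ha : 0 < a) (hc0 : 0 < c)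
    (hc : rate c b < 1) (hL : UnfilledAtDensity P R d a) {k : ℕ → ℕ} (hk : ∀ n, 1 ≤ n → 1 ≤ k n)
    (hkb : Tendsto (fun n : ℕ => (k n : ℝ) / Real.log n) atTop (𝓝 b)) :
    ∀ᵐ ω ∂P, ∀ᶠ n : ℕ in atTop,
      ENNReal.ofReal (c / a) ≤ ratio d n (R ω n (k n)) (Real.log n) := by
  have ht : 0 < c / a := div_pos hc0 ha
  have hθ := theta_pos d
  obtain ⟨ζ, hζ, hζ1⟩ := exists_between hc
  set δ := 1 - ζ with hδ
  have hδ0 : 0 < δ := by linarith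
  have hpos : ∀ᶠ n : ℕ in atTop, 0 < n ∧ 0 < Real.log n :=
    (eventually_gt_atTop 0).and (tendsto_log_natCast.eventually_gt_atTop 0)
  obtain ⟨c₁, hc₁, hL⟩ := hL
  -- The cubic term of the exponential series gives `exp(δ ℓ) ≥ (δ ℓ)³ / 6`; after division by `ℓ`
  -- this leaves `G ℓ²`, which is at least `2 ℓ` eventually.
  set G := c₁ * (theta d / (c / a)) * δ ^ 3 / 6 with hG
  have hG0 : 0 < G := by positivity
  have h := hL k (fun n => radius d (c / a) (Real.log n) n)
    (fun n => Real.exp (-(2 * Real.log n)))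
    (hpos.mono fun n hn => radius_pos ht hn.2 hn.1) (tendsto_radius hd _ tendsto_log_div_natCast)
    summable_exp_neg_two_mul_log (by
      filter_upwards [hpos, eventually_exp_le_one_sub_binTail hk hkb hc0 hζ,
        tendsto_log_natCast.eventually_ge_atTop (2 / G)] with n hn hb hlarge
      have hn' : (0 : ℝ) < n := by exact_mod_cast hn.1
      have hℓ := hn.2
      have hp : a * (theta d * radius d (c / a) (Real.log n) n ^ d) = c * Real.log n / n := by
        rw [theta_mul_radius_pow hd ht.le hℓ.le]
        field_simp
      rw [hp]
      refine (min_le_right _ _).trans (Real.exp_le_exp.2 (neg_le_neg ?_))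
      rw [div_radius_pow hd ht hℓ hn.1]
      set ℓ := Real.log n with hℓdef
      have hexp : (δ * ℓ) ^ 3 / 6 ≤ Real.exp (δ * ℓ) := by
        have := Real.pow_div_factorial_le_exp (δ * ℓ) (by positivity) 3
        simpa [Nat.factorial] using this
      calc 2 * ℓ ≤ G * ℓ * ℓ := by
            rw [div_le_iff₀ hG0] at hlarge
            nlinarith
        _ = c₁ * (theta d / (c / a) / ℓ) * ((δ * ℓ) ^ 3 / 6) := by
            rw [hG]
            field_simp
        _ ≤ c₁ * (theta d / (c / a) / ℓ) * Real.exp (δ * ℓ) := by gcongr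
        _ = c₁ * (theta d / (c / a) * Real.exp ℓ / ℓ) * Real.exp (-(ζ * ℓ)) := by
            have : δ * ℓ = ℓ + -(ζ * ℓ) := by rw [hδ]; ring
            rw [this, Real.exp_add]
            ring
        _ = c₁ * (theta d / (c / a) * n / ℓ) * Real.exp (-(ζ * ℓ)) := by
            rw [hℓdef, Real.exp_log hn']
        _ ≤ _ := by gcongr)
  filter_upwards [h] with ω hω
  filter_upwards [hω, hpos] with n hn hpos
  exact (ratio_radius hd ht hpos.2 hpos.1).ge.trans (ratio_mono _ hn)

/-- Every `n` lies in a block between consecutive `κ`-th powers. -/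
theorem exists_block {κ : ℕ} (hκ : κ ≠ 0) : ∃ J : ℕ → ℕ, Tendsto J atTop atTop ∧
    ∀ n, J n ^ κ ≤ n ∧ n < (J n + 1) ^ κ := by
  refine ⟨fun n => Nat.findGreatest (fun j => j ^ κ ≤ n) n, ?_, fun n => ⟨?_, ?_⟩⟩
  · refine tendsto_atTop.2 fun j => ?_
    filter_upwards [eventually_ge_atTop (j ^ κ)] with n hn
    exact Nat.le_findGreatest ((Nat.le_self_pow hκ j).trans hn) hn
  · exact Nat.findGreatest_spec (P := fun j => j ^ κ ≤ n) (Nat.zero_le n) (by simp [hκ])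
  · by_contra! hcon
    have := Nat.le_findGreatest (P := fun j => j ^ κ ≤ n) ((Nat.le_self_pow hκ _).trans hcon) hcon
    omega

theorem tendsto_ceil_mul_log_div_log {κ : ℕ} (hκ : 0 < κ) {b : ℝ} (hb : 0 ≤ b) :
    Tendsto (fun j : ℕ => (⌈b * (κ * Real.log (j + 1))⌉₊ : ℝ) / (κ * Real.log j)) atTop (𝓝 b) := by
  have hκ' : (0 : ℝ) < κ := by exact_mod_cast hκ
  have hℓ : Tendsto (fun j : ℕ => κ * Real.log j) atTop atTop :=
    tendsto_log_natCast.const_mul_atTop hκ'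
  have hup : Tendsto (fun j : ℕ => b + (b * κ + 1) * (κ * Real.log j)⁻¹) atTop (𝓝 b) := by
    have := (hℓ.inv_tendsto_atTop.const_mul (b * κ + 1)).const_add b
    simpa using this
  refine tendsto_of_tendsto_of_tendsto_of_le_of_le' tendsto_const_nhds hup ?_ ?_
  · filter_upwards [hℓ.eventually_gt_atTop 0, eventually_gt_atTop 0] with j hj hj0
    have hj0' : (0 : ℝ) < j := by exact_mod_cast hj0
    rw [le_div_iff₀ hj]
    refine le_trans ?_ (Nat.le_ceil _)
    gcongr
    linarith
  · filter_upwards [hℓ.eventually_gt_atTop 0, eventually_gt_atTop 0] with j hj hj0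
    have hj0' : (1 : ℝ) ≤ j := by exact_mod_cast hj0
    have hlog0 : 0 ≤ Real.log (j + 1) := Real.log_nonneg (by linarith)
    rw [div_le_iff₀ hj, add_mul, mul_assoc, inv_mul_cancel₀ hj.ne', mul_one]
    refine (Nat.ceil_lt_add_one (by positivity)).le.trans ?_
    have h1 : Real.log (j + 1) ≤ Real.log j + 1 := by
      have h2 := Real.log_le_sub_one_of_pos (show (0 : ℝ) < (j + 1) / j by positivity)
      rw [Real.log_div (by positivity) (by positivity), add_div, div_self (by positivity)] at h2
      have h3 : 1 / (j : ℝ) ≤ 1 := (div_le_one (by positivity)).2 hj0'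
      linarith
    have h2 : b * (κ * Real.log (j + 1)) ≤ b * (κ * (Real.log j + 1)) := by gcongr
    linarith

/-- The failure bound is only a possibly small negative power of the sample size, so Borel–Cantelli
is applied at the sizes `j ^ κ`. Within a block, more points and a smaller `k` only help, and the
slack from `c'` to `c` absorbs the block length because `((j + 1) / j) ^ κ → 1`. -/
theorem ae_eventually_ratio_le_of_tendsto (hd : 0 < d) {a b₀ c h : ℝ} (ha : 0 < a) (hb₀ : 0 ≤ b₀)
    (hbh : b₀ < h) (hh : rate h b₀ = 1) (hc : h < c) (hU : FilledAtDensity P R d a) {k : ℕ → ℕ}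
    (hkb : Tendsto (fun n : ℕ => (k n : ℝ) / Real.log n) atTop (𝓝 b₀)) :
    ∀ᵐ ω ∂P, ∀ᶠ n : ℕ in atTop,
      ratio d n (R ω n (k n)) (Real.log n) ≤ ENNReal.ofReal (c / a) := by
  have hθ := theta_pos d
  obtain ⟨c', hhc', hc'c⟩ := exists_between hc
  have hh0 : 0 < h := hb₀.trans_lt hbh
  have hc'0 : 0 < c' := hh0.trans hhc'
  have hc0 : 0 < c := hc'0.trans hc'c
  have hrate : 1 < rate c' b₀ := hh ▸ rate_strictMono hbh.le hh0 hhc'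
  -- A `b` above `b₀` makes `K j`, computed at the right end of the block, dominate eventually every
  -- `k n` in it, while the rate stays above `1`.
  obtain ⟨b, hbb₀, hbc', hrb⟩ : ∃ b, b₀ < b ∧ b < c' ∧ 1 < rate c' b := by
    have h1 : ∀ᶠ b in 𝓝[>] b₀, 1 < rate c' b :=
      (((continuous_rate_right c').tendsto b₀).mono_left nhdsWithin_le_nhds).eventually_const_lt
        hrate
    have h2 : ∀ᶠ b in 𝓝[>] b₀, b < c' :=
      (tendsto_id.mono_left nhdsWithin_le_nhds).eventually_lt_const (hbh.trans hhc')
    obtain ⟨b, ⟨h3, h4⟩, h5⟩ := ((h1.and h2).and eventually_mem_nhdsWithin).exists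
    exact ⟨b, h5, h4, h3⟩
  have hb0 : 0 < b := hb₀.trans_lt hbb₀
  obtain ⟨y, hy1, hyr⟩ := exists_between hrb
  set η := y - 1 with hη
  have hη0 : 0 < η := by linarith
  -- With `κ * η > 2`, the bound `N j * (N j)^(-(1 + η)) = j^(-κ η)` is summable in `j`.
  obtain ⟨κ, hκ⟩ := exists_nat_gt (2 / η)
  have hκ0 : (0 : ℝ) < κ := lt_trans (by positivity) hκ
  have hκpos : 0 < κ := by exact_mod_cast hκ0
  rw [div_lt_iff₀ hη0] at hκ
  have hs : 0 < c' / a := div_pos hc'0 ha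
  set N : ℕ → ℕ := fun j => j ^ κ with hN
  set K : ℕ → ℕ := fun j => ⌈b * (κ * Real.log (j + 1))⌉₊ with hK
  have hlogN : ∀ j : ℕ, Real.log (N j : ℕ) = κ * Real.log j := fun j => by
    rw [hN]
    push_cast
    rw [Real.log_pow]
  have hℓ : Tendsto (fun j : ℕ => κ * Real.log j) atTop atTop :=
    tendsto_log_natCast.const_mul_atTop hκ0
  have hNt : Tendsto N atTop atTop := tendsto_pow_atTop hκpos.ne'
  have hKt : Tendsto (fun j : ℕ => (K j : ℝ) / (κ * Real.log j)) atTop (𝓝 b) :=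
    tendsto_ceil_mul_log_div_log hκpos hb0.le
  have hNpos : ∀ᶠ j in atTop, 0 < N j := hNt.eventually_gt_atTop 0
  have hdiv : Tendsto (fun j : ℕ => (κ * Real.log j) / N j) atTop (𝓝 0) :=
    (tendsto_log_div_natCast.comp hNt).congr fun j => by
      rw [Function.comp, hlogN]
  have hpt : Tendsto (fun j : ℕ => c' * (κ * Real.log j) / N j) atTop (𝓝 0) := by
    have := hdiv.const_mul c'
    rw [mul_zero] at this
    exact this.congr fun n => by ring
  have hmain := hU N K (fun j => radius d (c' / a) (κ * Real.log j) (N j))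
    (fun j => theta d / (c' / a) * Real.exp (-(2 * Real.log j)))
    ((hNpos.and (hℓ.eventually_gt_atTop 0)).mono fun j hj => radius_pos hs hj.2 hj.1)
    (tendsto_radius hd _ hdiv) (summable_exp_neg_two_mul_log.mul_left _) (by
      filter_upwards [hNpos, hℓ.eventually_ge_atTop 1, hKt.eventually_lt_const hbc',
        hKt.eventually_const_lt hb0, hpt.eventually_le_const one_pos,
        (((continuous_rate_right c').tendsto b).comp hKt).eventually_const_lt hyr,
        tendsto_log_natCast.eventually_ge_atTop 0]
        with j hNj hℓj hKc hKpos hp1 hrj hlogj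
      have hN' : (0 : ℝ) < N j := by exact_mod_cast hNj
      have hNexp : (N j : ℝ) = Real.exp (κ * Real.log j) := by rw [← hlogN, Real.exp_log hN']
      set ℓ := κ * Real.log j with hℓdef
      have hℓ0 : 0 < ℓ := by linarith
      have hK0 : (0 : ℝ) < K j := by
        rw [lt_div_iff₀ hℓ0, zero_mul] at hKpos
        exact hKpos
      have hp : a * (theta d * radius d (c' / a) ℓ (N j) ^ d) = c' * ℓ / N j := by
        rw [theta_mul_radius_pow hd hs.le hℓ0.le]
        field_simp
      have hp0 : 0 ≤ c' * ℓ / N j := by positivity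
      have hx1 : 1 ≤ c' * ℓ / K j := by
        rw [div_lt_iff₀ hℓ0] at hKc
        rw [le_div_iff₀ hK0]
        linarith
      have hb := one_sub_binTail_le_exp (p := c' * ℓ / N j) ⟨hp0, hp1⟩ hx1 (n := N j) (k := K j)
        (by field_simp)
      have hexp : K j * (c' * ℓ / K j - 1 - Real.log (c' * ℓ / K j)) =
          ℓ * rate c' (K j / ℓ) := by
        rw [Real.log_div (by positivity) hK0.ne', Real.log_mul hc'0.ne' hℓ0.ne', rate,
          Real.log_div hK0.ne' hℓ0.ne']
        field_simp
        ring
      rw [hexp] at hb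
      have hrj' : ℓ * (1 + η) ≤ ℓ * rate c' (K j / ℓ) := by
        refine mul_le_mul_of_nonneg_left ?_ hℓ0.le
        rw [hη]
        have : y < rate c' (K j / ℓ) := hrj
        linarith
      rw [hp, div_radius_pow hd hs hℓ0 hNj]
      calc (1 - binTail (c' * ℓ / N j) (N j) (K j)) * (theta d / (c' / a) * N j / ℓ)
          ≤ Real.exp (-(ℓ * (1 + η))) * (theta d / (c' / a) * N j) := by
            gcongr
            · exact hb.trans (Real.exp_le_exp.2 (neg_le_neg hrj'))
            · exact div_le_self (by positivity) hℓj
        _ = theta d / (c' / a) * (Real.exp ℓ * Real.exp (-(ℓ * (1 + η)))) := by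
            rw [hNexp]
            ring
        _ = theta d / (c' / a) * Real.exp (-(η * κ * Real.log j)) := by
            rw [← Real.exp_add, hℓdef]
            congr 2
            ring
        _ ≤ _ := by
            gcongr
            linarith)
  obtain ⟨J, hJt, hJ⟩ := exists_block hκpos.ne'
  have hgrow : ∀ᶠ j : ℕ in atTop, ((j : ℝ) + 1) ^ κ ≤ c / c' * j ^ κ := by
    have h1 : Tendsto (fun j : ℕ => (1 + 1 / (j : ℝ)) ^ κ) atTop (𝓝 ((1 + 0) ^ κ)) :=
      (tendsto_one_div_atTop_nhds_zero_nat.const_add 1).pow κ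
    rw [add_zero, one_pow] at h1
    filter_upwards [h1.eventually_lt_const ((one_lt_div hc'0).2 hc'c), eventually_gt_atTop 0]
      with j hj hj0
    have hj0' : (0 : ℝ) < j := by exact_mod_cast hj0
    have h2 : (j : ℝ) + 1 = (1 + 1 / j) * j := by field_simp
    rw [h2, mul_pow]
    gcongr
  filter_upwards [hmain] with ω hω
  filter_upwards [hJt.eventually hω, hJt.eventually hgrow, hJt.eventually hNpos,
    hJt.eventually (hℓ.eventually_gt_atTop 0), hkb.eventually_lt_const hbb₀,
    tendsto_log_natCast.eventually_gt_atTop 0, eventually_gt_atTop 0]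
    with n hn hg hNJ hℓJ hkn hlog hn0
  have hn0' : (0 : ℝ) < n := by exact_mod_cast hn0
  have hN' : (0 : ℝ) < N (J n) := by exact_mod_cast hNJ
  have hJ1 : (n : ℝ) ≤ ((J n : ℝ) + 1) ^ κ := by exact_mod_cast (hJ n).2.le
  have hkK : k n ≤ K (J n) := by
    have h1 : (k n : ℝ) ≤ b * (κ * Real.log (J n + 1)) := by
      rw [div_lt_iff₀ hlog] at hkn
      refine hkn.le.trans (mul_le_mul_of_nonneg_left ?_ hb0.le)
      rw [← Real.log_pow]
      exact Real.log_le_log hn0' hJ1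
    exact Nat.cast_le.1 (h1.trans (Nat.le_ceil _))
  refine (ratio_mono _ (hn n (k n) (hJ n).1 hkK)).trans ?_
  rw [ratio_ofReal (radius_pos hs hℓJ hNJ).le hlog, mul_assoc,
    theta_mul_radius_pow hd hs.le hℓJ.le]
  refine ENNReal.ofReal_le_ofReal ?_
  have h1 : (n : ℝ) ≤ c / c' * N (J n) := by
    refine hJ1.trans (hg.trans (le_of_eq ?_))
    rw [hN]
    push_cast
    rfl
  have h2 : κ * Real.log (J n) ≤ Real.log n := by
    rw [← hlogN]
    exact Real.log_le_log hN' (by exact_mod_cast (hJ n).1)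
  rw [div_le_iff₀ hlog]
  calc (n : ℝ) * (c' / a * (κ * Real.log (J n)) / N (J n))
      ≤ (c / c' * N (J n)) * (c' / a * Real.log n / N (J n)) := by gcongr
    _ = c / a * Real.log n := by field_simp

/-- Two-sided bounds at all densities above and below `F` identify the limit. -/
theorem ae_tendsto_ratio {Q : Ω → ℕ → ℝ≥0∞} {F : ℝ≥0∞} (hF : F ≠ ∞) {h c₀ : ℝ} (hc₀ : c₀ < h)
    (hh : 0 < h)
    (hup : ∀ c a : ℝ, h < c → 0 < a → ENNReal.ofReal a < F →
      ∀ᵐ ω ∂P, ∀ᶠ n in atTop, Q ω n ≤ ENNReal.ofReal (c / a))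
    (hlow : ∀ c a : ℝ, 0 < c → c₀ < c → c < h → 0 < a → F < ENNReal.ofReal a →
      ∀ᵐ ω ∂P, ∀ᶠ n in atTop, ENNReal.ofReal (c / a) ≤ Q ω n) :
    ∀ᵐ ω ∂P, Tendsto (Q ω) atTop (𝓝 (ENNReal.ofReal h / F)) := by
  lift F to NNReal using hF
  have hup' : ∀ q : ℚ, ENNReal.ofReal h / F < ENNReal.ofReal q →
      ∀ᵐ ω ∂P, ∀ᶠ n in atTop, Q ω n ≤ ENNReal.ofReal q := by
    intro q hq
    -- For `F = 0` the limit is `∞` and no upper bound is required.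
    have hF0 : F ≠ 0 := by
      rintro rfl
      rw [ENNReal.coe_zero, ENNReal.div_zero (by simpa using hh)] at hq
      exact absurd hq not_top_lt
    have hF0' : (0 : ℝ) < F := by
      rw [NNReal.coe_pos]
      exact pos_iff_ne_zero.2 hF0
    have hq0 : (0 : ℝ) < q := ENNReal.ofReal_pos.1 (bot_le.trans_lt hq)
    rw [← ENNReal.ofReal_coe_nnreal, ← ENNReal.ofReal_div_of_pos hF0',
      ENNReal.ofReal_lt_ofReal_iff hq0, div_lt_iff₀ hF0'] at hq
    obtain ⟨c, hc1, hc2⟩ := exists_between hq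
    have hc0 : 0 < c := hh.trans hc1
    -- The density `a = c / q` makes the level `c / a` equal to `q`.
    have := hup c (c / q) hc1 (by positivity) (by
      rw [← ENNReal.ofReal_coe_nnreal, ENNReal.ofReal_lt_ofReal_iff hF0', div_lt_iff₀ hq0]
      linarith)
    rwa [div_div_cancel₀ hc0.ne'] at this
  have hlow' : ∀ q : ℚ, ENNReal.ofReal q < ENNReal.ofReal h / F →
      ∀ᵐ ω ∂P, ∀ᶠ n in atTop, ENNReal.ofReal q ≤ Q ω n := by
    intro q hq
    rcases le_or_gt (q : ℝ) 0 with hq0 | hq0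
    · simp [ENNReal.ofReal_of_nonpos hq0]
    have hqF : (q : ℝ) * F < h := by
      rw [ENNReal.lt_div_iff_mul_lt (Or.inr ENNReal.ofReal_ne_top) (Or.inl ENNReal.coe_ne_top),
        ← ENNReal.ofReal_coe_nnreal, ← ENNReal.ofReal_mul hq0.le,
        ENNReal.ofReal_lt_ofReal_iff hh] at hq
      exact hq
    obtain ⟨c, hc1, hc2⟩ := exists_between (max_lt hc₀ (max_lt hqF hh))
    have hcc₀ : c₀ < c := (le_max_left _ _).trans_lt hc1
    have hcF : (q : ℝ) * F < c := ((le_max_left _ _).trans (le_max_right _ _)).trans_lt hc1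
    have hc0 : 0 < c := ((le_max_right _ _).trans (le_max_right _ _)).trans_lt hc1
    have := hlow c (c / q) hc0 hcc₀ hc2 (by positivity) (by
      rw [← ENNReal.ofReal_coe_nnreal, ENNReal.ofReal_lt_ofReal_iff (by positivity),
        lt_div_iff₀ hq0]
      linarith)
    rwa [div_div_cancel₀ hc0.ne'] at this
  -- Rational levels suffice to pin down the limit, and countably many null sets may be discarded
  -- together.
  have h1 : ∀ᵐ ω ∂P, ∀ q : ℚ, ENNReal.ofReal h / F < ENNReal.ofReal q →
      ∀ᶠ n in atTop, Q ω n ≤ ENNReal.ofReal q := by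
    refine ae_all_iff.2 fun q => ?_
    by_cases hq : ENNReal.ofReal h / F < ENNReal.ofReal q
    · exact (hup' q hq).mono fun ω hω _ => hω
    · exact Eventually.of_forall fun ω h => absurd h hq
  have h2 : ∀ᵐ ω ∂P, ∀ q : ℚ, ENNReal.ofReal q < ENNReal.ofReal h / F →
      ∀ᶠ n in atTop, ENNReal.ofReal q ≤ Q ω n := by
    refine ae_all_iff.2 fun q => ?_
    by_cases hq : ENNReal.ofReal q < ENNReal.ofReal h / F
    · exact (hlow' q hq).mono fun ω hω _ => hω
    · exact Eventually.of_forall fun ω h => absurd h hq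
  filter_upwards [h1, h2] with ω hω1 hω2
  refine tendsto_order.2 ⟨fun x hx => ?_, fun x hx => ?_⟩
  · obtain ⟨q, -, hq1, hq2⟩ := ENNReal.lt_iff_exists_rat_btwn.1 hx
    exact (hω2 q hq2).mono fun n hn => hq1.trans_le hn
  · obtain ⟨q, -, hq1, hq2⟩ := ENNReal.lt_iff_exists_rat_btwn.1 hx
    exact (hω1 q hq1).mono fun n hn => hn.trans_lt hq2

/-- The strong law when `k n` dominates `log n`. -/
theorem ae_tendsto_ratio_of_dominates_log (hd : 0 < d) {F : ℝ≥0∞} (hF : F ≠ ∞)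
    (hU : ∀ a : ℝ, 0 < a → ENNReal.ofReal a < F → FilledAtDensity P R d a)
    (hL : ∀ a : ℝ, 0 < a → F < ENNReal.ofReal a → UnfilledAtDensity P R d a)
    {k : ℕ → ℕ} (hk : ∀ n, 1 ≤ n → 1 ≤ k n)
    (hkl : ∀ C : ℝ, ∀ᶠ n : ℕ in atTop, C * Real.log n ≤ k n)
    (hkn : Tendsto (fun n : ℕ => (k n : ℝ) / n) atTop (𝓝 0)) :
    ∀ᵐ ω ∂P, Tendsto (fun n => ratio d n (R ω n (k n)) (k n)) atTop (𝓝 F⁻¹) := by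
  have := ae_tendsto_ratio (P := P) (Q := fun ω n => ratio d n (R ω n (k n)) (k n)) hF
    one_pos one_pos
    (fun c a hc ha haF => ae_eventually_ratio_le_of_dominates_log hd ha hc (hU a ha haF) hk hkl hkn)
    (fun c a hc0 _ hc ha haF =>
      ae_eventually_le_ratio_of_dominates_log hd ha hc0 hc (hL a ha haF) hk hkl hkn)
  rwa [ENNReal.ofReal_one, one_div] at this

/-- The strong law when `k n` is of order at most `log n`. -/
theorem ae_tendsto_ratio_of_tendsto (hd : 0 < d) {F : ℝ≥0∞} (hF : F ≠ ∞)
    (hU : ∀ a : ℝ, 0 < a → ENNReal.ofReal a < F → FilledAtDensity P R d a)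
    (hL : ∀ a : ℝ, 0 < a → F < ENNReal.ofReal a → UnfilledAtDensity P R d a)
    {k : ℕ → ℕ} (hk : ∀ n, 1 ≤ n → 1 ≤ k n) {b : ℝ} (hb : 0 ≤ b)
    (hkb : Tendsto (fun n : ℕ => (k n : ℝ) / Real.log n) atTop (𝓝 b)) :
    ∀ᵐ ω ∂P, Tendsto (fun n : ℕ => ratio d n (R ω n (k n)) (Real.log n)) atTop
      (𝓝 (ENNReal.ofReal (hatH b 1) / F)) := by
  obtain ⟨hbh, hrate⟩ := hatH_spec hb
  refine ae_tendsto_ratio (P := P) (Q := fun ω n => ratio d n (R ω n (k n)) (Real.log n)) hF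
    hbh (hb.trans_lt hbh)
    (fun c a hc ha haF =>
      ae_eventually_ratio_le_of_tendsto hd ha hb hbh hrate hc (hU a ha haF) hkb)
    (fun c a hc0 hbc hc ha haF => ?_)
  have : rate c b < 1 := hrate ▸ rate_strictMono hbc.le hc0 hc
  exact ae_eventually_le_ratio_of_tendsto hd ha hc0 this (hL a ha haF) hk hkb

/-- All three laws for an abstract threshold process. -/
theorem ae_tendsto_ratio_all (hd : 0 < d) {F : ℝ≥0∞} (hF : F ≠ ∞)
    (hU : ∀ a : ℝ, 0 < a → ENNReal.ofReal a < F → FilledAtDensity P R d a)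
    (hL : ∀ a : ℝ, 0 < a → F < ENNReal.ofReal a → UnfilledAtDensity P R d a)
    {β : ℝ≥0∞} {k : ℕ → ℕ} (hk : ∀ n, 1 ≤ n → 1 ≤ k n)
    (hkβ : Tendsto (fun n : ℕ => (k n : ℝ≥0∞) / ENNReal.ofReal (Real.log n)) atTop (𝓝 β))
    (hkn : Tendsto (fun n : ℕ => (k n : ℝ) / n) atTop (𝓝 0)) :
    (β = ∞ → ∀ᵐ ω ∂P, Tendsto (fun n : ℕ => (n : ℝ≥0∞) * ENNReal.ofReal (theta d)
        * R ω n (k n) ^ d / (k n : ℝ≥0∞)) atTop (𝓝 F⁻¹)) ∧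
      (β ≠ ∞ → ∀ᵐ ω ∂P, Tendsto (fun n : ℕ => (n : ℝ≥0∞) * ENNReal.ofReal (theta d)
        * R ω n (k n) ^ d / ENNReal.ofReal (Real.log n)) atTop
          (𝓝 (ENNReal.ofReal (hatH β.toReal 1) / F))) ∧
      (0 < F → ∀ k₀ : ℕ, 1 ≤ k₀ → ∀ᵐ ω ∂P, Tendsto (fun n : ℕ => (n : ℝ≥0∞) *
        ENNReal.ofReal (theta d) * F * R ω n k₀ ^ d / ENNReal.ofReal (Real.log n)) atTop (𝓝 1)) := by
  refine ⟨fun hβ => ?_, fun hβ => ?_, fun hF0 k₀ hk₀ => ?_⟩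
  · subst hβ
    have hkl : ∀ C : ℝ, ∀ᶠ n : ℕ in atTop, C * Real.log n ≤ k n := fun C => by
      filter_upwards [hkβ.eventually_const_lt (ENNReal.ofReal_lt_top (r := C)),
        tendsto_log_natCast.eventually_gt_atTop 0] with n hn hlog
      rw [← ENNReal.ofReal_natCast, ← ENNReal.ofReal_div_of_pos hlog] at hn
      rw [← le_div_iff₀ hlog]
      exact (ENNReal.ofReal_lt_ofReal_iff'.1 hn).1.le
    have := ae_tendsto_ratio_of_dominates_log hd hF hU hL hk hkl hkn
    simpa only [ratio, ENNReal.ofReal_natCast] using this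
  · refine ae_tendsto_ratio_of_tendsto hd hF hU hL hk ENNReal.toReal_nonneg ?_
    refine ((ENNReal.tendsto_toReal hβ).comp hkβ).congr fun n => ?_
    rw [Function.comp, ENNReal.toReal_div, ENNReal.toReal_natCast,
      ENNReal.toReal_ofReal (Real.log_natCast_nonneg n)]
  · have hk₀' : Tendsto (fun n : ℕ => (k₀ : ℝ) / Real.log n) atTop (𝓝 0) :=
      tendsto_const_nhds.div_atTop tendsto_log_natCast
    have := ae_tendsto_ratio_of_tendsto hd hF hU hL (k := fun _ => k₀) (fun _ _ => hk₀) le_rfl hk₀'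
    rw [hatH_zero_one, ENNReal.ofReal_one] at this
    filter_upwards [this] with ω hω
    have h1 := ENNReal.Tendsto.const_mul (a := F) hω (Or.inr hF)
    rw [one_div, ENNReal.mul_inv_cancel hF0.ne' hF] at h1
    refine h1.congr fun n => ?_
    rw [ratio, div_eq_mul_inv, div_eq_mul_inv]
    ring

end Abstract

/-! ### Coverage thresholds -/

/-- A functional of point sequences that is characterized by the coverage of small balls. -/
structure IsCoverageThreshold {m : ℕ} (M A B : Set (E m)) (thr : (ℕ → E m) → ℕ → ℕ → ℝ≥0∞) :
    Prop where
  le_of_covered : ∃ r₁ > 0, ∀ (x : ℕ → E m) (n k : ℕ) (r : ℝ), Function.Injective x → 0 < r →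
    r < r₁ → (∀ y ∈ B ∩ rInterior M A r, k ≤ hits x (geoBall M y r) n) →
    thr x n k ≤ ENNReal.ofReal r
  ge_of_uncovered : ∀ (x : ℕ → E m) (n k : ℕ) (r : ℝ),
    (∃ y ∈ B ∩ rInterior M A r, hits x (geoBall M y r) n < k) → ENNReal.ofReal r ≤ thr x n k

theorem natCast_le_encard_of_le_hits {m : ℕ} {x : ℕ → E m} (hx : Function.Injective x)
    {S : Set (E m)} {n k : ℕ} (h : k ≤ hits x S n) : (k : ℕ∞) ≤ (firstPoints x n ∩ S).encard := by
  rw [encard_firstPoints_inter hx]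
  exact_mod_cast h

theorem le_hits_of_natCast_le_encard {m : ℕ} {x : ℕ → E m} {S : Set (E m)} {n k : ℕ}
    (h : (k : ℕ∞) ≤ (firstPoints x n ∩ S).encard) : k ≤ hits x S n := by
  exact_mod_cast h.trans (encard_firstPoints_inter_le x S n)

/-- An uncovered point for radius `r` stays uncovered for every `s ≤ r`: its ball shrinks, and it
remains in the larger `s`-interior. -/
theorem isCoverageThreshold_int {m : ℕ} (M A B : Set (E m)) :
    IsCoverageThreshold M A B (intCovThreshold M A B) where
  le_of_covered := ⟨1, one_pos, fun _ _ _ r hx hr _ h =>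
    sInf_le ⟨r, ⟨hr, fun y hy => natCast_le_encard_of_le_hits hx (h y hy)⟩, rfl⟩⟩
  ge_of_uncovered := by
    rintro x n k r ⟨y, hy, hlt⟩
    refine le_sInf ?_
    rintro _ ⟨s, ⟨hs, h⟩, rfl⟩
    by_contra! hcon
    have hsr : s ≤ r := (ENNReal.ofReal_lt_ofReal_iff'.1 hcon).1.le
    have h1 := le_hits_of_natCast_le_encard (h y ⟨hy.1, rInterior_anti M A hsr hy.2⟩)
    have h2 := hits_mono x (geoBall_mono M y hsr) (le_refl n)
    omega

/-- For small `r` the whole of `B` is `r`-interior, so restricting to the `r`-interior changes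
nothing at the relevant scale. -/
theorem isCoverageThreshold_cov {m : ℕ} {M A B : Set (E m)} (hBA : B ⊆ A) (hB : IsCompact B)
    (hBi : B ⊆ relInterior M A) : IsCoverageThreshold M A B (covThreshold M B) where
  le_of_covered := by
    obtain ⟨r₁, hr₁, hsub⟩ := exists_subset_rInterior hBA hB hBi
    exact ⟨r₁, hr₁, fun _ _ _ r hx hr hrr h => sInf_le ⟨r, ⟨hr, fun y hy =>
      natCast_le_encard_of_le_hits hx (h y ⟨hy, hsub r hr hrr hy⟩)⟩, rfl⟩⟩
  ge_of_uncovered := by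
    rintro x n k r ⟨y, hy, hlt⟩
    refine le_sInf ?_
    rintro _ ⟨s, ⟨hs, h⟩, rfl⟩
    by_contra! hcon
    have hsr : s ≤ r := (ENNReal.ofReal_lt_ofReal_iff'.1 hcon).1.le
    have h1 := le_hits_of_natCast_le_encard (h y hy.1)
    have h2 := hits_mono x (geoBall_mono M y hsr) (le_refl n)
    omega

section Thresholds

variable {m d : ℕ} {M A B : Set (E m)} {f : E m → ℝ} {Ω : Type*} [MeasurableSpace Ω]
  {P : Measure Ω} [IsProbabilityMeasure P] {X : ℕ → Ω → E m}
  {thr : (ℕ → E m) → ℕ → ℕ → ℝ≥0∞}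

theorem IsCoverageThreshold.filledAtDensity (hthr : IsCoverageThreshold M A B thr) (hd : 0 < d)
    (hM : IsC2Submanifold d M) (hAM : A ⊆ M) (hA : IsCompact A) (hBA : B ⊆ A)
    (hfc : ContinuousOn f A) (hXm : ∀ i, Measurable (X i)) (hXind : iIndepFun X P)
    (hXlaw : ∀ i, P.map (X i) = densityMeasure hM f) {a : ℝ} (ha : 0 < a)
    (haf : ENNReal.ofReal a < infOn B f) :
    FilledAtDensity P (fun ω => thr fun i => X i ω) d a := by
  intro N K r b hr hr0 hb hbound
  obtain ⟨r₁, hr₁, hle⟩ := hthr.le_of_covered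
  filter_upwards [ae_eventually_covered hd hM hAM hA hBA hfc hXm hXind hXlaw ha haf hr hr0 hb
    hbound, ae_injective hXm hXind hXlaw (densityMeasure_singleton hM hd)] with ω hω hinj
  filter_upwards [hω, hr, hr0.eventually_lt_const hr₁] with j hj hrj hrj₁ n k hn hk
  exact hle _ n k (r j) hinj hrj hrj₁ fun y hy =>
    hk.trans ((hj y hy).trans (hits_mono _ subset_rfl hn))

theorem IsCoverageThreshold.unfilledAtDensity (hthr : IsCoverageThreshold M A B thr) (hd : 0 < d)
    (hM : IsC2Submanifold d M) (hAM : A ⊆ M) (hA : IsCompact A) (hBA : B ⊆ A)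
    (hfc : ContinuousOn f A) (hB : B = closure (relInterior M B)) (hXm : ∀ i, Measurable (X i))
    (hXind : iIndepFun X P) (hXlaw : ∀ i, P.map (X i) = densityMeasure hM f) {a : ℝ} (ha : 0 < a)
    (haf : infOn B f < ENNReal.ofReal a) :
    UnfilledAtDensity P (fun ω => thr fun i => X i ω) d a := by
  obtain ⟨c, hc, h⟩ := ae_eventually_uncovered hd hM hAM hA hBA hfc hB hXm hXind hXlaw ha haf
  refine ⟨c, hc, fun k r b hr hr0 hb hbound => ?_⟩
  filter_upwards [h hr hr0 hb hbound] with ω hω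
  exact hω.mono fun n hn => hthr.ge_of_uncovered _ _ _ _ hn

end Thresholds

end Coverage

end

/-! ### The strong laws for both coverage thresholds -/

theorem mainTheorem4 {d m : ℕ} (hd : 2 ≤ d)
    {M : Set (Coverage.E m)} (hM : Coverage.IsC2Submanifold d M)
    {A : Set (Coverage.E m)} (hA : Coverage.IsSubmanifoldWithBoundary d M A) (hAc : IsCompact A)
    {B : Set (Coverage.E m)} (hBA : B ⊆ A) (hBc : IsClosed B)
    (hB : B = closure (Coverage.relInterior M B))
    {f : Coverage.E m → ℝ} (hf : Coverage.IsProbDensity hM f) (hfA : ∀ x ∈ M \ A, f x = 0)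
    (hfc : ContinuousOn f A) (hμB : 0 < Coverage.densityMeasure hM f B)
    {Ω : Type*} [MeasurableSpace Ω] (P : Measure Ω) [IsProbabilityMeasure P]
    (X : ℕ → Ω → Coverage.E m) (hXm : ∀ i, Measurable (X i)) (hXind : iIndepFun X P)
    (hXlaw : ∀ i, P.map (X i) = Coverage.densityMeasure hM f)
    (β : ℝ≥0∞) (k : ℕ → ℕ) (hk : ∀ n, 1 ≤ n → 1 ≤ k n)
    (hkβ : Tendsto (fun n : ℕ => (k n : ℝ≥0∞) / ENNReal.ofReal (Real.log n)) atTop (𝓝 β))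
    (hkn : Tendsto (fun n : ℕ => (k n : ℝ) / n) atTop (𝓝 0)) :
    -- the interior coverage threshold
    ((β = ∞ → ∀ᵐ ω ∂P, Tendsto
        (fun n : ℕ => (n : ℝ≥0∞) * ENNReal.ofReal (Coverage.theta d)
          * Coverage.intCovThreshold M A B (fun i => X i ω) n (k n) ^ d / (k n : ℝ≥0∞))
        atTop (𝓝 (Coverage.infOn B f)⁻¹)) ∧
      (β ≠ ∞ → ∀ᵐ ω ∂P, Tendsto
        (fun n : ℕ => (n : ℝ≥0∞) * ENNReal.ofReal (Coverage.theta d)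
          * Coverage.intCovThreshold M A B (fun i => X i ω) n (k n) ^ d
            / ENNReal.ofReal (Real.log n))
        atTop (𝓝 (ENNReal.ofReal (Coverage.hatH β.toReal 1) / Coverage.infOn B f))) ∧
      (0 < Coverage.infOn B f → ∀ k₀ : ℕ, 1 ≤ k₀ → ∀ᵐ ω ∂P, Tendsto
        (fun n : ℕ => (n : ℝ≥0∞) * ENNReal.ofReal (Coverage.theta d) * Coverage.infOn B f
          * Coverage.intCovThreshold M A B (fun i => X i ω) n k₀ ^ d
            / ENNReal.ofReal (Real.log n))
        atTop (𝓝 1))) ∧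
    -- the coverage threshold, for `B` in the interior of `A`
    (B ⊆ Coverage.relInterior M A →
      (β = ∞ → ∀ᵐ ω ∂P, Tendsto
        (fun n : ℕ => (n : ℝ≥0∞) * ENNReal.ofReal (Coverage.theta d)
          * Coverage.covThreshold M B (fun i => X i ω) n (k n) ^ d / (k n : ℝ≥0∞))
        atTop (𝓝 (Coverage.infOn B f)⁻¹)) ∧
      (β ≠ ∞ → ∀ᵐ ω ∂P, Tendsto
        (fun n : ℕ => (n : ℝ≥0∞) * ENNReal.ofReal (Coverage.theta d)
          * Coverage.covThreshold M B (fun i => X i ω) n (k n) ^ d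
            / ENNReal.ofReal (Real.log n))
        atTop (𝓝 (ENNReal.ofReal (Coverage.hatH β.toReal 1) / Coverage.infOn B f))) ∧
      (0 < Coverage.infOn B f → ∀ k₀ : ℕ, 1 ≤ k₀ → ∀ᵐ ω ∂P, Tendsto
        (fun n : ℕ => (n : ℝ≥0∞) * ENNReal.ofReal (Coverage.theta d) * Coverage.infOn B f
          * Coverage.covThreshold M B (fun i => X i ω) n k₀ ^ d
            / ENNReal.ofReal (Real.log n))
        atTop (𝓝 1))) := by
  have hd0 : 0 < d := by omega
  have hB' : IsCompact B := hAc.of_isClosed_subset hBc hBA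
  -- Positive measure makes `B` nonempty, so the infimum is not the empty one.
  have hF : Coverage.infOn B f ≠ ∞ := by
    obtain ⟨x, hx⟩ := nonempty_of_measure_ne_zero hμB.ne'
    exact ne_top_of_le_ne_top ENNReal.ofReal_ne_top (iInf₂_le x hx)
  have key : ∀ thr : (ℕ → Coverage.E m) → ℕ → ℕ → ℝ≥0∞,
      Coverage.IsCoverageThreshold M A B thr → _ := fun thr hthr =>
    Coverage.ae_tendsto_ratio_all (P := P) (R := fun ω => thr fun i => X i ω) hd0 hF
      (fun a ha haf => hthr.filledAtDensity hd0 hM hA.1 hAc hBA hfc hXm hXind hXlaw ha haf)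
      (fun a ha haf => hthr.unfilledAtDensity hd0 hM hA.1 hAc hBA hfc hB hXm hXind hXlaw ha haf)
      hk hkβ hkn
  exact ⟨key _ (Coverage.isCoverageThreshold_int M A B),
    fun hBi => key _ (Coverage.isCoverageThreshold_cov hBA hB' hBi)⟩
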